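/- \textbf{Conventions.} For a partition $\lambda=(\lambda_1\ge\dots\ge\lambda_t>0)$ put $\lambda_i=0$ for $i>t$, let $Y(\lambda)=\{(i,j): 1\le i\le t,\ 1\le j\le\lambda_i\}$ be its Young diagram and $\lambda'$ its conjugate. For $(i,j)\in Y(\lambda)$ the rim hook $R_{i,j}$ is the set of all $(i',j')\in Y(\lambda)$ with $i'\ge i$, $j'\ge j$ and $(i'+1,j'+1)\notin Y(\lambda)$; its size is its number of boxes and its arm length is $\lambda_i-j$. Let $d,e$ be positive integers. The partition $\lambda$ is \emph{$d$-balanced} (respectively \emph{$d$-shift balanced}) if every rim hook of $\lambda$ of size divisible by $e$ has arm length congruent to $0$ (respectively $-1$) modulo $d$. It is \emph{$e$-regular} if no $e$ of its (positive) parts are equal. The \emph{$e$-core} of $\lambda$ is the partition without rim hooks of size $e$ obtained from $\lambda$ by successively removing rim hooks of size $e$. The \emph{$d$-runner matrix} $\mathcal R_d(\lambda)$ is the $(d-1)\times e$ matrix, indexed by $1\le x\le d-1$ and $0\le y\le e-1$, whose $(x,y)$ entry is the number of indices $i\ge 1$ with $\lambda_i\equiv x \pmod d$ and $\lambda_i\equiv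 i+y\pmod e$. \textbf{The Mullineux map.} The rim of $\lambda$ is the set of $(i,j)\in Y(\lambda)$ with $(i+1,j+1)\notin Y(\lambda)$. The \emph{$e$-rim} of $\lambda$ is a union of segments of the rim: the first segment consists of the first $e$ boxes met (or all of them, if there are fewer) when one follows the rim from the last box of the first row downwards and to the left; each further segment is formed in the same way, starting from the last box of the row just below the lowest row met by the preceding segment, until the last row of $\lambda$ is reached. Put $\lambda^{(0)}=\lambda$ and let $\lambda^{(i+1)}$ be $\lambda^{(i)}$ with its $e$-rim removed; let $a_i(\lambda)$ be the size of the $e$-rim of $\lambda^{(i)}$ and $r_i(\lambda)$ the number of parts of $\lambda^{(i)}$. For an $e$-regular $\lambda$, the Mullineux image $m_e(\lambda)$ is the $e$-regular partition $\mu$ such that, for all $i\ge0$, $a_i(\mu)=a_i(\lambda)$ and $r_i(\mu)=a_i(\lambda)-r_i(\lambda)+\varepsilon_i$, where $\varepsilon_i=0$ if $e\mid a_i(\lambda)$ and $\varepsilon_i=1$ otherwise. \textbf{Theorem.} Let $1<d<e$ be coprime integers and let $\lambda$ be a $d$-balanced partition such that the first row ($x=1$) of $\mathcal R_d(\lambda)$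 contains at least one $0$. Then $\lambda$ is $e$-regular, $m_e(\lambda)$ is well defined (exactly one partition $\mu$ as above exists), and $m_e(\lambda)'$ is a $d$-shift balanced partition with the same $d$-runner matrix and the same $e$-core as $\lambda$. Moreover, $m_e(\lambda)'$ is the only $d$-shift balanced partition with the same $d$-runner matrix and the same $e$-core as $\lambda$. -/

import Mathlib

/-!
Partitions are Mathlib's Young diagrams. Boxes `(i, j)` are indexed from `0`: `i` is the row and
`j` the column, `μ.rowLen i` is the `(i + 1)`-st part, `μ.colLen 0` is the number of parts and
`μ.transpose` is the conjugate partition.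
-/

namespace YoungDiagram

/-- The rim: the boxes `(i, j)` of the diagram such that `(i + 1, j + 1)` is not in the diagram. -/
def rim (μ : YoungDiagram) : Finset (ℕ × ℕ) :=
  μ.cells.filter fun b => (b.1 + 1, b.2 + 1) ∉ μ

/-- The rim hook attached to the box `c`: the rim boxes weakly below and weakly to the right
of `c`. -/
def rimHook (μ : YoungDiagram) (c : ℕ × ℕ) : Finset (ℕ × ℕ) :=
  μ.rim.filter fun b => c.1 ≤ b.1 ∧ c.2 ≤ b.2

/-- The arm length of the rim hook of a box `c` of the diagram: the number of boxes of its row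
strictly to the right of `c`. -/
def armLength (μ : YoungDiagram) (c : ℕ × ℕ) : ℕ :=
  μ.rowLen c.1 - (c.2 + 1)

/-- The partition obtained by removing the rim hook attached to the box `c`. -/
def removeRimHook (μ : YoungDiagram) (c : ℕ × ℕ) : YoungDiagram where
  cells := μ.cells \ μ.rimHook c
  isLowerSet := by
    rintro ⟨a', b'⟩ ⟨a, b⟩ hle h
    obtain ⟨h1, h2⟩ : a ≤ a' ∧ b ≤ b' := hle
    simp only [rimHook, rim, Finset.coe_sdiff, Set.mem_sdiff, Finset.mem_coe, mem_cells,
      Finset.mem_filter, not_and] at h ⊢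
    refine ⟨μ.up_left_mem h1 h2 h.1, fun h3 h4 h5 => ?_⟩
    refine h.2 ⟨h.1, fun h6 => h3.2 ?_⟩ (h4.trans h1) (h5.trans h2)
    exact μ.up_left_mem (Nat.succ_le_succ h1) (Nat.succ_le_succ h2) h6

/-- `ν` is obtained from `μ` by removing one rim hook of size `e`. -/
def RemovesHook (e : ℕ) (μ ν : YoungDiagram) : Prop :=
  ∃ c ∈ μ, (μ.rimHook c).card = e ∧ ν = μ.removeRimHook c

/-- `μ` has no rim hook of size `e`. -/
def IsCore (e : ℕ) (μ : YoungDiagram) : Prop :=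
  ∀ c ∈ μ, (μ.rimHook c).card ≠ e

/-- `γ` is the `e`-core of `μ`: a partition without rim hooks of size `e` that is reached from `μ`
by successively removing rim hooks of size `e`. -/
def IsCoreOf (e : ℕ) (γ μ : YoungDiagram) : Prop :=
  Relation.ReflTransGen (RemovesHook e) μ γ ∧ IsCore e γ

/-- `μ` and `ν` have the same `e`-core. -/
def SameCore (e : ℕ) (μ ν : YoungDiagram) : Prop :=
  ∃ γ, IsCoreOf e γ μ ∧ IsCoreOf e γ ν

/-- `μ` does not have `e` equal (positive) parts. -/
def IsRegular (e : ℕ) (μ : YoungDiagram) : Prop :=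
  ∀ k, μ.rowLens.count k < e

/-- All rim hooks of size divisible by `e` have arm length congruent to `0` modulo `d`. -/
def IsBalanced (d e : ℕ) (μ : YoungDiagram) : Prop :=
  ∀ c ∈ μ, e ∣ (μ.rimHook c).card → (μ.armLength c : ℤ) ≡ 0 [ZMOD d]

/-- All rim hooks of size divisible by `e` have arm length congruent to `-1` modulo `d`. -/
def IsShiftBalanced (d e : ℕ) (μ : YoungDiagram) : Prop :=
  ∀ c ∈ μ, e ∣ (μ.rimHook c).card → (μ.armLength c : ℤ) ≡ -1 [ZMOD d]

/-- The `d`-runner matrix, with rows `x = 1, …, d - 1` (the row `x` has index `x - 1`) and columns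
`y = 0, …, e - 1`. The entry at `(x, y)` is the number of `i ≥ 1` such that the `i`-th part is
congruent to `x` modulo `d` and to `i + y` modulo `e`. As `x` is not divisible by `d`, only the
positive parts matter. The variable `k` below is `i - 1`. -/
def runnerMatrix (d e : ℕ) (μ : YoungDiagram) : Matrix (Fin (d - 1)) (Fin e) ℕ := fun x y =>
  ((Finset.range (μ.colLen 0)).filter fun k =>
    μ.rowLen k ≡ (x : ℕ) + 1 [MOD d] ∧ μ.rowLen k ≡ (k + 1) + (y : ℕ) [MOD e]).card

/-! ### The Mullineux map -/

/-- The segment of the `e`-rim that starts at the last box of row `t`: the first `e` rim boxes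
(or all of them, if there are fewer) met when one follows the rim from this box downwards and to
the left. Each step along the rim lowers `j - i` by one, so these are the rim boxes `(i, j)` with
`t ≤ i` whose `j - i` exceeds `(μ.rowLen t - 1) - t - e`. -/
def rimSegment (e : ℕ) (μ : YoungDiagram) (t : ℕ) : Finset (ℕ × ℕ) :=
  μ.rim.filter fun b => t ≤ b.1 ∧ μ.rowLen t + b.1 < b.2 + e + t + 1

/-- The row below the last row met by the segment that starts in row `t`. -/
def nextStart (e : ℕ) (μ : YoungDiagram) (t : ℕ) : ℕ :=
  max t ((rimSegment e μ t).sup Prod.fst) + 1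

/-- The row in which the `k`-th segment of the `e`-rim starts. -/
def segmentStart (e : ℕ) (μ : YoungDiagram) (k : ℕ) : ℕ :=
  (nextStart e μ)^[k] 0

/-- The `e`-rim: the union of the successive segments, the first of which starts in the first row
and each later one in the row below the last row met by the previous one. -/
def eRim (e : ℕ) (μ : YoungDiagram) : Finset (ℕ × ℕ) :=
  (Finset.range (μ.colLen 0)).biUnion fun k => rimSegment e μ (segmentStart e μ k)

theorem segmentStart_succ (e : ℕ) (μ : YoungDiagram) (k : ℕ) :
    segmentStart e μ (k + 1) = nextStart e μ (segmentStart e μ k) :=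
  Function.iterate_succ_apply' _ _ _

theorem le_segmentStart (e : ℕ) (μ : YoungDiagram) (k : ℕ) : k ≤ segmentStart e μ k := by
  induction k with
  | zero => exact Nat.zero_le _
  | succ k ih =>
    rw [segmentStart_succ, nextStart]
    omega

theorem mem_eRim_right {e : ℕ} {μ : YoungDiagram} {a b b' : ℕ} (h : (a, b) ∈ eRim e μ)
    (hb : b ≤ b') (hm : (a, b') ∈ μ) : (a, b') ∈ eRim e μ := by
  simp only [eRim, Finset.mem_biUnion, rimSegment, rim, Finset.mem_filter, mem_cells] at h ⊢
  obtain ⟨k, hk, ⟨-, h2⟩, h3, h4⟩ := h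
  exact ⟨k, hk, ⟨hm, fun h5 => h2 (μ.up_left_mem le_rfl (by omega) h5)⟩, h3, by omega⟩

theorem mem_eRim_below {e : ℕ} {μ : YoungDiagram} {a b : ℕ} (h : (a, b) ∈ eRim e μ)
    (hm : (a + 1, b) ∈ μ) : (a + 1, b) ∈ eRim e μ := by
  simp only [eRim, Finset.mem_biUnion, Finset.mem_range] at h ⊢
  obtain ⟨k, hk, h⟩ := h
  have h' := h
  simp only [rimSegment, rim, Finset.mem_filter, mem_cells] at h'
  obtain ⟨⟨h1, h2⟩, h3, h4⟩ := h'
  set t := segmentStart e μ k with ht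
  have hr : (a + 1 + 1, b + 1) ∉ μ := fun h5 => h2 (μ.up_left_mem (by omega) le_rfl h5)
  by_cases h5 : μ.rowLen t + (a + 1) < b + e + t + 1
  · refine ⟨k, hk, ?_⟩
    simp only [rimSegment, rim, Finset.mem_filter, mem_cells]
    exact ⟨⟨hm, hr⟩, by omega, h5⟩
  · have hsup : (rimSegment e μ t).sup Prod.fst = a := by
      refine le_antisymm (Finset.sup_le ?_) (Finset.le_sup (f := Prod.fst) h)
      rintro ⟨i, j⟩ hij
      simp only [rimSegment, rim, Finset.mem_filter, mem_cells] at hij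
      obtain ⟨⟨h6, -⟩, h7, h8⟩ := hij
      by_contra h9
      change ¬ i ≤ a at h9
      have h10 : j ≤ b := by
        by_contra h11
        exact h2 (μ.up_left_mem (by omega) (by omega) h6)
      omega
    have hs : segmentStart e μ (k + 1) = a + 1 := by
      rw [segmentStart_succ, nextStart, ← ht, hsup, max_eq_right h3]
    have hrow : μ.rowLen (a + 1) = b + 1 := by
      have := mem_iff_lt_rowLen.1 hm
      have h8 : ¬ b + 1 < μ.rowLen (a + 1) := fun h9 => h2 (mem_iff_lt_rowLen.2 h9)
      omega
    have hlen : a + 1 < μ.colLen 0 :=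
      mem_iff_lt_colLen.1 (μ.up_left_mem le_rfl (Nat.zero_le _) hm)
    have hk' := le_segmentStart e μ (k + 1)
    have h6 := mem_iff_lt_rowLen.1 h1
    have h7 := μ.rowLen_anti t a h3
    refine ⟨k + 1, by omega, ?_⟩
    rw [hs]
    simp only [rimSegment, rim, Finset.mem_filter, mem_cells]
    exact ⟨⟨hm, hr⟩, le_rfl, by omega⟩

/-- The partition obtained by removing the `e`-rim. -/
def removeERim (e : ℕ) (μ : YoungDiagram) : YoungDiagram where
  cells := μ.cells \ eRim e μ
  isLowerSet := by
    rintro ⟨a', b'⟩ ⟨a, b⟩ hle h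
    obtain ⟨h1, h2⟩ : a ≤ a' ∧ b ≤ b' := hle
    simp only [Finset.coe_sdiff, Set.mem_sdiff, Finset.mem_coe, mem_cells] at h ⊢
    refine ⟨μ.up_left_mem h1 h2 h.1, fun h3 => h.2 ?_⟩
    have key : ∀ n, (a + n, b) ∈ μ → (a + n, b) ∈ eRim e μ := by
      intro n
      induction n with
      | zero => exact fun _ => h3
      | succ n ih =>
        exact fun h4 => mem_eRim_below (ih (μ.up_left_mem (by omega) le_rfl h4)) h4
    obtain ⟨n, rfl⟩ := Nat.exists_eq_add_of_le h1
    exact mem_eRim_right (key n (μ.up_left_mem le_rfl h2 h.1)) h2 h.1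

/-- The size of the `e`-rim of the partition left after `i` removals of the `e`-rim (the `i`-th
entry of the first row of the Mullineux symbol, continued by zeros). -/
def mullineuxA (e : ℕ) (μ : YoungDiagram) (i : ℕ) : ℕ :=
  (eRim e ((removeERim e)^[i] μ)).card

/-- The number of parts of the partition left after `i` removals of the `e`-rim (the `i`-th
entry of the second row of the Mullineux symbol, continued by zeros). -/
def mullineuxR (e : ℕ) (μ : YoungDiagram) (i : ℕ) : ℕ :=
  ((removeERim e)^[i] μ).colLen 0

/-- `ν` is the image of `μ` under the Mullineux map: if `μ` has Mullineux symbol with columns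
`(aᵢ, rᵢ)`, then `ν` is the `e`-regular partition whose Mullineux symbol has columns
`(aᵢ, aᵢ - rᵢ + εᵢ)`, where `εᵢ` is `0` if `e` divides `aᵢ` and `1` otherwise. -/
def IsMullineuxImage (e : ℕ) (μ ν : YoungDiagram) : Prop :=
  IsRegular e ν ∧ ∀ i, mullineuxA e ν i = mullineuxA e μ i ∧
    mullineuxR e ν i + mullineuxR e μ i =
      mullineuxA e μ i + if e ∣ mullineuxA e μ i then 0 else 1

/-- The Mullineux map `m_e` on `e`-regular partitions. -/
noncomputable def mullineux (e : ℕ) (μ : YoungDiagram) : YoungDiagram :=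
  Classical.epsilon (IsMullineuxImage e μ)

end YoungDiagram

/-!
A partition is encoded by its boundary path (`Profile`), a two-sided infinite word of beads (ends
of rows) and gaps (ends of columns), together with the label `g p` of a position `p`, the number of
gaps below `p`. Rim hooks are pairs of a gap `p` below a bead `q`, with size `q - p` and arm length
`g q - g p - 1`. So `d`-balance says that a gap `p` below a bead `q` in the same residue class
modulo `e` satisfies `g q = g p + 1` modulo `d`, and shift balance says `g q = g p`. The `e`-core
and the runner matrix together amount to the multiset of pairs (label modulo `d`, position modulo
`e`) of the beads (`YoungDiagram.partner_iff`); two profiles with the same multiset are called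
partners.

The removal of the `e`-rim factors into two commuting operations, the removal of the first column
(`Profile.col`) and `Profile.trim`. The sizes `arr e a i k` of the diagrams left after `i` of the
former and `k` of the latter satisfy a recurrence that is symmetric in `i` and `k`
(`Profile.arr_recurrence`). The Mullineux symbol consists of the entries of this array on and next
to the diagonal, and the Mullineux map transposes the array. So if removing rows one by one from a
partition `κ` leaves the sizes of the successive trimmings of `λ`, then the conjugate of `κ` is the
Mullineux image of `λ` (`YoungDiagram.isMullineuxImage_of_arr`), and it is the only one because the
symbol determines the partition (`YoungDiagram.eq_of_mullineux_eq`).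

Such a `κ`, a shift balanced partner of `λ`, is built by induction on the size
(`Profile.exists_shiftBalanced`). If `λ` is balanced, then the diagonals not met by the `e`-rim form
a ladder, along which position and label both decrease by one at each step (`Profile.ladder`).
Therefore trimming preserves balance (`Profile.Balanced.trim`) and removes exactly one labelled
bead (`Profile.eventually_beadSum_trim`), so the partner of `trim λ` with a suitable new first row
is a partner of `λ`. That it is shift balanced follows from the shift balance of the partner of `λ`
without its first column, which by the transposition principle is the conjugate of a trimming of
the conjugate of the new partition (`Profile.shiftBalanced_of_trim_conj`).

Conversely a shift balanced partition is determined by its labelled beads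
(`Profile.ShiftBalanced.eq_of_partner`): since `d` and `e` are coprime, the labelled gaps are
determined as well, and two partners can be compared at the highest position where they differ.
-/

open Finset Filter

/-! ### Boundary paths -/

/-- A boundary path of a partition of charge `s`, as the function that sends a position `p : ℤ` to
the number of gaps below `p`. Far to the left every position is a bead (`g` stays constant, at `0`),
far to the right every position is a gap (`g` increases by one). The value `g p` at a bead or a gap
`p` is called its label. For a Young diagram the charge is `0`, the bead of row `i` is at `λ_i - i -
1` and has label `λ_i`, and the gap of column `j` is at `j - λ'_j` and has label `j` (rows and
columns numbered from `0`). The box `(i, j)` lies in the diagram exactly if `j < g (j - i)`. Other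
charges are needed because removing a row or a column moves the origin. -/
structure Profile where
  g : ℤ → ℤ
  s : ℤ
  step : ∀ p, g (p + 1) = g p ∨ g (p + 1) = g p + 1
  low : ∃ a, ∀ p ≤ a, g p = 0
  high : ∃ b, ∀ p ≥ b, g p = p - s

theorem Int.sum_Ico_telescope (F : ℤ → ℤ) {a b : ℤ} (h : a ≤ b) :
    ∑ p ∈ Ico a b, (F (p + 1) - F p) = F b - F a := by
  induction b, h using Int.leInduction with
  | base => simp
  | succ b h ih =>
    rw [← Order.succ_eq_add_one, ← insert_Ico_right_eq_Ico_succ h, Finset.sum_insert (by simp), ih,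
      Order.succ_eq_add_one]
    ring

/-- Every residue class modulo `e` meets every interval of length `e`. -/
theorem Int.exists_mem_Ico_cast_eq {e : ℕ} (he : 0 < e) (a : ℤ) (y : ℤ) :
    ∃ x, a ≤ x ∧ x < a + e ∧ (x : ZMod e) = y := by
  refine ⟨a + (y - a) % e, ?_, ?_, ?_⟩
  · have := Int.emod_nonneg (y - a) (b := (e : ℤ)) (by omega)
    omega
  · have := Int.emod_lt_of_pos (y - a) (b := (e : ℤ)) (by omega)
    omega
  · have h : (((y - a) % e : ℤ) : ZMod e) = ((y - a : ℤ) : ZMod e) := by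
      rw [ZMod.intCast_eq_intCast_iff]; exact Int.mod_modEq _ _
    push_cast at h ⊢
    rw [h]; ring

theorem Int.le_sub_of_cast_eq {e : ℕ} {p q : ℤ} (h : p < q) (hc : (p : ZMod e) = q) :
    p + e ≤ q := by
  have h1 : (e : ℤ) ∣ q - p := by
    rw [ZMod.intCast_eq_intCast_iff] at hc
    exact hc.dvd
  have := Int.le_of_dvd (by omega) h1
  omega

namespace Profile

theorem ext' {a b : Profile} (h : ∀ p, a.g p = b.g p) : a = b := by
  have hg : a.g = b.g := funext h
  obtain ⟨x, hx⟩ := a.high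
  obtain ⟨y, hy⟩ := b.high
  have h1 := hx (max x y) (le_max_left _ _)
  have h2 := hy (max x y) (le_max_right _ _)
  have h3 := h (max x y)
  have hs : a.s = b.s := by omega
  cases a; cases b; simp_all

/-- The position `p` is a bead: a vertical step of the boundary path, the end of a row. -/
def Bead (a : Profile) (p : ℤ) : Prop := a.g (p + 1) = a.g p

/-- The position `p` is a gap: a horizontal step of the boundary path, the end of a column. -/
def Gap (a : Profile) (p : ℤ) : Prop := a.g (p + 1) = a.g p + 1

theorem bead_or_gap (a : Profile) (p : ℤ) : a.Bead p ∨ a.Gap p := a.step p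

theorem not_bead {a : Profile} {p : ℤ} : ¬ a.Bead p ↔ a.Gap p := by
  have := a.step p
  unfold Bead Gap
  omega

theorem not_gap {a : Profile} {p : ℤ} : ¬ a.Gap p ↔ a.Bead p := by
  rw [← not_bead, not_not]

instance (a : Profile) : DecidablePred a.Bead := fun p => by unfold Bead; infer_instance

theorem mono (a : Profile) {p q : ℤ} (h : p ≤ q) : a.g p ≤ a.g q := by
  induction q, h using Int.leInduction with
  | base => exact le_rfl
  | succ q h ih => have := a.step q; omega

theorem anti (a : Profile) {p q : ℤ} (h : p ≤ q) : a.g q - q ≤ a.g p - p := by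
  induction q, h using Int.leInduction with
  | base => exact le_rfl
  | succ q h ih => have := a.step q; omega

theorem nonneg (a : Profile) (p : ℤ) : 0 ≤ a.g p := by
  obtain ⟨x, hx⟩ := a.low
  rw [← hx (min x p) (min_le_left _ _)]
  exact a.mono (min_le_right _ _)

theorem sub_le (a : Profile) (p : ℤ) : p - a.s ≤ a.g p := by
  obtain ⟨x, hx⟩ := a.high
  have h1 := hx (max x p) (le_max_left _ _)
  have h2 := a.anti (le_max_right x p)
  omega

/-- The first gap `u`, described through the values of `g` on either side of it. -/
theorem exists_firstGap (a : Profile) : ∃ u, (∀ p ≤ u, a.g p = 0) ∧ ∀ p, u < p → 1 ≤ a.g p := by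
  obtain ⟨x, hx⟩ := a.low
  obtain ⟨u, hu, hm⟩ := Int.exists_greatest_of_bdd (P := fun u => a.g u = 0)
    ⟨a.s, fun z hz => by have := a.sub_le z; omega⟩ ⟨x, hx x le_rfl⟩
  refine ⟨u, fun p hp => ?_, fun p hp => ?_⟩
  · have := a.mono hp; have := a.nonneg p; omega
  · have h1 := a.nonneg p
    by_contra h2
    have := hm p (by omega)
    omega

/-- The last bead `t`. -/
theorem exists_top (a : Profile) : ∃ t, a.Bead t ∧ ∀ p, t < p → a.g p = p - a.s := by
  obtain ⟨x, hx⟩ := a.high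
  obtain ⟨y, hy⟩ := a.low
  obtain ⟨t, ht, hm⟩ := Int.exists_greatest_of_bdd (P := fun t => a.g t ≠ t - a.s)
    ⟨x, fun z hz => by by_contra h; exact hz (hx z (by omega))⟩
    ⟨min y (a.s - 1), by
      show a.g _ ≠ _
      rw [hy _ (min_le_left _ _)]; have := min_le_right y (a.s - 1); omega⟩
  have hm' : ∀ p, t < p → a.g p = p - a.s := fun p hp => by
    by_contra h; have := hm p h; omega
  refine ⟨t, ?_, hm'⟩
  have h1 := hm' (t + 1) (by omega)
  have h2 := a.step t
  have h3 := a.sub_le t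
  change a.g t ≠ _ at ht
  unfold Bead
  omega

theorem gap_of_top {a : Profile} {t p : ℤ} (ht : ∀ p, t < p → a.g p = p - a.s) (h : t < p) :
    a.Gap p := by
  unfold Gap; rw [ht p h, ht (p + 1) (by omega)]; ring

theorem bead_of_first {a : Profile} {u p : ℤ} (hu : ∀ p ≤ u, a.g p = 0) (h : p < u) :
    a.Bead p := by
  unfold Bead; rw [hu p h.le, hu (p + 1) (by omega)]

theorem eventually_bounds (a : Profile) :
    ∀ᶠ N : ℤ in atTop, (∀ p ≤ -N, a.g p = 0) ∧ (∀ p ≥ N, a.g p = p - a.s) := by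
  obtain ⟨x, hx⟩ := a.low
  obtain ⟨y, hy⟩ := a.high
  filter_upwards [eventually_ge_atTop (max (-x) y)] with N hN
  refine ⟨fun p hp => hx p ?_, fun p hp => hy p ?_⟩ <;>
  · have h1 := le_max_left (-x) y
    have h2 := le_max_right (-x) y
    omega

/-- The number of boxes: on the diagonal `p` there are `g p - max 0 (p - s)` of them. -/
noncomputable def size (a : Profile) : ℤ := ∑ᶠ p, (a.g p - max 0 (p - a.s))

theorem eventually_size (a : Profile) :
    ∀ᶠ N : ℤ in atTop, a.size = ∑ p ∈ Ico (-N) N, (a.g p - max 0 (p - a.s)) := by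
  filter_upwards [a.eventually_bounds, eventually_ge_atTop |a.s|] with N hN hs
  refine finsum_eq_sum_of_support_subset _ fun p hp => ?_
  have h1 := le_abs_self a.s
  have h2 := neg_abs_le a.s
  simp only [Function.mem_support] at hp
  simp only [coe_Ico, Set.mem_Ico]
  by_contra h
  apply hp
  rcases lt_or_ge p (-N) with h3 | h3
  · rw [hN.1 p h3.le, max_eq_left (by omega)]; rfl
  · rw [hN.2 p (by omega), max_eq_right (by omega)]; ring

theorem size_nonneg (a : Profile) : 0 ≤ a.size := by
  obtain ⟨N, hN⟩ := a.eventually_size.exists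
  rw [hN]
  refine Finset.sum_nonneg fun p _ => ?_
  have h1 := a.nonneg p
  have h2 := a.sub_le p
  have := max_le h1 h2
  omega

theorem eq_of_size_eq_zero {a : Profile} (h : a.size = 0) (p : ℤ) : a.g p = max 0 (p - a.s) := by
  obtain ⟨N, hN, hp⟩ := (a.eventually_size.and (eventually_gt_atTop |p|)).exists
  rw [h, eq_comm, Finset.sum_eq_zero_iff_of_nonneg] at hN
  · have h1 := le_abs_self p
    have h2 := neg_abs_le p
    have := hN p (by simp; omega)
    omega
  · intro p _
    have h1 := a.nonneg p
    have h2 := a.sub_le p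
    have := max_le h1 h2
    omega

/-! ### Removing a row or a column -/

/-- Removal of the first column: the first gap becomes a bead. -/
def col (a : Profile) : Profile where
  g p := max (a.g p - 1) 0
  s := a.s + 1
  step p := by have := a.step p; omega
  low := by
    obtain ⟨x, hx⟩ := a.low
    exact ⟨x, fun p hp => by rw [hx p hp]; rfl⟩
  high := by
    obtain ⟨x, hx⟩ := a.high
    refine ⟨max x (a.s + 1), fun p hp => ?_⟩
    have h1 := le_max_left x (a.s + 1)
    have h2 := le_max_right x (a.s + 1)
    rw [hx p (by omega)]
    omega

/-- The conjugate path, which is the path read backwards with beads and gaps exchanged. -/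
def conj (a : Profile) : Profile where
  g p := a.g (-p) + p + a.s
  s := -a.s
  step p := by
    have := a.step (-(p + 1))
    rw [show -(p + 1) + 1 = -p by ring] at this
    omega
  low := by
    obtain ⟨x, hx⟩ := a.high
    exact ⟨-x, fun p hp => by rw [hx (-p) (by omega)]; ring⟩
  high := by
    obtain ⟨x, hx⟩ := a.low
    exact ⟨-x, fun p hp => by rw [hx (-p) (by omega)]; ring⟩

theorem conj_g (a : Profile) (p : ℤ) : a.conj.g p = a.g (-p) + p + a.s := rfl
theorem conj_s (a : Profile) : a.conj.s = -a.s := rfl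
theorem col_g (a : Profile) (p : ℤ) : a.col.g p = max (a.g p - 1) 0 := rfl
theorem col_s (a : Profile) : a.col.s = a.s + 1 := rfl

@[simp] theorem conj_conj (a : Profile) : a.conj.conj = a :=
  ext' fun p => by simp only [conj_g, conj_s, neg_neg]; ring

theorem conj_bead {a : Profile} {p : ℤ} : a.conj.Bead p ↔ a.Gap (-p - 1) := by
  unfold Bead Gap
  simp only [conj_g]
  rw [show -(p + 1) = -p - 1 by ring, show -p - 1 + 1 = -p by ring]
  omega

theorem conj_gap {a : Profile} {p : ℤ} : a.conj.Gap p ↔ a.Bead (-p - 1) := by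
  unfold Bead Gap
  simp only [conj_g]
  rw [show -(p + 1) = -p - 1 by ring, show -p - 1 + 1 = -p by ring]
  omega

@[simp] theorem conj_size (a : Profile) : a.conj.size = a.size := by
  unfold size
  rw [← finsum_comp_equiv (Equiv.neg ℤ)]
  refine finsum_congr fun p => ?_
  simp only [Equiv.neg_apply, conj_g, conj_s, neg_neg]
  omega

/-- Removal of the first row: the last bead becomes a gap. -/
def row (a : Profile) : Profile := a.conj.col.conj

theorem row_g (a : Profile) (p : ℤ) : a.row.g p = max (a.g p) (p - a.s + 1) := by
  simp only [row, conj_g, col_g, conj_s, col_s, neg_neg]; omega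

/-- The length of the first column. -/
theorem size_sub_size_col {a : Profile} {u : ℤ} (hu : ∀ p ≤ u, a.g p = 0)
    (hu' : ∀ p, u < p → 1 ≤ a.g p) : a.size - a.col.size = a.s - u := by
  obtain ⟨N, h1, h2, h3, h4⟩ := (a.eventually_size.and (a.col.eventually_size.and
    ((eventually_gt_atTop (|u| + 1)).and (eventually_gt_atTop (|a.s| + 1))))).exists
  have h5 := le_abs_self u
  have h6 := neg_abs_le u
  have h7 := le_abs_self a.s
  have h8 := neg_abs_le a.s
  rw [h1, h2, ← Finset.sum_sub_distrib]
  have := Int.sum_Ico_telescope (fun p => max 0 (p - 1 - u) - max 0 (p - 1 - a.s))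
    (a := -N) (b := N) (by omega)
  rw [max_eq_right (by omega : 0 ≤ N - 1 - u), max_eq_right (by omega : 0 ≤ N - 1 - a.s),
    max_eq_left (by omega : -N - 1 - u ≤ 0), max_eq_left (by omega : -N - 1 - a.s ≤ 0)] at this
  rw [show a.s - u = N - 1 - u - (N - 1 - a.s) - (0 - 0) by ring, ← this]
  refine Finset.sum_congr rfl fun p _ => ?_
  simp only [col_g, col_s]
  rcases le_or_gt p u with h | h
  · have := hu p h; omega
  · have := hu' p h; omega

/-- The length of the first row. -/
theorem size_sub_size_row {a : Profile} {t : ℤ} (ht : a.Bead t)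
    (ht' : ∀ p, t < p → a.g p = p - a.s) : a.size - a.row.size = t + 1 - a.s := by
  have := size_sub_size_col (a := a.conj) (u := -t - 1) ?_ ?_
  · rw [conj_size, conj_s] at this
    rw [row, conj_size]; omega
  · intro p hp
    rw [conj_g, ht' _ (by omega)]; ring
  · intro p hp
    rw [conj_g]
    have h1 := a.anti (show -p ≤ t by omega)
    have h2 := ht' (t + 1) (by omega)
    unfold Bead at ht
    omega

theorem size_col_le (a : Profile) : a.col.size ≤ a.size := by
  obtain ⟨u, hu, hu'⟩ := a.exists_firstGap
  have := size_sub_size_col hu hu'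
  have := a.sub_le u
  have := hu u le_rfl
  omega

theorem size_col_lt {a : Profile} (h : 0 < a.size) : a.col.size < a.size := by
  obtain ⟨u, hu, hu'⟩ := a.exists_firstGap
  have h1 := size_sub_size_col hu hu'
  have h2 := a.sub_le u
  have h3 := hu u le_rfl
  by_contra h4
  have h5 : u = a.s := by omega
  have h6 : a.size = 0 := by
    obtain ⟨N, hN⟩ := a.eventually_size.exists
    rw [hN]
    refine Finset.sum_eq_zero fun p _ => ?_
    rcases le_or_gt p u with h | h
    · have := hu p h; omega
    · have := a.anti (show u + 1 ≤ p by omega)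
      have := a.step u
      have := a.sub_le p
      omega
  omega

theorem eventually_size_col_iterate (a : Profile) : ∀ᶠ i : ℕ in atTop, (col^[i] a).size = 0 := by
  have key : ∀ n : ℕ, ∀ a : Profile, a.size ≤ n → ∀ i ≥ n, (col^[i] a).size = 0 := by
    intro n
    induction n with
    | zero =>
      intro a ha i _
      induction i with
      | zero => have := a.size_nonneg; simpa using le_antisymm ha this
      | succ i ih =>
        rw [Function.iterate_succ_apply']
        exact le_antisymm (ih (by omega) ▸ size_col_le _) (size_nonneg _)
    | succ n ih =>
      intro a ha i hi
      obtain ⟨i, rfl⟩ : ∃ k, i = k + 1 := ⟨i - 1, by omega⟩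
      rw [Function.iterate_succ_apply]
      refine ih _ ?_ i (by omega)
      rcases (a.size_nonneg).eq_or_lt with h | h
      · have := size_col_le a; push_cast at ha; omega
      · have := size_col_lt h; push_cast at ha; omega
  filter_upwards [eventually_ge_atTop a.size.toNat] with i hi
  exact key _ a (by have := a.size_nonneg; omega) i hi

end Profile

namespace Profile

/-! ### The diagonals of the `e`-rim -/

/-- A position from which on there are only gaps. -/
noncomputable def bound (a : Profile) : ℤ := a.high.choose

theorem gap_of_bound_le {a : Profile} {p : ℤ} (h : a.bound ≤ p) : a.Gap p := by
  have := a.high.choose_spec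
  unfold Gap
  rw [this p h, this (p + 1) (by have : a.bound = a.high.choose := rfl; omega)]; ring

/-- The value of `sweep` at the position `n` steps below `bound`. -/
noncomputable def sweepAux (e : ℕ) (a : Profile) : ℕ → ℕ
  | 0 => 0
  | n + 1 => if 2 ≤ sweepAux e a n then sweepAux e a n - 1
      else if a.Bead (a.bound - n - 1) then e else 0

/-- The state at `p` of a counter that runs along the path from right to left: it is set to `e` at a
bead when no position is left over from an earlier bead, and then counts down to `1`. The positions
with nonzero state are called swept, the others skipped. The swept positions are the diagonals of
the boxes of the `e`-rim; each run `e, e - 1, …` belongs to one segment, and a new segment starts at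
the next bead below a completed one. Skipped positions are gaps. -/
noncomputable def sweep (e : ℕ) (a : Profile) (p : ℤ) : ℕ := sweepAux e a (a.bound - p).toNat

theorem sweep_of_bound_le {e : ℕ} {a : Profile} {p : ℤ} (h : a.bound ≤ p) : sweep e a p = 0 := by
  rw [sweep, show (a.bound - p).toNat = 0 by omega, sweepAux]

/-- The transition rule of the counter. -/
theorem sweep_eq (e : ℕ) (a : Profile) (p : ℤ) :
    sweep e a p = if 2 ≤ sweep e a (p + 1) then sweep e a (p + 1) - 1
      else if a.Bead p then e else 0 := by
  rcases le_or_gt a.bound p with h | h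
  · rw [sweep_of_bound_le h, sweep_of_bound_le (by omega), if_neg (by omega),
      if_neg (not_bead.2 (gap_of_bound_le h))]
  · obtain ⟨n, hn⟩ : ∃ n : ℕ, a.bound - p = n + 1 := ⟨(a.bound - p - 1).toNat, by omega⟩
    rw [sweep, sweep, show (a.bound - p).toNat = n + 1 by omega,
      show (a.bound - (p + 1)).toNat = n by omega, sweepAux, show a.bound - n - 1 = p by omega]

variable {e : ℕ} {a : Profile}

theorem sweep_of_bead (he : 0 < e) {p : ℤ} (h : a.Bead p) : sweep e a p ≠ 0 := by
  rw [sweep_eq]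
  split_ifs <;> omega

theorem gap_of_sweep_eq_zero (he : 0 < e) {p : ℤ} (h : sweep e a p = 0) : a.Gap p :=
  not_bead.1 fun hb => sweep_of_bead he hb h

theorem sweep_of_top {t p : ℤ} (ht : ∀ p, t < p → a.g p = p - a.s) (h : t < p) :
    sweep e a p = 0 := by
  rcases le_or_gt a.bound p with h1 | h1
  · exact sweep_of_bound_le h1
  · have key : ∀ n : ℕ, t < a.bound - n → sweep e a (a.bound - n) = 0 := by
      intro n
      induction n with
      | zero => exact fun _ => sweep_of_bound_le (by simp)
      | succ n ih =>
        intro hn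
        push_cast at hn
        rw [sweep_eq, show a.bound - (n + 1 : ℕ) + 1 = a.bound - n by push_cast; ring,
          ih (by omega), if_neg (by omega), if_neg (not_bead.2 (gap_of_top ht (by push_cast; omega)))]
    have := key (a.bound - p).toNat (by omega)
    rwa [show a.bound - (a.bound - p).toNat = p by omega] at this

theorem sweep_le (he : 0 < e) (p : ℤ) : sweep e a p ≤ e := by
  rcases le_or_gt a.bound p with h1 | h1
  · rw [sweep_of_bound_le h1]; omega
  · have key : ∀ n : ℕ, sweep e a (a.bound - n) ≤ e := by
      intro n
      induction n with
      | zero => rw [sweep_of_bound_le (by simp)]; omega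
      | succ n ih =>
        rw [sweep_eq, show a.bound - (n + 1 : ℕ) + 1 = a.bound - n by push_cast; ring]
        split_ifs <;> omega
    have := key (a.bound - p).toNat
    rwa [show a.bound - (a.bound - p).toNat = p by omega] at this

theorem sweep_succ_of_zero_of_ne {p : ℤ} (h : sweep e a p = 0)
    (h' : sweep e a (p + 1) ≠ 0) : sweep e a (p + 1) = 1 := by
  rw [sweep_eq] at h
  split_ifs at h <;> omega

theorem bead_of_ne_of_sweep_succ {p : ℤ} (h : sweep e a p ≠ 0)
    (h' : sweep e a (p + 1) ≤ 1) : a.Bead p ∧ sweep e a p = e := by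
  have := sweep_eq e a p
  rw [if_neg (by omega)] at this
  split_ifs at this with hb
  · exact ⟨hb, this⟩
  · omega

/-- A swept position with state `k` belongs to a segment that starts at a bead `e - k` steps above
it. -/
theorem segment_start (he : 0 < e) {p : ℤ} (h : sweep e a p ≠ 0) :
    ∃ b, a.Bead b ∧ sweep e a b = e ∧ b + sweep e a p = p + e := by
  obtain ⟨n, hn⟩ : ∃ n, sweep e a p + n = e := ⟨e - sweep e a p, by have := sweep_le (a := a) he p; omega⟩
  induction n generalizing p with
  | zero =>
    by_cases h1 : 2 ≤ sweep e a (p + 1)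
    · have h2 := sweep_eq e a p
      rw [if_pos h1] at h2
      have := sweep_le (a := a) he (p + 1)
      omega
    · obtain ⟨h2, h3⟩ := bead_of_ne_of_sweep_succ h (by omega)
      exact ⟨p, h2, h3, by omega⟩
  | succ n ih =>
    have h2 := sweep_eq e a p
    by_cases h1 : 2 ≤ sweep e a (p + 1)
    · rw [if_pos h1] at h2
      obtain ⟨b, hb, hb', hb''⟩ := ih (p := p + 1) (by omega) (by omega)
      exact ⟨b, hb, hb', by omega⟩
    · obtain ⟨-, h3⟩ := bead_of_ne_of_sweep_succ h (by omega)
      omega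

theorem sweep_sub {b : ℤ} {n : ℕ} (hn : n < sweep e a b) :
    sweep e a (b - n) = sweep e a b - n := by
  induction n with
  | zero => simp
  | succ n ih =>
    have := ih (by omega)
    rw [sweep_eq, show b - (n + 1 : ℕ) + 1 = b - n by push_cast; ring, if_pos (by omega)]
    omega

/-- The indicator function of the skipped positions. -/
noncomputable def skip (e : ℕ) (a : Profile) (p : ℤ) : ℤ := if sweep e a p = 0 then 1 else 0

theorem skip_of_eq {p : ℤ} (h : sweep e a p = 0) : skip e a p = 1 := if_pos h
theorem skip_of_ne {p : ℤ} (h : sweep e a p ≠ 0) : skip e a p = 0 := if_neg h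
theorem skip_cases (e : ℕ) (a : Profile) (p : ℤ) :
    sweep e a p = 0 ∧ skip e a p = 1 ∨ sweep e a p ≠ 0 ∧ skip e a p = 0 := by
  by_cases h : sweep e a p = 0
  · exact Or.inl ⟨h, skip_of_eq h⟩
  · exact Or.inr ⟨h, skip_of_ne h⟩

/-- The path obtained by adding `1` to `g` at the skipped positions and lowering the charge by one.
The path `col (trim e a)`, in which `g` is lowered by one at the swept positions as far as it is
positive, is that of the diagram with its `e`-rim removed; the diagram of `trim e a` has one more
column in front of it. Splitting the removal of the `e`-rim into the commuting operations `trim` and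
`col` makes the recurrence for the array `arr` below symmetric. -/
noncomputable def trim (e : ℕ) [NeZero e] (a : Profile) : Profile where
  g p := a.g p + skip e a p
  s := a.s - 1
  step p := by
    have he := NeZero.pos e
    have hs := a.step p
    rcases skip_cases e a p with ⟨h1, h2⟩ | ⟨h1, h2⟩ <;>
    rcases skip_cases e a (p + 1) with ⟨h3, h4⟩ | ⟨h3, h4⟩ <;> rw [h2, h4]
    · omega
    · have := gap_of_sweep_eq_zero he h1
      unfold Gap at this; omega
    · have := (bead_of_ne_of_sweep_succ h1 (by omega)).1
      unfold Bead at this; omega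
    · omega
  low := by
    obtain ⟨x, hx⟩ := a.low
    refine ⟨x - 1, fun p hp => ?_⟩
    rw [hx p (by omega), skip_of_ne (sweep_of_bead (NeZero.pos e) (bead_of_first hx (by omega)))]
    rfl
  high := by
    obtain ⟨t, -, ht⟩ := a.exists_top
    refine ⟨t + 1, fun p hp => ?_⟩
    rw [ht p (by omega), skip_of_eq (sweep_of_top ht (by omega))]
    ring

variable [NeZero e]

theorem trim_g (p : ℤ) : (trim e a).g p = a.g p + skip e a p := rfl
theorem trim_s : (trim e a).s = a.s - 1 := rfl

omit [NeZero e] in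
/-- The sweep at `p` only depends on the beads from `p` on. -/
theorem sweep_congr {a b : Profile} {u : ℤ} (h : ∀ p, u < p → (a.Bead p ↔ b.Bead p)) {p : ℤ}
    (hp : u < p) : sweep e a p = sweep e b p := by
  have key : ∀ n : ℕ, ∀ p, u < p → max a.bound b.bound - n ≤ p → sweep e a p = sweep e b p := by
    intro n
    induction n with
    | zero =>
      intro p _ hp
      have h1 := le_max_left a.bound b.bound
      have h2 := le_max_right a.bound b.bound
      rw [sweep_of_bound_le (by omega), sweep_of_bound_le (by omega)]
    | succ n ih =>
      intro p hp hp'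
      rw [sweep_eq e a, sweep_eq e b, ih (p + 1) (by omega) (by push_cast at hp'; omega)]
      simp only [h p hp]
  exact key (max a.bound b.bound - p).toNat p hp (by omega)

theorem col_bead_iff {u p : ℤ} (hu' : ∀ p, u < p → 1 ≤ a.g p) (hp : u < p) :
    a.col.Bead p ↔ a.Bead p := by
  have h1 := hu' p hp
  have h2 := hu' (p + 1) (by omega)
  unfold Bead
  simp only [col_g]
  omega

theorem col_bead_of_le {u p : ℤ} (hu : ∀ p ≤ u, a.g p = 0) (hp : p ≤ u) : a.col.Bead p := by
  have h1 := hu p hp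
  have h2 := a.step p
  unfold Bead
  simp only [col_g]
  omega

/-- Trimming commutes with the removal of the first column, as the sweep above the first gap does
not see what lies below it. -/
theorem col_trim (a : Profile) : (trim e a).col = trim e a.col := by
  refine ext' fun p => ?_
  obtain ⟨u, hu, hu'⟩ := a.exists_firstGap
  rw [col_g, trim_g, trim_g, col_g]
  rcases le_or_gt p u with h | h
  · rw [hu p h, skip_of_ne (sweep_of_bead (NeZero.pos e) (col_bead_of_le hu h))]
    rcases skip_cases e a p with ⟨-, h⟩ | ⟨-, h⟩ <;> rw [h] <;> rfl
  · have h1 := sweep_congr (e := e) (fun p hp => (col_bead_iff hu' hp).symm) h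
    have h2 : skip e a.col p = skip e a p := by simp only [skip, h1]
    have := hu' p h
    rw [h2]
    rcases skip_cases e a p with ⟨-, h⟩ | ⟨-, h⟩ <;> rw [h] <;> omega

/-- The correction term `ε` of the Mullineux map: `0` if `e` divides the size of the `e`-rim and `1`
otherwise. -/
noncomputable def eps (e : ℕ) [NeZero e] (a : Profile) : ℤ :=
  if (e : ℤ) ∣ a.size - (trim e a).col.size then 0 else 1

omit [NeZero e] in
/-- Modulo `e`, the number of swept positions from `p` on is determined by the state at `p`, since
all segments but possibly the last one visited have length `e`. -/
theorem sum_swept_mod {h p : ℤ} (hh : ∀ p, h ≤ p → sweep e a p = 0) (hp : p ≤ h) :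
    (sweep e a p = 0 → (e : ℤ) ∣ ∑ x ∈ Ico p h, (1 - skip e a x)) ∧
    (sweep e a p ≠ 0 → (e : ℤ) ∣ (∑ x ∈ Ico p h, (1 - skip e a x)) + sweep e a p - 1) := by
  obtain ⟨n, hn⟩ : ∃ n : ℕ, h = p + n := ⟨(h - p).toNat, by omega⟩
  induction n generalizing p with
  | zero =>
    have : h = p := by omega
    subst this
    simp [hh h le_rfl]
  | succ n ih =>
    obtain ⟨h1, h2⟩ := ih (p := p + 1) (by push_cast at hn; omega) (by push_cast at hn; omega)
    have hsum : ∑ x ∈ Ico p h, (1 - skip e a x) = (1 - skip e a p) +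
        ∑ x ∈ Ico (p + 1) h, (1 - skip e a x) := by
      rw [← Order.succ_eq_add_one, ← insert_Ico_succ_left_eq_Ico (by push_cast at hn; omega),
        Finset.sum_insert (by simp)]
    have h3 := sweep_eq e a p
    rw [hsum]
    constructor
    · intro h0
      rw [skip_of_eq h0]
      by_cases h4 : sweep e a (p + 1) = 0
      · simpa using h1 h4
      · have h5 := sweep_succ_of_zero_of_ne h0 h4
        have := h2 h4
        rw [h5] at this
        simpa using this
    · intro h0
      rw [skip_of_ne h0]
      by_cases h4 : 2 ≤ sweep e a (p + 1)
      · rw [if_pos h4] at h3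
        have := h2 (by omega)
        rw [h3]
        convert this using 1
        push_cast [show 1 ≤ sweep e a (p + 1) by omega]
        ring
      · have h6 := (bead_of_ne_of_sweep_succ h0 (by omega)).2
        have h7 : (e : ℤ) ∣ ∑ x ∈ Ico (p + 1) h, (1 - skip e a x) := by
          by_cases h8 : sweep e a (p + 1) = 0
          · exact h1 h8
          · have := h2 h8
            rw [show sweep e a (p + 1) = 1 by omega] at this
            simpa using this
        rw [h6]
        have := Int.dvd_add h7 (Int.dvd_refl (e : ℤ))
        convert this using 1
        ring

theorem eventually_trim_size (a : Profile) : ∀ᶠ N : ℤ in atTop,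
    a.size - (trim e a).col.size = ∑ p ∈ Ico (-N) N, (a.g p - (trim e a).col.g p) := by
  filter_upwards [a.eventually_size, (trim e a).col.eventually_size] with N h1 h2
  rw [h1, h2, ← Finset.sum_sub_distrib]
  refine Finset.sum_congr rfl fun p _ => ?_
  rw [col_s, trim_s, sub_add_cancel]
  ring

/-- The size of the `e`-rim is divisible by `e` exactly if its last segment is complete, that is, if
the first gap is skipped. -/
theorem eps_eq (he : 1 < e) {u : ℤ} (hu : ∀ p ≤ u, a.g p = 0)
    (hu' : ∀ p, u < p → 1 ≤ a.g p) : eps e a = 1 - skip e a u := by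
  obtain ⟨N, h1, h2, h3⟩ := ((eventually_trim_size (e := e) a).and
    ((eventually_gt_atTop (|u| + 1)).and (eventually_ge_atTop a.bound))).exists
  have h5 := le_abs_self u
  have h6 := neg_abs_le u
  have hsum : a.size - (trim e a).col.size = ∑ x ∈ Ico (u + 1) N, (1 - skip e a x) := by
    rw [h1, ← Finset.sum_subset (s₁ := Ico (u + 1) N)]
    · refine Finset.sum_congr rfl fun p hp => ?_
      have := hu' p (by simp at hp; omega)
      rw [col_g, trim_g]
      rcases skip_cases e a p with ⟨-, h⟩ | ⟨-, h⟩ <;> rw [h] <;> omega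
    · intro x; simp; omega
    · intro p hp hp'
      simp only [mem_Ico] at hp hp'
      rw [col_g, trim_g, hu p (by omega)]
      rcases skip_cases e a p with ⟨-, h⟩ | ⟨-, h⟩ <;> rw [h] <;> rfl
  obtain ⟨h7, h8⟩ := sum_swept_mod (e := e) (a := a) (h := N) (p := u + 1)
    (fun p hp => sweep_of_bound_le (by omega)) (by omega)
  rw [eps, hsum]
  have hgap : ¬ a.Bead u := by
    have := hu u le_rfl; have := hu' (u + 1) (by omega)
    unfold Bead; omega
  have h9 := sweep_eq e a u
  rw [if_neg hgap] at h9
  rcases skip_cases e a u with ⟨h, h'⟩ | ⟨h, h'⟩ <;> rw [h']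
  · rw [if_pos]; · rfl
    by_cases h10 : sweep e a (u + 1) = 0
    · exact h7 h10
    · have := h8 h10
      rw [sweep_succ_of_zero_of_ne h h10] at this
      simpa using this
  · rw [if_neg]; · rfl
    intro hd
    split_ifs at h9 with h10
    · have h11 := h8 (by omega)
      have h12 := sweep_le (e := e) (a := a) (by omega) (u + 1)
      rw [add_sub_assoc] at h11
      have h13 := (Int.dvd_add_right hd).1 h11
      have := Int.le_of_dvd (by omega) h13
      omega
    · omega

/-- Trimming lowers the length of the first column by `eps`. -/
theorem size_recurrence (he : 1 < e) (a : Profile) :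
    (trim e a).size - (trim e a).col.size = a.size - a.col.size - eps e a := by
  obtain ⟨u, hu, hu'⟩ := a.exists_firstGap
  rw [eps_eq he hu hu']
  obtain ⟨N, h1, h2, h3, h4, h5, h6⟩ := (a.eventually_size.and (a.col.eventually_size.and
    ((trim e a).eventually_size.and ((trim e a).col.eventually_size.and
    ((eventually_gt_atTop (|u| + 1)).and (eventually_gt_atTop (|a.s| + 1))))))).exists
  have h7 := le_abs_self u
  have h8 := neg_abs_le u
  have h9 := le_abs_self a.s
  have h10 := neg_abs_le a.s
  have key : ∑ p ∈ Ico (-N) N, ((if p = u then skip e a u else 0) - (if p = a.s then 1 else 0)) =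
      skip e a u - 1 := by
    rw [Finset.sum_sub_distrib, Finset.sum_ite_eq', Finset.sum_ite_eq', if_pos (by simp; omega),
      if_pos (by simp; omega)]
  have : (trim e a).size - (trim e a).col.size - (a.size - a.col.size) = skip e a u - 1 := by
    rw [← key, h1, h2, h3, h4]
    simp only [← Finset.sum_sub_distrib]
    refine Finset.sum_congr rfl fun p _ => ?_
    simp only [col_g, col_s, trim_g, trim_s]
    rcases lt_trichotomy p u with h | h | h
    · rw [skip_of_ne (sweep_of_bead (by omega) (bead_of_first hu h)), hu p h.le, if_neg h.ne]
      split_ifs <;> omega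
    · subst h
      rw [hu p le_rfl, if_pos rfl]
      rcases skip_cases e a p with ⟨-, h⟩ | ⟨-, h⟩ <;> rw [h] <;> split_ifs <;> omega
    · have := hu' p h
      rw [if_neg h.ne']
      rcases skip_cases e a p with ⟨-, h⟩ | ⟨-, h⟩ <;> rw [h] <;> split_ifs <;> omega
  omega

theorem size_trim_of_size_eq_zero (h : a.size = 0) : (trim e a).size = 0 := by
  have hg := eq_of_size_eq_zero h
  obtain ⟨N, hN⟩ := (trim e a).eventually_size.exists
  rw [hN]
  refine Finset.sum_eq_zero fun p _ => ?_
  rw [trim_g, trim_s]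
  rcases le_or_gt a.s p with hp | hp
  · rw [skip_of_eq, hg]; · omega
    exact sweep_of_top (t := a.s - 1) (fun p hp => by rw [hg]; omega) (by omega)
  · rw [skip_of_ne, hg]; · omega
    refine sweep_of_bead (NeZero.pos e) ?_
    unfold Bead
    rw [hg, hg]; omega

theorem eps_nonneg (a : Profile) : 0 ≤ eps e a := by unfold eps; split_ifs <;> omega

/-- Induction by removing the first column. -/
theorem col_induction {P : Profile → Prop} (h0 : ∀ a, a.size = 0 → P a)
    (h1 : ∀ a : Profile, 0 < a.size → P a.col → P a) (a : Profile) : P a := by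
  obtain ⟨n, hn⟩ : ∃ n : ℕ, a.size = n := ⟨a.size.toNat, by have := a.size_nonneg; omega⟩
  induction n using Nat.strong_induction_on generalizing a with
  | _ n ih =>
    rcases a.size_nonneg.eq_or_lt with h | h
    · exact h0 a h.symm
    · have h2 := size_col_lt h
      have h3 := a.col.size_nonneg
      exact h1 a h (ih a.col.size.toNat (by omega) a.col (by omega))

/-- The number of boxes lost by trimming, compared with that for the diagram without its first
column. -/
theorem size_sub_size_trim (he : 1 < e) (a : Profile) :
    a.size - (trim e a).size = a.col.size - (trim e a.col).size + eps e a := by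
  have := size_recurrence he a
  rw [← col_trim]
  omega

theorem size_trim_le (he : 1 < e) (a : Profile) : (trim e a).size ≤ a.size := by
  induction a using col_induction with
  | h0 a h => rw [size_trim_of_size_eq_zero h, h]
  | h1 a _ ih =>
    have := size_sub_size_trim he a
    have := eps_nonneg (e := e) a
    omega

/-- The numbers of boxes lost by successive trimmings decrease weakly. By the previous recurrences,
an increase could only come from `eps` being `0` for `a` and `1` for `trim e a`; but then the two
numbers whose divisibility by `e` defines these two values agree. -/
theorem size_convex (he : 1 < e) (a : Profile) :
    (trim e a).size - (trim e (trim e a)).size ≤ a.size - (trim e a).size := by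
  induction a using col_induction with
  | h0 a h =>
    have h1 := size_trim_of_size_eq_zero (e := e) h
    rw [size_trim_of_size_eq_zero h1, h1, h]
  | h1 a _ ih =>
    have h1 := size_sub_size_trim he a
    have h2 := size_sub_size_trim he (trim e a)
    have h3 := size_recurrence he a
    have h4 := size_recurrence he (trim e a)
    rw [col_trim] at h2
    by_contra hlt
    have h5 : eps e a = 0 ∧ eps e (trim e a) = 1 := by
      unfold eps at h1 h2 ⊢
      split_ifs at h1 h2 ⊢ <;> omega
    obtain ⟨h6, h7⟩ := h5
    have h8 : (e : ℤ) ∣ a.size - (trim e a).col.size := by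
      by_contra h; rw [eps, if_neg h] at h6; omega
    have h9 : ¬ (e : ℤ) ∣ (trim e a).size - (trim e (trim e a)).col.size := by
      intro h; rw [eps, if_pos h] at h7; omega
    apply h9
    convert h8 using 1
    omega

/-! ### The array of sizes -/

/-- The sizes of the diagrams obtained by `k` trimmings and removing `i` columns. Its entries at
`(i, i)`, `(i + 1, i)` and `(i + 1, i + 1)` are the data of the Mullineux symbol. -/
noncomputable def arr (e : ℕ) [NeZero e] (a : Profile) (i k : ℕ) : ℤ :=
  (col^[i] ((trim e)^[k] a)).size

theorem trim_col_iterate (a : Profile) (i : ℕ) : trim e (col^[i] a) = col^[i] (trim e a) :=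
  (Function.Commute.iterate_right (f := trim e) (g := col) (fun a => (col_trim a).symm) i) a

/-- The recurrence on the squares of the array. It is symmetric in the two indices, as the
difference in the divisibility condition runs along the diagonal. -/
theorem arr_recurrence (he : 1 < e) (a : Profile) (i k : ℕ) :
    arr e a i (k + 1) - arr e a (i + 1) (k + 1) = arr e a i k - arr e a (i + 1) k -
      if (e : ℤ) ∣ arr e a i k - arr e a (i + 1) (k + 1) then 0 else 1 := by
  have := size_recurrence he (col^[i] ((trim e)^[k] a))
  rw [eps, trim_col_iterate, ← Function.iterate_succ_apply' (trim e),
    ← Function.iterate_succ_apply' col, ← Function.iterate_succ_apply' col] at this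
  exact this

theorem arr_nonneg (a : Profile) (i k : ℕ) : 0 ≤ arr e a i k := size_nonneg _

theorem arr_succ_le (a : Profile) (i k : ℕ) : arr e a (i + 1) k ≤ arr e a i k := by
  unfold arr
  rw [Function.iterate_succ_apply']
  exact size_col_le _

theorem arr_trim_le (he : 1 < e) (a : Profile) (i k : ℕ) : arr e a i (k + 1) ≤ arr e a i k := by
  unfold arr
  rw [Function.iterate_succ_apply', ← trim_col_iterate]
  exact size_trim_le he _

/-- If the first column of one array is the first row of another one, then the arrays are transposes
of each other: the recurrence determines each column from the previous one, starting from the zeros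
far away. -/
theorem arr_transpose (he : 1 < e) {a b : Profile} (h : ∀ i, arr e b i 0 = arr e a 0 i) (i k : ℕ) :
    arr e b i k = arr e a k i := by
  induction k generalizing i with
  | zero => exact h i
  | succ k ih =>
    have h1 : ∀ᶠ i in atTop, arr e b i (k + 1) = arr e a (k + 1) i := by
      filter_upwards [eventually_size_col_iterate ((trim e)^[k] b)] with i hi
      have h2 : arr e b i k = 0 := hi
      have h3 := arr_trim_le he b i k
      have h4 := arr_nonneg (e := e) b i (k + 1)
      have h5 := arr_succ_le (e := e) a k i
      have h6 := arr_nonneg (e := e) a (k + 1) i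
      have := ih i
      omega
    obtain ⟨n, hn⟩ := eventually_atTop.1 h1
    rcases le_or_gt n i with hi | hi
    · exact hn i hi
    · obtain ⟨m, hm⟩ : ∃ m, i + m = n := ⟨n - i, by omega⟩
      clear hi
      induction m generalizing i with
      | zero => exact hn i (by omega)
      | succ m ihm =>
        have h2 := ihm (i + 1) (by omega)
        have h3 := arr_recurrence he b i k
        have h4 := arr_recurrence he a k i
        rw [ih i, ih (i + 1), h2] at h3
        omega

/-- The entries on and next to the diagonal determine, by the recurrence, all entries on one side of
it. -/
theorem arr_eq_of_diag (he : 1 < e) {a b : Profile} (h0 : ∀ i, arr e a i i = arr e b i i)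
    (h1 : ∀ i, arr e a (i + 1) i = arr e b (i + 1) i) (m k : ℕ) :
    arr e a (k + m) k = arr e b (k + m) k := by
  induction m using Nat.strong_induction_on generalizing k with
  | _ m ih =>
    match m with
    | 0 => exact h0 k
    | 1 => exact h1 k
    | m + 2 =>
      have h2 := ih m (by omega) (k + 1)
      have h3 := ih (m + 1) (by omega) (k + 1)
      have h4 := ih (m + 1) (by omega) k
      have h5 := arr_recurrence he a (k + m + 1) k
      have h6 := arr_recurrence he b (k + m + 1) k
      rw [show k + 1 + m = k + m + 1 by ring] at h2
      rw [show k + 1 + (m + 1) = k + m + 1 + 1 by ring] at h3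
      rw [show k + (m + 1) = k + m + 1 by ring] at h4
      rw [show k + (m + 2) = k + m + 1 + 1 by ring]
      rw [h2, h3, h4] at h5
      omega

/-- A profile is determined by its charge and by the sizes left after removing columns. -/
theorem eq_of_size_col_iterate {a b : Profile} (hs : a.s = b.s)
    (h : ∀ i, (col^[i] a).size = (col^[i] b).size) : a = b := by
  induction a using col_induction generalizing b with
  | h0 a ha =>
    have hb : b.size = 0 := by rw [← ha]; exact (h 0).symm
    exact ext' fun p => by rw [eq_of_size_eq_zero ha, eq_of_size_eq_zero hb, hs]
  | h1 a _ ih =>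
    have hcol : a.col = b.col := by
      refine ih (by rw [col_s, col_s, hs]) fun i => ?_
      simpa only [Function.iterate_succ_apply] using h (i + 1)
    obtain ⟨u, hu, hu'⟩ := a.exists_firstGap
    obtain ⟨v, hv, hv'⟩ := b.exists_firstGap
    have h2 := size_sub_size_col hu hu'
    have h3 := size_sub_size_col hv hv'
    have h4 := h 0
    simp only [Function.iterate_zero, id] at h4
    rw [hcol] at h2
    have huv : u = v := by omega
    subst huv
    refine ext' fun p => ?_
    rcases le_or_gt p u with hp | hp
    · rw [hu p hp, hv p hp]
    · have h5 := hu' p hp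
      have h6 := hv' p hp
      have h7 : a.col.g p = b.col.g p := by rw [hcol]
      simp only [col_g] at h7
      omega

end Profile

namespace Profile

variable {d e : ℕ} {a : Profile}

/-! ### The ladder of skipped positions -/

/-- The condition that all rim hooks of size divisible by `e` have arm length `0` modulo `d`: rim
hooks correspond to a gap `p` below a bead `q`, have size `q - p` and arm length `g q - g p - 1`. -/
def Balanced (d e : ℕ) (a : Profile) : Prop :=
  ∀ p q : ℤ, p < q → (p : ZMod e) = q → a.Gap p → a.Bead q → (a.g q : ZMod d) = a.g p + 1

/-- The condition that all rim hooks of size divisible by `e` have arm length `-1` modulo `d`. -/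
def ShiftBalanced (d e : ℕ) (a : Profile) : Prop :=
  ∀ p q : ℤ, p < q → (p : ZMod e) = q → a.Gap p → a.Bead q → (a.g q : ZMod d) = a.g p

/-- In some residue class modulo `e` there is no bead with label `1` modulo `d`; the first row of
the runner matrix has a zero entry. -/
def HasZero (d e : ℕ) (a : Profile) : Prop :=
  ∃ y : ℤ, ∀ p : ℤ, (p : ZMod e) = y → a.Bead p → (a.g p : ZMod d) ≠ 1

/-- The number of skipped positions in the interval from `p` up to `h`. The end `h` is usually a
position from which on everything is skipped. -/
noncomputable def skips (e : ℕ) (a : Profile) (h p : ℤ) : ℤ := ∑ x ∈ Ico p h, skip e a x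

theorem skips_self (h : ℤ) : skips e a h h = 0 := by simp [skips]

theorem skips_eq {h p : ℤ} (hp : p < h) : skips e a h p = skip e a p + skips e a h (p + 1) := by
  rw [skips, skips, ← Order.succ_eq_add_one, ← insert_Ico_succ_left_eq_Ico hp,
    Finset.sum_insert (by simp)]

theorem skips_nonneg (h p : ℤ) : 0 ≤ skips e a h p :=
  Finset.sum_nonneg fun x _ => by unfold skip; split_ifs <;> omega

variable [NeZero e]

omit [NeZero e] in
/-- If a segment ends directly above the skipped position `c`, then it starts at the bead `c + e`.
-/
theorem bead_above (he : 0 < e) {c : ℤ} (h : sweep e a c = 0) (h' : sweep e a (c + 1) ≠ 0) :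
    a.Bead (c + e) ∧ sweep e a (c + e) = e := by
  obtain ⟨b, hb, hb', hb''⟩ := segment_start he h'
  rw [sweep_succ_of_zero_of_ne h h'] at hb''
  obtain rfl : b = c + e := by push_cast at hb''; omega
  exact ⟨hb, hb'⟩

/-- From a skipped position `c` directly below a segment, contiguous segments lead up to the next
skipped position `t`. They start at the beads `c + e, c + 2 * e, …`, the last of which is `t - 1`.
Comparing the bead `t - 1` with the gap `c` gives the label of `t`. -/
theorem exists_next_skip (hb : Balanced d e a) {h c : ℤ} (hh : ∀ p, h ≤ p → sweep e a p = 0)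
    (hc : sweep e a c = 0) (hc' : sweep e a (c + 1) ≠ 0) :
    ∃ t, c + 1 < t ∧ t ≤ h ∧ sweep e a t = 0 ∧ (t : ZMod e) = c + 1 ∧
      (a.g t : ZMod d) = a.g c + 1 ∧ skips e a h t = skips e a h (c + 1) ∧
      (∀ x, c < x → x < t → (x : ZMod e) = c → a.Bead x) ∧ a.Bead (t - 1) := by
  have he := NeZero.pos e
  have hgap := gap_of_sweep_eq_zero he hc
  -- `b` runs through the beads `c + e`, `c + 2e`, … that start contiguous segments
  have key : ∀ n : ℕ, ∀ b, h ≤ b + n → c < b → (b : ZMod e) = c → sweep e a b = e → a.Bead b →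
      skips e a h b = skips e a h (c + 1) → (∀ x, c < x → x ≤ b → (x : ZMod e) = c → a.Bead x) →
      ∃ t, c + 1 < t ∧ t ≤ h ∧ sweep e a t = 0 ∧ (t : ZMod e) = c + 1 ∧
      (a.g t : ZMod d) = a.g c + 1 ∧ skips e a h t = skips e a h (c + 1) ∧
      (∀ x, c < x → x < t → (x : ZMod e) = c → a.Bead x) ∧ a.Bead (t - 1) := by
    intro n
    induction n with
    | zero =>
      intro b hn _ _ hs
      rw [hh b (by push_cast at hn; omega)] at hs
      omega
    | succ n ih =>
      intro b hn hcb hcast hs hbead hsk hall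
      have hbh : b < h := by
        by_contra h1
        rw [hh b (by omega)] at hs; omega
      have hsk' := skips_eq (e := e) (a := a) hbh
      rw [skip_of_ne (by omega), zero_add] at hsk'
      by_cases h0 : sweep e a (b + 1) = 0
      · refine ⟨b + 1, by omega, by omega, h0, by push_cast; rw [hcast], ?_, by rw [← hsk', hsk],
          fun x h1 h2 h3 => hall x h1 (by omega) h3, by rwa [add_sub_cancel_right]⟩
        rw [hbead]
        exact hb c b hcb hcast.symm hgap hbead
      · have h1 : sweep e a (b + 1) = 1 := by
          have := sweep_eq e a b
          by_contra h2
          rw [if_pos (by omega)] at this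
          have := sweep_le (a := a) he (b + 1)
          omega
        obtain ⟨b', hb1, hb2, hb3⟩ := segment_start he h0
        rw [h1] at hb3
        obtain rfl : b' = b + e := by push_cast at hb3; omega
        refine ih (b + e) (by push_cast at hn; omega) (by omega) (by push_cast; simp [hcast]) hb2 hb1
          ?_ ?_
        · rw [← hsk]
          have : ∀ n : ℕ, n ≤ e → skips e a h b = skips e a h (b + n) := by
            intro n
            induction n with
            | zero => simp
            | succ n ihn =>
              intro hne
              have h3 : sweep e a (b + n) ≠ 0 := by
                rcases Nat.eq_zero_or_pos n with h4 | h4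
                · subst h4; push_cast; rw [add_zero]; omega
                · have := sweep_sub (e := e) (a := a) (b := b + e) (n := e - n) (by omega)
                  rw [show b + (e : ℤ) - (e - n : ℕ) = b + n by omega] at this
                  omega
              have h5 : b + n < h := by
                by_contra h6
                exact h3 (hh _ (by omega))
              have := skips_eq (e := e) (a := a) h5
              rw [skip_of_ne h3, zero_add] at this
              rw [ihn (by omega), this]
              push_cast
              ring_nf
          exact (this e le_rfl).symm
        · intro x hx hx' hxc
          rcases le_or_gt x b with h3 | h3
          · exact hall x hx h3 hxc
          · have := Int.le_sub_of_cast_eq h3 (by rw [hcast, hxc])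
            obtain rfl : x = b + e := by omega
            exact hb1
  obtain ⟨h1, h2⟩ := bead_above he hc hc'
  have h3 : ∀ n : ℕ, 0 < n → n ≤ e → skips e a h (c + 1) = skips e a h (c + n) := by
    intro n
    induction n with
    | zero => simp
    | succ n ihn =>
      intro _ hne
      rcases Nat.eq_zero_or_pos n with h4 | h4
      · subst h4; simp
      · have h3 : sweep e a (c + n) ≠ 0 := by
          have := sweep_sub (e := e) (a := a) (b := c + e) (n := e - n) (by omega)
          rw [show c + (e : ℤ) - (e - n : ℕ) = c + n by omega] at this
          omega
        have h5 : c + n < h := by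
          by_contra h6
          exact h3 (hh _ (by omega))
        have := skips_eq (e := e) (a := a) h5
        rw [skip_of_ne h3, zero_add] at this
        rw [ihn h4 (by omega), this]
        push_cast
        ring_nf
  refine key (h - (c + e)).toNat (c + e) (by omega) (by omega) (by simp) h2 h1 (h3 e he le_rfl).symm ?_
  intro x hx hx' hxc
  have := Int.le_sub_of_cast_eq hx hxc.symm
  obtain rfl : x = c + e := by omega
  exact h1

/-- The next skipped position `t` above a skipped position `c` lies in the residue class of `c + 1`,
and its label is larger by one modulo `d`. -/
theorem exists_next (hb : Balanced d e a) {h c : ℤ} (hh : ∀ p, h ≤ p → sweep e a p = 0)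
    (hc : sweep e a c = 0) (hch : c < h) :
    ∃ t, c < t ∧ t ≤ h ∧ sweep e a t = 0 ∧ (t : ZMod e) = c + 1 ∧
      (a.g t : ZMod d) = a.g c + 1 ∧ skips e a h c = skips e a h t + 1 ∧
      (∀ x, c < x → x < t → (x : ZMod e) = c → a.Bead x) := by
  have h1 := skips_eq (e := e) (a := a) hch
  rw [skip_of_eq hc] at h1
  by_cases h0 : sweep e a (c + 1) = 0
  · refine ⟨c + 1, by omega, by omega, h0, by push_cast; rfl, ?_, by omega, fun x _ _ => by omega⟩
    rw [show a.g (c + 1) = a.g c + 1 from gap_of_sweep_eq_zero (NeZero.pos e) hc]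
    push_cast; rfl
  · obtain ⟨t, h2, h3, h4, h5, h6, h7, h8, -⟩ := exists_next_skip hb hh hc h0
    exact ⟨t, by omega, h3, h4, h5, h6, by omega, h8⟩

/-- Induction along the skipped positions, from above. -/
theorem skip_induction (hb : Balanced d e a) {h : ℤ} (hh : ∀ p, h ≤ p → sweep e a p = 0)
    {P : ℤ → Prop} (h0 : P h)
    (h1 : ∀ c t, sweep e a c = 0 → c < h → c < t → t ≤ h → sweep e a t = 0 →
      (t : ZMod e) = c + 1 → (a.g t : ZMod d) = a.g c + 1 → skips e a h c = skips e a h t + 1 →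
      (∀ x, c < x → x < t → (x : ZMod e) = c → a.Bead x) → P t → P c)
    {c : ℤ} (hc : sweep e a c = 0) (hch : c ≤ h) : P c := by
  obtain ⟨n, hn⟩ : ∃ n : ℕ, (h - c).toNat = n := ⟨_, rfl⟩
  induction n using Nat.strong_induction_on generalizing c with
  | _ n ih =>
    rcases hch.eq_or_lt with h2 | h2
    · rwa [h2]
    · obtain ⟨t, h3, h4, h5, h6, h7, h8, h9⟩ := exists_next hb hh hc h2
      exact h1 c t hc h2 h3 h4 h5 h6 h7 h8 h9 (ih (h - t).toNat (by omega) h5 h4 rfl)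

/-- The skipped positions form a ladder: at the one with number `v` from above, both the position
modulo `e` and the label modulo `d` are the initial ones minus `v`. -/
theorem ladder (hb : Balanced d e a) {h c : ℤ} (hh : ∀ p, h ≤ p → sweep e a p = 0)
    (hc : sweep e a c = 0) (hch : c ≤ h) :
    (a.g c : ZMod d) = a.g h - skips e a h c ∧ (c : ZMod e) = h - skips e a h c := by
  refine skip_induction hb hh (P := fun c => (a.g c : ZMod d) = a.g h - skips e a h c ∧
    (c : ZMod e) = h - skips e a h c) (by simp [skips_self]) ?_ hc hch
  rintro c t - - - - - h1 h2 h3 - ⟨h4, h5⟩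
  rw [h3]
  push_cast
  rw [h4] at h2
  rw [h5] at h1
  constructor
  · rw [sub_add_eq_sub_sub, h2]; ring
  · rw [sub_add_eq_sub_sub, h1]; ring

/-- Every value between `0` and the number at `c` is the number of skipped positions from some
skipped position on. -/
theorem exists_skips_eq (hb : Balanced d e a) {h c : ℤ} (hh : ∀ p, h ≤ p → sweep e a p = 0)
    (hc : sweep e a c = 0) (hch : c ≤ h) {v : ℤ} (hv : 0 ≤ v) (hv' : v ≤ skips e a h c) :
    ∃ t, c ≤ t ∧ t ≤ h ∧ sweep e a t = 0 ∧ skips e a h t = v := by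
  refine skip_induction hb hh (P := fun c => v ≤ skips e a h c →
    ∃ t, c ≤ t ∧ t ≤ h ∧ sweep e a t = 0 ∧ skips e a h t = v) ?_ ?_ hc hch hv'
  · intro h1
    rw [skips_self] at h1
    exact ⟨h, le_rfl, le_rfl, hh h le_rfl, by rw [skips_self]; omega⟩
  · intro c t h1 h2 h3 h4 h5 _ _ h6 _ ih hvc
    rcases hvc.eq_or_lt with h7 | h7
    · exact ⟨c, le_rfl, h2.le, h1, h7.symm⟩
    · obtain ⟨x, hx, hx'⟩ := ih (by omega)
      exact ⟨x, by omega, hx'⟩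

/-- Let `x` lie above the skipped position `t`, in the same residue class modulo `e`, and let its
label not allow a bead at `x`. Then `x` and everything above it are gaps: `x` is a gap, so `x + 1`
has the same defect with respect to the next skipped position, and so on. -/
theorem gap_of_ladder (hb : Balanced d e a) {h t x : ℤ}
    (hh : ∀ p, h ≤ p → a.Gap p) (hh' : ∀ p, h ≤ p → sweep e a p = 0)
    (ht : sweep e a t = 0) (hth : t ≤ h) (hx : t < x)
    (hcast : (x : ZMod e) = t) (hl : (a.g x : ZMod d) ≠ a.g t + 1) : ∀ y ≥ x, a.Gap y := by
  refine skip_induction hb hh' (P := fun t => ∀ x, t < x → (x : ZMod e) = t →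
    (a.g x : ZMod d) ≠ a.g t + 1 → ∀ y ≥ x, a.Gap y) ?_ ?_ ht hth x hx hcast hl
  · intro x hx _ _ y hy
    exact hh y (by omega)
  · intro c t h1 h2 h3 h4 h5 h6 h7 _ h9 ih x hx hcast hl y hy
    have hgx : a.Gap x := by
      by_contra h
      exact hl (hb c x hx hcast.symm (gap_of_sweep_eq_zero (NeZero.pos e) h1) (not_gap.1 h))
    have hxt : t ≤ x := by
      by_contra h
      exact not_bead.2 hgx (h9 x hx (by omega) hcast)
    rcases hy.eq_or_lt' with h10 | h10
    · rwa [h10]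
    · refine ih (x + 1) (by omega) (by push_cast; rw [hcast, h6]) ?_ y (by omega)
      rw [show a.g (x + 1) = a.g x + 1 from hgx, h7]
      push_cast
      intro h
      exact hl (add_right_cancel h)

/-- The number of boxes lost by trimming in terms of skipped positions. -/
theorem size_sub_size_trim_eq (a : Profile) : ∀ᶠ N : ℤ in atTop,
    a.size - (trim e a).size = N - a.s - skips e a N (-N) := by
  filter_upwards [a.eventually_size, (trim e a).eventually_size, eventually_gt_atTop (|a.s|)]
    with N h1 h2 h3
  have h4 := le_abs_self a.s
  have h5 := neg_abs_le a.s
  have := Int.sum_Ico_telescope (fun p => max 0 (p - a.s)) (a := -N) (b := N) (by omega)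
  rw [max_eq_right (by omega), max_eq_left (by omega), sub_zero] at this
  rw [h1, h2, ← this, skips, ← Finset.sum_sub_distrib, ← Finset.sum_sub_distrib]
  refine Finset.sum_congr rfl fun p _ => ?_
  rw [trim_g, trim_s, show p - (a.s - 1) = p + 1 - a.s by ring]
  ring

end Profile

namespace Profile

variable {d e : ℕ} {a : Profile}

/-! ### Trimming preserves balance -/

theorem skips_anti {h p q : ℤ} (hpq : p ≤ q) : skips e a h q ≤ skips e a h p :=
  Finset.sum_le_sum_of_subset_of_nonneg (Finset.Ico_subset_Ico_left hpq) fun x _ _ => by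
    unfold skip; split_ifs <;> omega

theorem skips_pos {h p : ℤ} (hp : p < h) (hs : sweep e a p = 0) : 1 ≤ skips e a h p := by
  have := skips_nonneg (e := e) (a := a) h (p + 1)
  have := skips_eq (e := e) (a := a) hp
  rw [skip_of_eq hs] at this
  omega

theorem Balanced.col (hb : Balanced d e a) : Balanced d e a.col := by
  intro p q hpq hc hp hq
  have h0 := a.nonneg p
  have h1 := a.step p
  have h2 := a.step q
  have h3 := a.mono (show p + 1 ≤ q by omega)
  unfold Gap at hp
  unfold Bead at hq
  simp only [col_g] at hp hq ⊢
  have h4 := hb p q hpq hc (by unfold Gap; omega) (by unfold Bead; omega)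
  rw [max_eq_left (by omega), max_eq_left (by omega)]
  push_cast
  rw [h4]; ring

theorem one_ne_zero_of (hd : 1 < d) : (1 : ZMod d) ≠ 0 := by
  have : Fact (1 < d) := ⟨hd⟩
  exact one_ne_zero

variable [NeZero e]

omit [NeZero e] in
theorem cast_e_ne_zero (hd : 1 < d) (hcop : Nat.Coprime d e) : (e : ZMod d) ≠ 0 := by
  intro h
  have := Nat.Coprime.eq_one_of_dvd hcop ((ZMod.natCast_eq_zero_iff _ _).1 h)
  omega

section Trim

-- In this section `t` is the last bead.
variable (hd : 1 < d) (hcop : Nat.Coprime d e) (hb : Balanced d e a) {t : ℤ}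
  (ht : a.Bead t) (ht' : ∀ p, t < p → a.g p = p - a.s)
include hd hcop hb ht ht'

/-- A skipped position in the residue class of the last bead `t` is the highest skipped position
below `t`. Otherwise the ladder has a step with number `e + 1`, which also lies in this class, and
balance between it and the bead `t` forces `d ∣ e`. -/
theorem skips_eq_one {c : ℤ} (hc : sweep e a c = 0) (hct : c ≤ t) (hcast : (c : ZMod e) = t) :
    skips e a (t + 1) c = 1 := by
  have hh : ∀ p, t + 1 ≤ p → sweep e a p = 0 := fun p hp => sweep_of_top ht' (by omega)
  have hts := sweep_of_bead (NeZero.pos e) ht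
  have hne : ∀ x, sweep e a x = 0 → x ≤ t → x < t := fun x hx hxt =>
    lt_of_le_of_ne hxt (by rintro rfl; exact hts hx)
  have h1 := skips_pos (by omega : c < t + 1) hc
  by_contra h2
  obtain ⟨h3, h4⟩ := ladder hb hh hc (by omega)
  have h5 : ((1 : ℤ) : ZMod e) = skips e a (t + 1) c := by
    rw [hcast] at h4
    push_cast at h4 ⊢
    linear_combination -h4
  have h6 := Int.le_sub_of_cast_eq (by omega) h5
  obtain ⟨x, -, hx1, hx2, hx3⟩ := exists_skips_eq hb hh hc (by omega) (v := e + 1) (by omega)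
    (by omega)
  have hxt : x < t := by
    refine hne x hx2 ?_
    by_contra h
    obtain rfl : x = t + 1 := by omega
    rw [skips_self] at hx3; omega
  obtain ⟨h7, h8⟩ := ladder hb hh hx2 hx1
  have h9 : (x : ZMod e) = t := by
    rw [h8, hx3]; push_cast; simp
  have h10 := hb x t hxt h9 (gap_of_sweep_eq_zero (NeZero.pos e) hx2) ht
  rw [h7, hx3, ht] at h10
  apply cast_e_ne_zero hd hcop
  push_cast at h10
  linear_combination h10

/-- If `c` and `c + 1` are both skipped, then there is no bead above `c` in its residue class. A
bead at `x` would make everything above `x` a gap, so that `x` is the last bead; this contradicts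
`skips_eq_one`, as `c` and `c + 1` are two steps of the ladder. -/
theorem no_bead_above_skip {c x : ℤ} (hc : sweep e a c = 0) (hc' : sweep e a (c + 1) = 0)
    (hx : c < x) (hcast : (x : ZMod e) = c) : a.Gap x := by
  by_contra hbx
  rw [not_gap] at hbx
  have hh : ∀ p, t + 1 ≤ p → sweep e a p = 0 := fun p hp => sweep_of_top ht' (by omega)
  have hg : ∀ p, t + 1 ≤ p → a.Gap p := fun p hp => gap_of_top ht' (by omega)
  have hxt : x ≤ t := by
    by_contra h
    exact not_bead.2 (hg x (by omega)) hbx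
  have hgc := gap_of_sweep_eq_zero (NeZero.pos e) hc
  have h1 := hb c x hx hcast.symm hgc hbx
  have h2 := gap_of_ladder hb hg hh hc' (by omega) (x := x + 1) (by omega)
    (by push_cast; rw [hcast]) (by
      rw [hbx, hgc, h1]
      push_cast
      intro h
      exact one_ne_zero_of hd (by linear_combination -h))
  have h3 : x = t := by
    by_contra h
    exact not_bead.2 (h2 t (by omega)) ht
  subst h3
  have h4 := skips_eq_one hd hcop hb ht ht' hc (by omega) hcast.symm
  have h5 := skips_pos (by omega : c + 1 < x + 1) hc'
  have h6 := skips_eq (e := e) (a := a) (by omega : c < x + 1)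
  rw [skip_of_eq hc] at h6
  omega

/-- Let a segment start at the bead `b` directly below a skipped position. All beads above `b` in
its residue class have label `g b + 1`. Otherwise such a bead is the last bead `x`, and counting
modulo `e` shows that the ladder from `b + 1` to the top has exactly `e` steps; comparison of labels
along the top segments then gives a contradiction. -/
theorem label_above_segment {b x : ℤ} (hbb : a.Bead b) (hb1 : sweep e a (b + 1) = 0)
    (hx : b < x) (hbx : a.Bead x) (hcast : (x : ZMod e) = b) :
    (a.g x : ZMod d) = a.g b + 1 := by
  by_contra hne
  have hh : ∀ p, t + 1 ≤ p → sweep e a p = 0 := fun p hp => sweep_of_top ht' (by omega)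
  have hg : ∀ p, t + 1 ≤ p → a.Gap p := fun p hp => gap_of_top ht' (by omega)
  have hle : ∀ x, a.Bead x → x ≤ t := by
    intro x hx
    by_contra h
    exact not_bead.2 (hg x (by omega)) hx
  have key : ∀ x, b < x → a.Bead x → (x : ZMod e) = b → (a.g x : ZMod d) ≠ a.g b + 1 → x = t := by
    intro x hx hbx hcast hne
    have h1 := gap_of_ladder hb hg hh hb1 (by have := hle x hbx; omega) (x := x + 1) (by omega)
      (by push_cast; rw [hcast]) (by rwa [hbx, hbb])
    by_contra h
    exact not_bead.2 (h1 t (by have := hle x hbx; omega)) ht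
  obtain rfl := key x hx hbx hcast hne
  have hV1 := skips_pos (by omega : b + 1 < x + 1) hb1
  obtain ⟨l1, l2⟩ := ladder hb hh hb1 (by omega)
  -- the ladder from `b + 1` to the top has exactly `e` steps
  have hV : skips e a (x + 1) (b + 1) = e := by
    have h1 : ((0 : ℤ) : ZMod e) = skips e a (x + 1) (b + 1) := by
      push_cast at l2 ⊢
      rw [hcast] at l2
      linear_combination -l2
    have h2 := Int.le_sub_of_cast_eq (by omega) h1
    by_contra h3
    obtain ⟨y, -, hy1, hy2, hy3⟩ := exists_skips_eq hb hh hb1 (by omega) (v := e + 1) (by omega)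
      (by omega)
    obtain ⟨-, h8⟩ := ladder hb hh hy2 hy1
    have hyt : y ≤ x := by
      by_contra h
      obtain rfl : y = x + 1 := by omega
      rw [skips_self] at hy3; omega
    have := skips_eq_one hd hcop hb ht ht' hy2 hyt (by rw [h8, hy3]; push_cast; simp)
    have := NeZero.pos e
    omega
  have he := NeZero.pos e
  obtain ⟨c, hbc, hc1, hc2, hc3⟩ := exists_skips_eq hb hh hb1 (by omega) (v := 1) (by omega)
    (by omega)
  obtain ⟨-, l4⟩ := ladder hb hh hc2 hc1
  have hcx : c < x := by
    by_contra h
    rcases eq_or_lt_of_le (show x ≤ c by omega) with h1 | h1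
    · subst h1; exact sweep_of_bead he hbx hc2
    · obtain rfl : c = x + 1 := by omega
      rw [skips_self] at hc3; omega
  have hcc : (c : ZMod e) = x := by rw [l4, hc3]; push_cast; ring
  have hgc := gap_of_sweep_eq_zero he hc2
  have hlx := hb c x hcx hcc hgc hbx
  have hcex := Int.le_sub_of_cast_eq hcx hcc
  rcases hcex.eq_or_lt with h1 | h1
  · -- the top segment has length `e`, and all positions inside it are gaps
    have hgaps : ∀ p, c < p → p < x → a.Gap p := by
      intro p hp hp'
      by_contra hbp
      rw [not_gap] at hbp
      obtain ⟨y, -, hy1, hy2, hy3⟩ := exists_skips_eq hb hh hb1 (by omega) (v := x + 1 - p)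
        (by omega) (by omega)
      obtain ⟨-, h8⟩ := ladder hb hh hy2 hy1
      have hyc : y < c := by
        by_contra h
        have := skips_anti (e := e) (a := a) (h := x + 1) (show c ≤ y by omega)
        omega
      have hyp : (y : ZMod e) = p := by rw [h8, hy3]; push_cast; ring
      obtain ⟨z, hz1, hz2, hz3, hz4, hz5, hz6, -⟩ := exists_next hb hh hy2 (by omega)
      have hzc : z ≤ c := by
        by_contra h
        have h9 := skips_anti (e := e) (a := a) (h := x + 1) (show c + 1 ≤ z by omega)
        have h10 := skips_eq (e := e) (a := a) (show c < x + 1 by omega)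
        rw [skip_of_eq hc2] at h10
        omega
      have h10 := hb y p (by omega) hyp (gap_of_sweep_eq_zero he hy2) hbp
      have h11 := gap_of_ladder hb hg hh hz3 hz2 (x := p + 1) (by omega)
        (by push_cast; rw [hz4, hyp]) (by
          rw [hbp, hz5, h10]
          intro h
          exact one_ne_zero_of hd (by linear_combination -h))
      exact not_bead.2 (h11 x (by omega)) hbx
    have hcount : ∀ n : ℕ, n ≤ e → a.g (c + n) = a.g c + n := by
      intro n
      induction n with
      | zero => simp
      | succ n ih =>
        intro hn
        have h2 : a.Gap (c + n) := by
          rcases Nat.eq_zero_or_pos n with h3 | h3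
          · subst h3; simpa using hgc
          · exact hgaps _ (by omega) (by omega)
        have h4 := ih (by omega)
        unfold Gap at h2
        push_cast
        rw [← add_assoc, h2, h4]; ring
    have h2 := hcount e le_rfl
    rw [h1] at h2
    apply hne
    rw [hbb, hV, show a.g (x + 1) = a.g x from hbx] at l1
    rw [l1]
    rw [h2] at hlx ⊢
    push_cast at hlx ⊢
    linear_combination hlx
  · obtain ⟨z, hz1, hz2, hz3, hz4, hz5, hz6, hz7⟩ := exists_next hb hh hc2 (by omega)
    have hz : z = x + 1 := by
      by_contra h
      have := skips_pos (by omega : z < x + 1) hz3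
      omega
    have hbe := hz7 (c + e) (by omega) (by omega) (by simp)
    have hle2 := hb c (c + e) (by omega) (by simp) hgc hbe
    apply hne
    rw [hlx, ← hle2]
    by_contra h2
    have := key (c + e) (by omega) hbe (by push_cast; simp [hcc, hcast]) h2
    omega

end Trim

/-- A bead of the trimmed profile comes from a bead of `a` weakly above it in its residue class with
the same label, and a gap from a gap or from the first bead of a segment; in each case balance of
`a`, or one of the preceding lemmas, applies. -/
theorem Balanced.trim (hd : 1 < d) (hcop : Nat.Coprime d e) (hb : Balanced d e a) :
    Balanced d e (trim e a) := by
  have he := NeZero.pos e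
  obtain ⟨t, ht, ht'⟩ := a.exists_top
  intro p q hpq hc hp hq
  -- a bead of the trimmed profile comes from a bead of `a` weakly above it in its residue class
  obtain ⟨x, hx, hxc, hbx, hlx⟩ : ∃ x, q ≤ x ∧ (x : ZMod e) = q ∧ a.Bead x ∧
      ((Profile.trim e a).g q : ZMod d) = a.g x := by
    unfold Bead at hq
    simp only [trim_g] at hq ⊢
    rcases skip_cases e a q with ⟨h1, h2⟩ | ⟨h1, h2⟩ <;>
    rcases skip_cases e a (q + 1) with ⟨h3, h4⟩ | ⟨h3, h4⟩ <;> rw [h2, h4] at hq <;> rw [h2]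
    · have := gap_of_sweep_eq_zero he h1
      unfold Gap at this
      omega
    · obtain ⟨h5, -⟩ := bead_above he h1 h3
      refine ⟨q + e, by omega, by simp, h5, ?_⟩
      rw [hb q (q + e) (by omega) (by simp) (gap_of_sweep_eq_zero he h1) h5]
      push_cast; rfl
    · have := a.step q
      omega
    · exact ⟨q, le_rfl, rfl, by unfold Bead; omega, by simp⟩
  rw [hlx]
  have hpx : p < x := by omega
  have hxp : (x : ZMod e) = p := by rw [hxc, hc]
  unfold Gap at hp
  simp only [trim_g] at hp ⊢
  rcases skip_cases e a p with ⟨h1, h2⟩ | ⟨h1, h2⟩ <;>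
  rcases skip_cases e a (p + 1) with ⟨h3, h4⟩ | ⟨h3, h4⟩ <;> rw [h2, h4] at hp <;> rw [h2]
  · exact absurd hbx (not_bead.2 (no_bead_above_skip hd hcop hb ht ht' h1 h3 hpx hxp))
  · have := a.step p
    omega
  · have hbp := (bead_of_ne_of_sweep_succ h1 (by omega)).1
    rw [label_above_segment hd hcop hb ht ht' hbp h3 hpx hbx hxp, add_zero]
  · rw [add_zero]
    exact hb p x hpx hxp.symm (by unfold Gap; omega) hbx

end Profile

namespace Profile

variable {d e : ℕ} {a : Profile}

/-! ### Labelled beads -/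

/-- The sum of `f` over the beads in `[-N, N)`, where `f` is evaluated at the label modulo `d` and
the position modulo `e`. For `f` an indicator function it counts beads. -/
noncomputable def beadSum (d e : ℕ) (a : Profile) (N : ℤ) (f : ZMod d → ZMod e → ℤ) : ℤ :=
  ∑ p ∈ Ico (-N) N, if a.Bead p then f (a.g p) p else 0

/-- The two profiles have the same charge and the same multiset of pairs (label modulo `d`, position
modulo `e`) of beads. Both multisets are infinite, and are compared on all large intervals. -/
def Partner (d e : ℕ) (a b : Profile) : Prop :=
  a.s = b.s ∧ ∀ᶠ N : ℤ in atTop, ∀ f, beadSum d e a N f = beadSum d e b N f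

/-- If the number of beads with property `P` is eventually not positive, then no bead has property
`P`. -/
theorem forall_bead_of_beadSum_eq_zero {P : ZMod d → ZMod e → Prop} [∀ x y, Decidable (P x y)]
    (h : ∀ᶠ N : ℤ in atTop, beadSum d e a N (fun x y => if P x y then 1 else 0) ≤ 0) {p : ℤ}
    (hp : a.Bead p) : ¬ P (a.g p) p := by
  intro hP
  obtain ⟨N, h1, h2⟩ := (h.and (eventually_gt_atTop |p|)).exists
  have h3 := le_abs_self p
  have h4 := neg_abs_le p
  have h5 : (if a.Bead p then (if P (a.g p) p then (1 : ℤ) else 0) else 0) ≤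
      beadSum d e a N (fun x y => if P x y then 1 else 0) :=
    Finset.single_le_sum (f := fun p : ℤ => if a.Bead p then (if P (a.g p) p then (1 : ℤ) else 0) else 0)
      (fun x _ => by split_ifs <;> omega) (mem_Ico.2 ⟨by omega, by omega⟩)
  rw [if_pos hp, if_pos hP] at h5
  omega

theorem beadSum_eq_zero {P : ZMod d → ZMod e → Prop} [∀ x y, Decidable (P x y)]
    (h : ∀ p : ℤ, a.Bead p → ¬ P (a.g p) p) (N : ℤ) :
    beadSum d e a N (fun x y => if P x y then 1 else 0) = 0 := by
  refine Finset.sum_eq_zero fun p _ => ?_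
  split_ifs with h1
  · exact if_neg (h p h1)
  · rfl

/-- The residue class of the gap with label `2` contains no bead with label `1` after removal of the
first column: such a bead has label `2` before, and lies neither above the gap, by balance, nor
below it, where it would belong to a run of at least `e` beads, one of them above the first gap in
the residue class of the latter. -/
theorem Balanced.hasZero_col (hd : 1 < d) (he : 0 < e) (hb : Balanced d e a) : HasZero d e a.col := by
  obtain ⟨t, -, ht⟩ := a.exists_top
  obtain ⟨u, hu, hu'⟩ := a.exists_firstGap
  -- `x` is the gap with two gaps below it
  obtain ⟨x, hx, hm⟩ := Int.exists_greatest_of_bdd (P := fun x => a.g x ≤ 2)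
    ⟨a.s + 2, fun z hz => by have := a.sub_le z; omega⟩ ⟨u, by rw [hu u le_rfl]; omega⟩
  have hx1 : 2 < a.g (x + 1) := by
    by_contra h
    have := hm (x + 1) (by omega); omega
  have hstep := a.step x
  have hx2 : a.g x = 2 := by omega
  have hgx : a.Gap x := by unfold Gap; omega
  have h10 := one_ne_zero_of hd
  refine ⟨x, fun p hpx hbp hl => ?_⟩
  unfold Bead at hbp
  simp only [col_g] at hbp hl
  have hgp : 2 ≤ a.g p := by
    by_contra h
    rw [max_eq_right (by omega)] at hl
    push_cast at hl
    exact h10 hl.symm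
  rw [max_eq_left (by omega)] at hl
  have hlp : (a.g p : ZMod d) = 2 := by
    push_cast at hl
    linear_combination hl
  have hbp' : a.Bead p := by unfold Bead; omega
  rcases lt_trichotomy p x with h | h | h
  · have h1 := Int.le_sub_of_cast_eq h hpx
    have h2 : ∀ y, p ≤ y → y < x → a.Bead y ∧ a.g y = 2 := by
      intro y hy hy'
      have h3 := a.mono hy
      have h4 := a.mono hy'.le
      have h5 := a.mono (show y + 1 ≤ x by omega)
      have h6 := a.step y
      unfold Bead
      omega
    obtain ⟨y, hy, hy', hyu⟩ := Int.exists_mem_Ico_cast_eq he p u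
    obtain ⟨h3, h4⟩ := h2 y hy (by omega)
    have hgu : a.Gap u := by
      have := hu' (u + 1) (by omega)
      have := hu u le_rfl
      have := a.step u
      unfold Gap; omega
    have huy : u < y := by
      by_contra h5
      rw [hu y (by omega)] at h4; omega
    have h5 := hb u y huy hyu.symm hgu h3
    rw [h4, hu u le_rfl] at h5
    push_cast at h5
    apply h10
    linear_combination h5
  · subst h
    exact not_bead.2 hgx hbp'
  · have h1 := hb x p h hpx.symm hgx hbp'
    rw [hlp, hx2] at h1
    push_cast at h1
    apply h10
    linear_combination -h1

variable [NeZero e]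

/-- Trimming a balanced profile removes one labelled bead, whose label and position are given by the
number of skipped positions. By the ladder, the changes at the individual positions telescope. -/
theorem eventually_beadSum_trim (hb : Balanced d e a) : ∀ᶠ N : ℤ in atTop, ∀ f,
    beadSum d e (trim e a) N f = beadSum d e a N f -
      f (a.g N - skips e a N (-N)) (N - 1 - skips e a N (-N)) := by
  obtain ⟨u, hu, -⟩ := a.exists_firstGap
  filter_upwards [eventually_ge_atTop a.bound, eventually_gt_atTop (-u), eventually_gt_atTop 0]
    with N hN hN' hN0 f
  have he := NeZero.pos e
  have hh : ∀ p, N ≤ p → sweep e a p = 0 := fun p hp => sweep_of_bound_le (by omega)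
  have h1 := Int.sum_Ico_telescope (fun p => if sweep e a p = 0 then 0 else
    f (a.g N - skips e a N p) (N - 1 - skips e a N p)) (a := -N) (b := N) (by omega)
  rw [if_pos (hh N le_rfl), if_neg (sweep_of_bead he (bead_of_first hu (by omega)))] at h1
  rw [zero_sub] at h1
  rw [sub_eq_add_neg, ← h1, beadSum, beadSum, ← Finset.sum_add_distrib]
  refine Finset.sum_congr rfl fun p hp => ?_
  rw [mem_Ico] at hp
  have hsk := skips_eq (e := e) (a := a) hp.2
  have hT : ∀ p, (trim e a).Bead p ↔ a.g (p + 1) + skip e a (p + 1) = a.g p + skip e a p :=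
    fun p => Iff.rfl
  rcases skip_cases e a p with ⟨h1, h2⟩ | ⟨h1, h2⟩ <;>
  rcases skip_cases e a (p + 1) with ⟨h3, h4⟩ | ⟨h3, h4⟩
  · have hg := gap_of_sweep_eq_zero he h1
    have hb' : ¬ (trim e a).Bead p := by
      rw [hT, h2, h4]; unfold Gap at hg; omega
    rw [if_neg hb', if_neg (not_bead.2 hg), if_pos h1, if_pos h3]
    simp
  · have hg := gap_of_sweep_eq_zero he h1
    obtain ⟨l1, l2⟩ := ladder hb hh h1 hp.2.le
    have hb' : (trim e a).Bead p := by
      rw [hT, h2, h4]; unfold Gap at hg; omega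
    rw [if_pos hb', if_neg (not_bead.2 hg), if_pos h1, if_neg h3, trim_g, h2, zero_add, sub_zero]
    rw [hsk, h2] at l1 l2
    push_cast at l1 l2 ⊢
    congr 1
    · rw [l1]; ring
    · rw [l2]; ring
  · have hbp := (bead_of_ne_of_sweep_succ h1 (by omega)).1
    obtain ⟨l1, l2⟩ := ladder hb hh h3 (by omega)
    have hb' : ¬ (trim e a).Bead p := by
      rw [hT, h2, h4]; unfold Bead at hbp; omega
    rw [if_neg hb', if_pos hbp, if_neg h1, if_pos h3, hsk, h2]
    unfold Bead at hbp
    rw [hbp] at l1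
    rw [l1, show (p : ZMod e) = N - 1 - skips e a N (p + 1) by
      push_cast at l2
      linear_combination l2]
    simp
  · have hb' : (trim e a).Bead p ↔ a.Bead p := by
      rw [hT, h2, h4]; unfold Bead; omega
    rw [if_neg h1, if_neg h3, hsk, h2, trim_g, h2]
    simp [hb']

end Profile

namespace Profile

variable {d e : ℕ} {a : Profile}

/-! ### Adding a first row -/

/-- The profile with an additional last bead at `q`, where only gaps lie from `q` on: a new first
row. -/
def addTop (a : Profile) (q : ℤ) (hq : ∀ p, q ≤ p → a.g p = p - a.s) : Profile where
  g p := if p ≤ q then a.g p else p - (a.s + 1)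
  s := a.s + 1
  step p := by
    have := a.step p
    rcases lt_trichotomy p q with h | h | h
    · rw [if_pos (by omega), if_pos h.le]; exact this
    · subst h
      rw [if_neg (by omega), if_pos le_rfl, hq p le_rfl]; omega
    · rw [if_neg (by omega), if_neg (by omega)]; omega
  low := by
    obtain ⟨x, hx⟩ := a.low
    exact ⟨min x q, fun p hp => by rw [if_pos (by omega), hx p (by omega)]⟩
  high := ⟨q + 1, fun p hp => by rw [if_neg (by omega)]⟩

section AddTop

variable {q : ℤ} {hq : ∀ p, q ≤ p → a.g p = p - a.s}

theorem addTop_s : (addTop a q hq).s = a.s + 1 := rfl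

theorem addTop_g {p : ℤ} (h : p ≤ q) : (addTop a q hq).g p = a.g p := if_pos h

theorem addTop_g_of_lt {p : ℤ} (h : q < p) : (addTop a q hq).g p = p - (addTop a q hq).s :=
  if_neg (by omega)

theorem addTop_bead : (addTop a q hq).Bead q := by
  unfold Bead
  rw [addTop_g le_rfl, addTop_g_of_lt (by omega), addTop_s, hq q le_rfl]; ring

theorem row_addTop : (addTop a q hq).row = a := by
  refine ext' fun p => ?_
  rw [row_g, addTop_s]
  rcases le_or_gt p q with h | h
  · rw [addTop_g h]; have := a.sub_le p; omega
  · rw [addTop_g_of_lt h, addTop_s, hq p h.le]; omega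

theorem eventually_beadSum_addTop : ∀ᶠ N : ℤ in atTop, ∀ f,
    beadSum d e (addTop a q hq) N f = beadSum d e a N f + f ((q - a.s : ℤ)) q := by
  filter_upwards [eventually_gt_atTop |q|] with N hN f
  have h1 := le_abs_self q
  have h2 := neg_abs_le q
  have h3 : f ((q - a.s : ℤ)) q = ∑ p ∈ Ico (-N) N, if p = q then f ((q - a.s : ℤ)) q else 0 := by
    rw [Finset.sum_ite_eq', if_pos (by simp; omega)]
  rw [h3, beadSum, beadSum, ← Finset.sum_add_distrib]
  refine Finset.sum_congr rfl fun p _ => ?_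
  rcases lt_trichotomy p q with h | h | h
  · rw [if_neg h.ne, add_zero, addTop_g h.le]
    refine if_congr ?_ rfl rfl
    unfold Bead
    rw [addTop_g h.le, addTop_g (by omega)]
  · subst h
    have hg : a.Gap p := by unfold Gap; rw [hq p le_rfl, hq _ (by omega)]; ring
    rw [if_pos addTop_bead, if_neg (not_bead.2 hg), if_pos rfl, zero_add, addTop_g le_rfl,
      hq p le_rfl]
  · have hg : a.Gap p := by unfold Gap; rw [hq p h.le, hq _ (by omega)]; ring
    have hg' : (addTop a q hq).Gap p := gap_of_top (fun _ => addTop_g_of_lt) h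
    rw [if_neg (not_bead.2 hg), if_neg (not_bead.2 hg'), if_neg h.ne', add_zero]

end AddTop

/-! ### The inductive step for shift balance -/

section Trim

variable [NeZero e]

theorem HasZero.trim (hb : Balanced d e a) (hz : HasZero d e a) : HasZero d e (trim e a) := by
  classical
  obtain ⟨y, hy⟩ := hz
  refine ⟨y, fun p hp hbp hl => ?_⟩
  refine forall_bead_of_beadSum_eq_zero (d := d) (e := e)
    (P := fun x z => x = 1 ∧ z = (y : ZMod e)) ?_ hbp ⟨hl, hp⟩
  filter_upwards [eventually_beadSum_trim hb] with N hN
  rw [hN, beadSum_eq_zero]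
  · split_ifs <;> omega
  · exact fun p hp h => hy p h.2 hp h.1

/-- Trimming a nonempty balanced profile lowers its size if the runner matrix has a zero in its
first row. A single column whose length is divisible by `e` is fixed by trimming, but it has a bead
with label `1` in every residue class. -/
theorem size_trim_lt (hd : 1 < d) (he : 1 < e) (hb : Balanced d e a) (hz : HasZero d e a)
    (ha : 0 < a.size) : (trim e a).size < a.size := by
  induction a using col_induction with
  | h0 a h => omega
  | h1 a _ ih =>
    have h1 := size_sub_size_trim he a
    rcases a.col.size_nonneg.eq_or_lt with h2 | h2
    · rw [size_trim_of_size_eq_zero h2.symm, ← h2] at h1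
      have h3 : eps e a = 1 := by
        rw [eps, col_trim, size_trim_of_size_eq_zero h2.symm, sub_zero]
        refine if_neg fun hdvd => ?_
        have h4 := Int.le_of_dvd ha hdvd
        obtain ⟨u, hu, hu'⟩ := a.exists_firstGap
        have h5 := size_sub_size_col hu hu'
        have h6 : ∀ p, u < p → p ≤ a.s + 1 → a.g p = 1 := by
          intro p hp hps
          have := hu' p hp
          have := eq_of_size_eq_zero h2.symm p
          rw [col_g, col_s] at this
          omega
        obtain ⟨y, hy⟩ := hz
        obtain ⟨x, hx, hx', hxy⟩ := Int.exists_mem_Ico_cast_eq (by omega : 0 < e) (u + 1) y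
        refine hy x hxy ?_ ?_
        · unfold Bead
          rw [h6 x (by omega) (by omega), h6 (x + 1) (by omega) (by omega)]
        · rw [h6 x (by omega) (by omega)]
          norm_num
      omega
    · have := ih hb.col (hb.hasZero_col hd (by omega)) h2
      have := eps_nonneg (e := e) a
      omega

omit [NeZero e] in
/-- Below the start `x` of a segment, contiguous segments end at a skipped position in the residue
class of `x`, not below a given gap `z` of this class. -/
theorem exists_sweep_eq_zero_below (he : 0 < e) {x z : ℤ} (hx : sweep e a x = e) (hz : a.Gap z)
    (hzx : z < x) (hcast : (z : ZMod e) = x) :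
    ∃ y, z ≤ y ∧ y < x ∧ (y : ZMod e) = x ∧ sweep e a y = 0 ∧ sweep e a (y + 1) ≠ 0 := by
  obtain ⟨n, hn⟩ : ∃ n : ℕ, (x - z).toNat = n := ⟨_, rfl⟩
  induction n using Nat.strong_induction_on generalizing x with
  | _ n ih =>
    have h1 := Int.le_sub_of_cast_eq hzx hcast
    have h2 := sweep_sub (e := e) (a := a) (n := e - 1) (by omega : e - 1 < sweep e a x)
    rw [show x - (e - 1 : ℕ) = x - e + 1 by omega, hx] at h2
    have h3 : ((x - e : ℤ) : ZMod e) = x := by simp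
    have h4 := sweep_eq e a (x - e)
    rw [if_neg (by omega)] at h4
    by_cases h5 : a.Bead (x - e)
    · rw [if_pos h5] at h4
      have h6 : z < x - e := by
        rcases h1.eq_or_lt with h | h
        · obtain rfl : z = x - e := by omega
          exact absurd h5 (not_bead.2 hz)
        · omega
      obtain ⟨y, hy1, hy2, hy3, hy4⟩ := ih _ (by omega) h4 h6 (by rw [h3, hcast]) rfl
      exact ⟨y, hy1, by omega, by rw [hy3, h3], hy4⟩
    · rw [if_neg h5] at h4
      exact ⟨x - e, by omega, by omega, h3, h4, by omega⟩

omit [NeZero e] in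
/-- Let `k` be a profile with last bead `q` and let `G` be the conjugate of the trimmed conjugate of
`k`. If `G` is shift balanced, then so is `k`, given this for the pairs not involving `q` and, in
the case that the first gap of the conjugate of `k` is skipped, that the labels of `q` and of all
beads of `G` in the residue class of `q + 1` vanish. The proof transports a gap `p` of `k` in the
residue class of `q` to a gap of `G` with a label shifted in the same way as that of `q`. -/
theorem shiftBalanced_of_trim_conj (he : 0 < e) {k G : Profile} {q : ℤ}
    (hG : ∀ p, G.g p = k.g p + skip e k.conj (-p) - 1) (hGs : ShiftBalanced d e G)
    (hq : k.Bead q) (hq' : ∀ p, q < p → k.g p = p - k.s)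
    (hlow : ∀ p r : ℤ, p < r → r < q → (p : ZMod e) = r → k.Gap p → k.Bead r →
      (k.g r : ZMod d) = k.g p)
    (hz : sweep e k.conj (-q - 1) = 0 → (k.g q : ZMod d) = 0 ∧
      ∀ p : ℤ, (p : ZMod e) = q + 1 → G.Bead p → (G.g p : ZMod d) = 0) :
    ShiftBalanced d e k := by
  intro p r hpr hc hp hr
  have hrq : r ≤ q := by
    by_contra h
    exact not_bead.2 (gap_of_top hq' (by omega)) hr
  rcases hrq.lt_or_eq with h | rfl
  · exact hlow p r hpr h hc hp hr
  -- Only pairs of a gap `p` and the last bead `r` are left. The label of `x` in `G` is smaller by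
  -- one than in `k` if `-x` is swept in the conjugate of `k`, and the same otherwise.
  have hgap : ∀ x, k.Gap x → sweep e k.conj (-x - 1) ≠ 0 := fun x hx =>
    sweep_of_bead he (conj_bead.2 (by rwa [show -(-x - 1) - 1 = x by ring]))
  have hG1 : ∀ x, sweep e k.conj (-x) ≠ 0 → G.g x = k.g x - 1 := fun x hx => by
    rw [hG, skip_of_ne hx]; ring
  have hG0 : ∀ x, sweep e k.conj (-x) = 0 → G.g x = k.g x := fun x hx => by
    rw [hG, skip_of_eq hx]; ring
  have hneg : ∀ x : ℤ, -(x + 1) = -x - 1 := fun x => by ring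
  have hp1 : G.g (p + 1) = k.g p := by
    rw [hG1 _ (by rw [hneg]; exact hgap p hp), hp]; ring
  by_cases hA : sweep e k.conj (-r - 1) = 0
  · obtain ⟨h1, h2⟩ := hz hA
    rw [h1, eq_comm, ← hp1]
    rcases G.bead_or_gap (p + 1) with h3 | h3
    · exact h2 _ (by push_cast; rw [hc]) h3
    · have h4 : G.g (r + 1) = k.g r := by rw [hG0 _ (by rwa [hneg]), hr]
      have h5 : G.Bead (r + 1) := by
        unfold Bead
        rw [h4, hG1 _ (by rw [hneg]; exact hgap _ (gap_of_top hq' (by omega))), hq' _ (by omega),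
          ← hr, hq' _ (by omega)]
        ring
      rw [← hGs (p + 1) (r + 1) (by omega) (by push_cast; rw [hc]) h3 h5, h4, h1]
  · have hA' : sweep e k.conj (-r) ≠ 0 := by
      intro h
      have h1 := (bead_of_ne_of_sweep_succ hA (by rw [sub_add_cancel, h]; omega)).1
      rw [conj_bead, show -(-r - 1) - 1 = r by ring] at h1
      exact not_bead.2 h1 hr
    have h1 : G.g r = k.g r - 1 := hG1 _ hA'
    have h2 : G.Bead r := by
      unfold Bead
      rw [h1, hG1 _ (by rwa [hneg]), hr]
    by_cases hB : sweep e k.conj (-p) = 0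
    · -- `p` is not a gap of `G`, but some bead `x` of `k` between `p` and `r` is one
      have h3 := (bead_of_ne_of_sweep_succ (hgap p hp) (by rw [sub_add_cancel, hB]; omega)).2
      obtain ⟨y, hy1, hy2, hy3, hy4, hy5⟩ := exists_sweep_eq_zero_below he (z := -r - 1) h3
        (conj_gap.2 (by rwa [show -(-r - 1) - 1 = r by ring])) (by omega) (by push_cast; rw [hc])
      have hyr : y ≠ -r - 1 := by rintro rfl; exact hA hy4
      obtain ⟨x, rfl⟩ : ∃ x, y = -x - 1 := ⟨-y - 1, by ring⟩
      have hcx : (p : ZMod e) = x := by push_cast at hy3; linear_combination hy3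
      have hbx : k.Bead x := by
        have := conj_gap.1 (gap_of_sweep_eq_zero he hy4)
        rwa [show -(-x - 1) - 1 = x by ring] at this
      have h4 := hlow p x (by omega) (by omega) hcx hp hbx
      have h5 : G.g x = k.g x - 1 := hG1 _ (by rwa [sub_add_cancel] at hy5)
      have h6 : G.Gap x := by
        unfold Gap
        rw [hG0 _ (by rwa [hneg]), h5, hbx]; ring
      have h7 := hGs x r (by omega) (by rw [← hcx, hc]) h6 h2
      rw [h1, h5] at h7
      push_cast at h7
      rw [← h4]
      linear_combination h7
    · have h3 : G.g p = k.g p - 1 := hG1 _ hB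
      have h4 := hGs p r hpr hc (by unfold Gap; rw [hp1, h3]; ring) h2
      rw [h1, h3] at h4
      push_cast at h4
      linear_combination h4

end Trim

end Profile

namespace Profile

variable {d e : ℕ} {a : Profile} [NeZero e]

/-! ### Existence of the shift balanced partner -/

omit [NeZero e] in
theorem shiftBalanced_of_size_eq_zero (h : a.size = 0) : ShiftBalanced d e a := by
  intro p q hpq _ hp hq
  have h1 := eq_of_size_eq_zero h
  unfold Gap at hp
  unfold Bead at hq
  rw [h1, h1] at hp hq
  omega

theorem size_trim_iterate_of_size_eq_zero (h : a.size = 0) (i : ℕ) :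
    ((trim e)^[i] a).size = 0 := by
  induction i with
  | zero => exact h
  | succ i ih => rw [Function.iterate_succ_apply']; exact size_trim_of_size_eq_zero ih

theorem size_col_iterate_of_size_eq_zero (h : a.size = 0) (i : ℕ) :
    (col^[i] a).size = 0 := by
  induction i with
  | zero => exact h
  | succ i ih =>
    rw [Function.iterate_succ_apply']
    exact le_antisymm ((size_col_le _).trans ih.le) (size_nonneg _)

/-- If the first gap `u` is skipped, then the ladder reaches down to it, where the label is `0`. -/
theorem ladder_firstGap (hb : Balanced d e a) {u : ℤ} (hu : ∀ p ≤ u, a.g p = 0)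
    (hs : sweep e a u = 0) :
    ((a.size - (trim e a).size : ℤ) : ZMod d) = 0 ∧
      ((a.size - (trim e a).size + a.s : ℤ) : ZMod e) = u := by
  obtain ⟨N, h1, h2, h3, h4⟩ := ((size_sub_size_trim_eq (e := e) a).and (a.eventually_bounds.and
    ((eventually_ge_atTop a.bound).and (eventually_gt_atTop |u|)))).exists
  have h5 := le_abs_self u
  have h6 := neg_abs_le u
  have h7 : skips e a N (-N) = skips e a N u := by
    rw [skips, skips]
    refine (Finset.sum_subset (Ico_subset_Ico_left (by omega)) fun x hx hx' => ?_).symm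
    simp only [mem_Ico] at hx hx'
    exact skip_of_ne (sweep_of_bead (NeZero.pos e) (bead_of_first hu (by omega)))
  obtain ⟨l1, l2⟩ := ladder hb (h := N) (fun p hp => sweep_of_bound_le (by omega)) hs (by omega)
  rw [hu u le_rfl, h2.2 N le_rfl] at l1
  rw [h1, h7]
  push_cast at l1 l2 ⊢
  refine ⟨l1.symm, ?_⟩
  rw [l2]; ring

omit [NeZero e] in
/-- In the residue class of the first gap, all beads have label `0` after removal of the first
column. -/
theorem label_col_of_firstGap (hb : Balanced d e a) {u : ℤ} (hu : ∀ p ≤ u, a.g p = 0)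
    (hu' : ∀ p, u < p → 1 ≤ a.g p) {p : ℤ} (hp : (p : ZMod e) = u) (hbp : a.col.Bead p) :
    (a.col.g p : ZMod d) = 0 := by
  rw [col_g]
  rcases le_or_gt p u with h | h
  · rw [hu p h]; norm_num
  · have h1 := hu' p h
    have h2 := hu' (u + 1) (by omega)
    have h3 := hu u le_rfl
    have h4 := a.step u
    have h5 := hb u p h hp.symm (by unfold Gap; omega) ((col_bead_iff hu' h).1 hbp)
    rw [h3] at h5
    rw [max_eq_left (by omega)]
    push_cast at h5 ⊢
    rw [h5]; ring

/-- A balanced profile `a` with a zero in the first row of its runner matrix has a shift balanced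
partner `k`, and the sizes left after removing rows of `k` are the sizes of the successive trimmings
of `a`. The profile `k` is the partner of `trim e a` with a new first row, whose length is the
number of boxes lost by trimming. Shift balance follows from that of the partner `G` of `a.col`,
since `arr_transpose` identifies the conjugate of `G` with the trimmed conjugate of `k`. -/
theorem exists_shiftBalanced (hd : 1 < d) (he : 1 < e) (hcop : Nat.Coprime d e) (a : Profile)
    (hb : Balanced d e a) (hz : HasZero d e a) :
    ∃ k : Profile, ShiftBalanced d e k ∧ Partner d e a k ∧
      ∀ i, (col^[i] k.conj).size = ((trim e)^[i] a).size := by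
  obtain ⟨n, hn⟩ : ∃ n : ℕ, a.size.toNat = n := ⟨_, rfl⟩
  induction n using Nat.strong_induction_on generalizing a with
  | _ n ih =>
    rcases a.size_nonneg.eq_or_lt with h0 | h0
    · refine ⟨a, shiftBalanced_of_size_eq_zero h0.symm, ⟨rfl, .of_forall fun _ _ => rfl⟩,
        fun i => ?_⟩
      rw [size_trim_iterate_of_size_eq_zero h0.symm,
        size_col_iterate_of_size_eq_zero (by rw [conj_size, h0])]
    have hlt := size_trim_lt hd he hb hz h0
    have hlt' := size_col_lt h0
    have hn1 := (trim e a).size_nonneg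
    have hn2 := a.col.size_nonneg
    obtain ⟨k₀, hs₀, ⟨hc₀, hp₀⟩, hi₀⟩ := ih _ (by omega) (trim e a) (hb.trim hd hcop) (hz.trim hb) rfl
    obtain ⟨G, hsG, ⟨hcG, hpG⟩, hiG⟩ := ih _ (by omega) a.col hb.col (hb.hasZero_col hd (by omega)) rfl
    rw [trim_s] at hc₀
    rw [col_s] at hcG
    set j := a.size - (trim e a).size with hj
    -- By `size_convex` the new row is at least as long as the first row of `k₀`.
    have hq : ∀ p, j + a.s - 1 ≤ p → k₀.g p = p - k₀.s := by
      obtain ⟨t, ht, ht'⟩ := k₀.exists_top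
      have h1 := size_sub_size_row ht ht'
      have h2 := hi₀ 0
      have h3 := hi₀ 1
      simp only [Function.iterate_zero, id, Function.iterate_one, conj_size] at h2 h3
      rw [row, conj_size, h2, h3] at h1
      have h4 := size_convex he a
      exact fun p hp => ht' p (by omega)
    set q := j + a.s - 1 with hqdef
    set k := addTop k₀ q hq with hk
    have hks : k.s = a.s := by rw [hk, addTop_s, ← hc₀]; ring
    have hkt : ∀ p, q < p → k.g p = p - k.s := fun p hp => addTop_g_of_lt hp
    have hkcol : k.conj.col = k₀.conj := by
      rw [← row_addTop (hq := hq), row, conj_conj]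
    have hisize : ∀ i, (col^[i] k.conj).size = ((trim e)^[i] a).size := by
      intro i
      cases i with
      | succ i =>
        rw [Function.iterate_succ_apply, Function.iterate_succ_apply, hkcol, hi₀]
      | zero =>
        have h1 := size_sub_size_row (a := k) addTop_bead hkt
        have h2 := hi₀ 0
        simp only [Function.iterate_zero, id, conj_size] at h2 ⊢
        rw [hk, row_addTop, ← hk, h2, hks] at h1
        omega
    have harr := arr_transpose (a := a) (b := k.conj) he hisize
    -- Both sides have the sizes of the trimmings of `a.col` after removing columns.
    have hG : trim e k.conj = G.conj := by
      refine eq_of_size_col_iterate ?_ fun i => ?_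
      · rw [trim_s, conj_s, conj_s, ← hcG, hks]; ring
      · rw [hiG]
        have := harr i 1
        simp only [arr, Function.iterate_one] at this
        rw [this, ← Function.iterate_one col]
        congr 1
        exact (((Function.Commute.iterate_right (f := col) (g := trim e)
          (fun a => col_trim a) i)).iterate_left 1 a)
    have hGg : ∀ p, G.g p = k.g p + skip e k.conj (-p) - 1 := by
      intro p
      have h1 : G = (trim e k.conj).conj := by rw [hG, conj_conj]
      rw [h1, conj_g, trim_g, trim_s, conj_g, conj_s, neg_neg]; ring
    have hjq : q - k₀.s = j := by rw [← hc₀, hqdef]; ring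
    refine ⟨k, shiftBalanced_of_trim_conj (by omega) hGg hsG addTop_bead hkt ?_ ?_, ⟨hks.symm, ?_⟩,
      hisize⟩
    · intro p r hpr hrq hc hp hr
      unfold Gap at hp
      unfold Bead at hr
      rw [hk, addTop_g (by omega), addTop_g (by omega)] at hp hr ⊢
      exact hs₀ p r hpr hc hp hr
    · intro h1
      obtain ⟨u, hu, hu'⟩ := a.exists_firstGap
      have h2 : eps e k.conj = 0 := by
        rw [eps_eq he (u := -q - 1) ?_ ?_, skip_of_eq h1]; · ring
        · intro p hp
          rw [conj_g, hkt _ (by omega)]; ring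
        · intro p hp
          rw [conj_g]
          have h3 := k.anti (show -p ≤ q by omega)
          have h4 := hkt (q + 1) (by omega)
          have h5 : k.Bead q := addTop_bead
          unfold Bead at h5
          omega
      -- The first gaps of `a` and `k.conj` are both skipped, as `eps` only depends on the array.
      have h3 : eps e a = 0 := by
        rw [← h2, eps, eps]
        have h4 := harr 1 1
        have h5 := harr 0 0
        simp only [arr, Function.iterate_one, Function.iterate_zero, id] at h4 h5
        rw [h4, h5]
      rw [eps_eq he hu hu'] at h3
      have h4 : sweep e a u = 0 := by
        by_contra h
        rw [skip_of_ne h] at h3; omega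
      obtain ⟨l1, l2⟩ := ladder_firstGap hb hu h4
      rw [← hj] at l1 l2
      refine ⟨by rw [hk, addTop_g le_rfl, hq q le_rfl, hjq, l1], fun p hp hbp => ?_⟩
      have h5 : (p : ZMod e) = u := by
        rw [hp, ← l2, hqdef]; push_cast; ring
      classical
      by_contra h6
      refine forall_bead_of_beadSum_eq_zero (d := d) (e := e)
        (P := fun x y => x ≠ 0 ∧ y = (u : ZMod e)) ?_ hbp ⟨h6, h5⟩
      filter_upwards [hpG] with N hN
      rw [← hN, beadSum_eq_zero]
      exact fun p hbp ⟨h1, h2⟩ => h1 (label_col_of_firstGap hb hu hu' h2 hbp)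
    · filter_upwards [hp₀, eventually_beadSum_trim hb, eventually_beadSum_addTop (hq := hq),
        size_sub_size_trim_eq (e := e) a, a.eventually_bounds] with N h1 h2 h3 h4 h5 f
      have h6 : j = N - a.s - skips e a N (-N) := h4
      rw [hk, h3, ← h1, h2, hjq, h5.2 N le_rfl]
      have h7 : (j : ZMod d) = ((N - a.s : ℤ) : ZMod d) - skips e a N (-N) := by
        rw [h6]; push_cast; ring
      have h8 : (q : ZMod e) = N - 1 - skips e a N (-N) := by
        rw [hqdef, h6]; push_cast; ring
      rw [h7, h8]; ring

end Profile

namespace Profile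

variable {d e : ℕ} {a b : Profile}

/-! ### Uniqueness of shift balanced partners -/

/-- The analogue of `beadSum` for gaps. -/
noncomputable def gapSum (d e : ℕ) (a : Profile) (N : ℤ) (f : ZMod d → ZMod e → ℤ) : ℤ :=
  ∑ p ∈ Ico (-N) N, if a.Bead p then 0 else f (a.g p) p

/-- Flow along the path: a gap moves the pair (label, position) by `(1, 1)`, a bead by `(0, 1)`.
Hence the beads determine the differences of gap counts along the direction `(1, 1)`. -/
theorem gapSum_sub_gapSum {N : ℤ} (hN : 0 ≤ N) (f : ZMod d → ZMod e → ℤ) :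
    gapSum d e a N (fun x y => f (x + 1) (y + 1)) - gapSum d e a N f =
      f (a.g N) N - f (a.g (-N)) ((-N : ℤ)) -
        (beadSum d e a N (fun x y => f x (y + 1)) - beadSum d e a N f) := by
  rw [← Int.sum_Ico_telescope (fun p => f (a.g p) p) (by omega : -N ≤ N), eq_sub_iff_add_eq]
  simp only [gapSum, beadSum, ← Finset.sum_sub_distrib, ← Finset.sum_add_distrib]
  refine Finset.sum_congr rfl fun p _ => ?_
  by_cases h : a.Bead p
  · simp only [if_pos h]
    unfold Bead at h
    rw [h]; push_cast; ring
  · simp only [if_neg h]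
    rw [show a.g (p + 1) = a.g p + 1 from not_bead.1 h]; push_cast; ring

theorem gapSum_one {N : ℤ} (hN : 0 ≤ N) : gapSum d e a N (fun _ _ => 1) = a.g N - a.g (-N) := by
  rw [← Int.sum_Ico_telescope a.g (by omega : -N ≤ N)]
  refine Finset.sum_congr rfl fun p _ => ?_
  by_cases h : a.Bead p
  · rw [if_pos h]; unfold Bead at h; omega
  · rw [not_bead] at h; rw [if_neg (not_bead.2 h)]; unfold Gap at h; beta_reduce; omega

theorem gapSum_one_eq_sum [NeZero d] [NeZero e] (N : ℤ) : gapSum d e a N (fun _ _ => 1) =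
    ∑ x : ZMod d, ∑ y : ZMod e, gapSum d e a N (fun x' y' => if x' = x ∧ y' = y then 1 else 0) := by
  simp only [gapSum]
  rw [Finset.sum_congr rfl fun x _ => Finset.sum_comm, Finset.sum_comm]
  refine Finset.sum_congr rfl fun p _ => ?_
  split_ifs
  · simp
  · simp [ite_and]

/-- By the Chinese remainder theorem, `(1, 1)` generates `ZMod d × ZMod e`. -/
theorem eq_of_diagonal_const (hcop : Nat.Coprime d e) {f : ZMod d → ZMod e → ℤ} [NeZero d]
    [NeZero e] (h : ∀ x y, f (x + 1) (y + 1) = f x y) (x : ZMod d) (y : ZMod e) :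
    f x y = f 0 0 := by
  obtain ⟨n, h1, h2⟩ := Nat.chineseRemainder hcop x.val y.val
  have key : ∀ n : ℕ, f n n = f 0 0 := by
    intro n
    induction n with
    | zero => simp
    | succ n ih => push_cast; rw [h, ih]
  rw [← key n, (ZMod.natCast_eq_natCast_iff _ _ _).2 h1, (ZMod.natCast_eq_natCast_iff _ _ _).2 h2]
  simp

/-- Partners have the same labelled gaps. The difference of the counts is constant by the flow
equation and the Chinese remainder theorem, and the total numbers of gaps agree. -/
theorem Partner.gapSum_eq [NeZero d] [NeZero e] (hcop : Nat.Coprime d e) (h : Partner d e a b) :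
    ∀ᶠ N : ℤ in atTop, ∀ x y, gapSum d e a N (fun x' y' => if x' = x ∧ y' = y then 1 else 0) =
      gapSum d e b N (fun x' y' => if x' = x ∧ y' = y then 1 else 0) := by
  filter_upwards [h.2, a.eventually_bounds, b.eventually_bounds, eventually_ge_atTop 0]
    with N h1 h2 h3 hN
  set D : ZMod d → ZMod e → ℤ := fun x y =>
    gapSum d e a N (fun x' y' => if x' = x ∧ y' = y then 1 else 0) -
      gapSum d e b N (fun x' y' => if x' = x ∧ y' = y then 1 else 0) with hD
  have hD1 : ∀ x y, D (x + 1) (y + 1) = D x y := by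
    intro x y
    have h4 := gapSum_sub_gapSum (a := a) hN
      (fun x' y' => if x' = x + 1 ∧ y' = y + 1 then (1 : ℤ) else 0)
    have h5 := gapSum_sub_gapSum (a := b) hN
      (fun x' y' => if x' = x + 1 ∧ y' = y + 1 then (1 : ℤ) else 0)
    rw [h1, h1, show a.g N = b.g N by rw [h2.2 _ le_rfl, h3.2 _ le_rfl, h.1],
      show a.g (-N) = b.g (-N) by rw [h2.1 _ le_rfl, h3.1 _ le_rfl], ← h5] at h4
    simp only [add_left_inj] at h4
    simp only [hD]
    omega
  have hD2 := eq_of_diagonal_const hcop hD1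
  have hD3 : ∑ x : ZMod d, ∑ y : ZMod e, D x y = 0 := by
    simp only [hD, Finset.sum_sub_distrib]
    rw [← gapSum_one_eq_sum, ← gapSum_one_eq_sum, gapSum_one hN, gapSum_one hN,
      h2.1 _ le_rfl, h2.2 _ le_rfl, h3.1 _ le_rfl, h3.2 _ le_rfl, h.1]
    ring
  rw [Finset.sum_congr rfl fun x _ => Finset.sum_congr rfl fun y _ => hD2 x y] at hD3
  have hD4 : D 0 0 = 0 := by simpa [NeZero.ne] using hD3
  intro x y
  have := hD2 x y
  rw [hD4] at this
  exact sub_eq_zero.1 this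

/-- A shift balanced profile is determined by its labelled beads. At the highest position where two
partners differ, one has a bead and the other a gap. As the labelled gaps have the same counts, the
former has a gap below that bead, in the same residue class, with a label smaller by one, which
contradicts shift balance. -/
theorem ShiftBalanced.eq_of_partner [NeZero e] (hd : 1 < d) (hcop : Nat.Coprime d e)
    (ha : ShiftBalanced d e a) (hb : ShiftBalanced d e b) (h : Partner d e a b) : a = b := by
  have : NeZero d := ⟨by omega⟩
  have hgap := h.gapSum_eq hcop
  by_contra hab
  obtain ⟨p₀, hp₀⟩ : ∃ p, a.g p ≠ b.g p := by
    by_contra! h1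
    exact hab (ext' h1)
  obtain ⟨N₀, h1, h2⟩ := (a.eventually_bounds.and b.eventually_bounds).exists
  obtain ⟨p, hp, hm⟩ := Int.exists_greatest_of_bdd (P := fun p => a.g p ≠ b.g p)
    ⟨N₀, fun z hz => by
      by_contra h3
      exact hz (by rw [h1.2 z (by omega), h2.2 z (by omega), h.1])⟩ ⟨p₀, hp₀⟩
  have hgt : ∀ x, p < x → a.g x = b.g x := by
    intro x hx
    by_contra h3
    have := hm x h3
    omega
  -- the profile with a bead at `p` violates shift balance
  have key : ∀ a b : Profile, ShiftBalanced d e a → (∀ x, p < x → a.g x = b.g x) →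
      (∀ᶠ N : ℤ in atTop, ∀ x y, gapSum d e a N (fun x' y' => if x' = x ∧ y' = y then 1 else 0) =
      gapSum d e b N (fun x' y' => if x' = x ∧ y' = y then 1 else 0)) →
      a.Bead p → b.Gap p → False := by
    intro a b ha hgt hgap hap hbp
    obtain ⟨N, hN, hN'⟩ := (hgap.and (eventually_gt_atTop |p|)).exists
    have h3 := le_abs_self p
    have h4 := neg_abs_le p
    refine absurd (hN (b.g p) p) (ne_of_lt (Finset.sum_lt_sum (fun q _ => ?_)
      ⟨p, mem_Ico.2 ⟨by omega, by omega⟩, ?_⟩))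
    · beta_reduce
      rcases lt_trichotomy q p with hq | rfl | hq
      · have : (if a.Bead q then (0 : ℤ) else
            if (a.g q : ZMod d) = b.g p ∧ (q : ZMod e) = p then 1 else 0) = 0 := by
          split_ifs with h5 h6
          · rfl
          · exfalso
            have h7 := ha q p hq h6.2 (not_bead.1 h5) hap
            have h8 := hgt (p + 1) (by omega)
            unfold Bead at hap
            unfold Gap at hbp
            rw [show a.g p = b.g p + 1 by omega, h6.1] at h7
            push_cast at h7
            exact one_ne_zero_of hd (by linear_combination h7)
          · rfl
        rw [this]
        split_ifs <;> norm_num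
      · rw [if_pos hap]
        split_ifs <;> norm_num
      · rw [hgt q hq]
        have : a.Bead q ↔ b.Bead q := by
          unfold Bead
          rw [hgt q hq, hgt (q + 1) (by omega)]
        simp only [this, le_refl]
    · beta_reduce
      rw [if_pos hap, if_neg (not_bead.2 hbp), if_pos ⟨rfl, rfl⟩]
      norm_num
  have h3 := hgt (p + 1) (by omega)
  rcases a.bead_or_gap p with h4 | h4 <;> rcases b.bead_or_gap p with h5 | h5
  · unfold Bead at h4 h5
    omega
  · exact key a b ha hgt hgap h4 h5
  · exact key b a hb (fun x hx => (hgt x hx).symm)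
      (hgap.mono fun N hN x y => (hN x y).symm) h5 h4
  · unfold Gap at h4 h5
    omega

end Profile

namespace YoungDiagram

variable {μ ν : YoungDiagram} {i j : ℕ} {p q : ℤ}

/-! ### The boundary path of a Young diagram -/

theorem exists_diag_notMem (μ : YoungDiagram) (p : ℤ) :
    ∃ k : ℕ, ((-p).toNat + k, p.toNat + k) ∉ μ := by
  refine ⟨μ.rowLen 0, fun h => ?_⟩
  have h1 := mem_iff_lt_rowLen.1 h
  have := μ.rowLen_anti 0 _ (Nat.zero_le ((-p).toNat + μ.rowLen 0))
  omega

open Classical in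
/-- The column at which the boundary of the diagram crosses the diagonal `j - i = p`. -/
noncomputable def pathHeight (μ : YoungDiagram) (p : ℤ) : ℤ :=
  p.toNat + Nat.find (μ.exists_diag_notMem p)

theorem mem_iff_lt_pathHeight : (i, j) ∈ μ ↔ (j : ℤ) < μ.pathHeight (j - i) := by
  classical
  have h1 : i = (-((j : ℤ) - i)).toNat + min i j := by omega
  have h2 : j = ((j : ℤ) - i).toNat + min i j := by omega
  have h3 : (j : ℤ) < μ.pathHeight (j - i) ↔ min i j < Nat.find (μ.exists_diag_notMem (j - i)) := by
    unfold pathHeight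
    omega
  rw [h3, Nat.lt_find_iff]
  constructor
  · intro h m hm
    rw [not_not]
    exact μ.up_left_mem (by omega) (by omega) h
  · intro h
    have := h _ le_rfl
    rwa [not_not, ← h1, ← h2] at this

theorem pathHeight_nonneg : 0 ≤ μ.pathHeight p := by unfold pathHeight; omega

theorem le_pathHeight : p ≤ μ.pathHeight p := by unfold pathHeight; omega

/-- The boundary path of a Young diagram, of charge `0`. -/
noncomputable def profile (μ : YoungDiagram) : Profile where
  g := μ.pathHeight
  s := 0
  step p := by
    have h1 := μ.pathHeight_nonneg (p := p)
    have h2 := μ.le_pathHeight (p := p)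
    have h3 := μ.pathHeight_nonneg (p := p + 1)
    have h4 := μ.le_pathHeight (p := p + 1)
    have h5 : ¬ μ.pathHeight (p + 1) < μ.pathHeight p := by
      intro h
      obtain ⟨j, hj⟩ := Int.eq_ofNat_of_zero_le h3
      obtain ⟨i, hi⟩ := Int.eq_ofNat_of_zero_le (show 0 ≤ (j : ℤ) - p - 1 by omega)
      have h6 : (i + 1, j) ∈ μ := by
        rw [mem_iff_lt_pathHeight, show (j : ℤ) - (i + 1 : ℕ) = p by push_cast; omega]; omega
      have h7 := μ.up_left_mem (Nat.le_succ i) le_rfl h6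
      rw [mem_iff_lt_pathHeight, show (j : ℤ) - i = p + 1 by omega] at h7
      omega
    have h6 : ¬ μ.pathHeight p + 1 < μ.pathHeight (p + 1) := by
      intro h
      obtain ⟨j, hj⟩ := Int.eq_ofNat_of_zero_le h1
      obtain ⟨i, hi⟩ := Int.eq_ofNat_of_zero_le (show 0 ≤ (j : ℤ) - p by omega)
      have h6 : (i, j + 1) ∈ μ := by
        rw [mem_iff_lt_pathHeight, show ((j + 1 : ℕ) : ℤ) - i = p + 1 by push_cast; omega]
        push_cast; omega
      have h7 := μ.up_left_mem le_rfl (Nat.le_succ j) h6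
      rw [mem_iff_lt_pathHeight, show (j : ℤ) - i = p by omega] at h7
      omega
    omega
  low := by
    refine ⟨-(μ.colLen 0), fun p hp => ?_⟩
    obtain ⟨i, hi⟩ := Int.eq_ofNat_of_zero_le (show 0 ≤ -p by omega)
    have h1 : (i, 0) ∉ μ := by rw [mem_iff_lt_colLen]; omega
    rw [mem_iff_lt_pathHeight, show ((0 : ℕ) : ℤ) - i = p by omega] at h1
    have := μ.pathHeight_nonneg (p := p)
    omega
  high := by
    refine ⟨μ.rowLen 0, fun p hp => ?_⟩
    obtain ⟨j, hj⟩ := Int.eq_ofNat_of_zero_le (show 0 ≤ p by omega)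
    have h1 : (0, j) ∉ μ := by rw [mem_iff_lt_rowLen]; omega
    rw [mem_iff_lt_pathHeight, show (j : ℤ) - (0 : ℕ) = p by omega] at h1
    have := μ.le_pathHeight (p := p)
    omega

theorem profile_s (μ : YoungDiagram) : μ.profile.s = 0 := rfl

theorem mem_iff_profile : (i, j) ∈ μ ↔ (j : ℤ) < μ.profile.g (j - i) := mem_iff_lt_pathHeight

theorem le_profile (μ : YoungDiagram) (p : ℤ) : p ≤ μ.profile.g p := μ.le_pathHeight

/-- The boundary path is characterized by the membership predicate of the diagram. -/
theorem profile_g_eq_of_mem_iff {h : ℤ → ℤ} (h0 : ∀ p, 0 ≤ h p) (h1 : ∀ p, p ≤ h p)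
    (hm : ∀ i j : ℕ, (i, j) ∈ μ ↔ (j : ℤ) < h (j - i)) (p : ℤ) : μ.profile.g p = h p := by
  have key : ∀ a b : ℤ → ℤ, (∀ p, 0 ≤ b p) → (∀ p, p ≤ b p) →
      (∀ i j : ℕ, (j : ℤ) < a (j - i) → (j : ℤ) < b (j - i)) → a p ≤ b p := by
    intro a b h0 h1 h
    by_contra h2
    have h3 := h1 p
    obtain ⟨j, hj⟩ := Int.eq_ofNat_of_zero_le (h0 p)
    obtain ⟨i, hi⟩ := Int.eq_ofNat_of_zero_le (show 0 ≤ (j : ℤ) - p by omega)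
    have h4 := h i j
    rw [show (j : ℤ) - i = p by omega] at h4
    omega
  refine le_antisymm (key _ _ h0 h1 fun i j => ?_)
    (key _ _ μ.profile.nonneg μ.le_profile fun i j => ?_)
  · rw [← mem_iff_profile, hm]; exact id
  · rw [← mem_iff_profile, hm]; exact id

theorem profile_eq_of_mem_iff {a : Profile} (hs : a.s = 0)
    (h : ∀ i j : ℕ, (i, j) ∈ μ ↔ (j : ℤ) < a.g (j - i)) : μ.profile = a :=
  Profile.ext' <| profile_g_eq_of_mem_iff a.nonneg
    (fun p => by have := a.sub_le p; omega) h

theorem profile_injective : Function.Injective profile := by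
  intro μ ν h
  ext ⟨i, j⟩
  rw [mem_cells, mem_cells, mem_iff_profile, mem_iff_profile, h]

theorem profile_transpose (μ : YoungDiagram) : μ.transpose.profile = μ.profile.conj := by
  refine profile_eq_of_mem_iff (by rw [Profile.conj_s, profile_s]; rfl) fun i j => ?_
  rw [mem_transpose, Prod.swap_prod_mk, mem_iff_profile, Profile.conj_g, profile_s, neg_sub]
  omega

/-- Every path of charge zero bounds a Young diagram. -/
theorem exists_profile_eq {a : Profile} (hs : a.s = 0) : ∃ μ : YoungDiagram, μ.profile = a := by
  obtain ⟨N, h1, h2⟩ := a.eventually_bounds.exists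
  have hlow : ∀ {i j i' j' : ℕ}, i' ≤ i → j' ≤ j → (j : ℤ) < a.g (j - i) →
      (j' : ℤ) < a.g (j' - i') := by
    intro i j i' j' hi hj h
    have h3 := a.anti (show (j' : ℤ) - i ≤ j - i by omega)
    have h4 := a.mono (show (j' : ℤ) - i ≤ j' - i' by omega)
    omega
  have hbd : ∀ {i j : ℕ}, (j : ℤ) < a.g (j - i) → i < N.toNat ∧ j < N.toNat := by
    intro i j h
    have h3 := hlow le_rfl (Nat.zero_le j) h
    have h4 := hlow (Nat.zero_le i) le_rfl h
    constructor
    · by_contra h5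
      rw [h1 _ (by omega)] at h3; omega
    · by_contra h5
      rw [h2 _ (by omega)] at h4; omega
  refine ⟨⟨((range N.toNat) ×ˢ (range N.toNat)).filter fun b => (b.2 : ℤ) < a.g (b.2 - b.1), ?_⟩,
    profile_eq_of_mem_iff hs fun i j => ?_⟩
  · rintro ⟨i, j⟩ ⟨i', j'⟩ ⟨hi, hj⟩ h
    simp only [coe_filter, mem_product, mem_range, Set.mem_ofPred_eq] at h ⊢
    have h3 := hlow hi hj h.2
    exact ⟨hbd h3, h3⟩
  · rw [← mem_cells]
    simp only [mem_filter, mem_product, mem_range, and_iff_right_iff_imp]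
    exact hbd

/-! ### Rows and columns -/

theorem bead_row (μ : YoungDiagram) (i : ℕ) :
    μ.profile.Bead (μ.rowLen i - i - 1) ∧ μ.profile.g (μ.rowLen i - i - 1) = μ.rowLen i := by
  have h1 : (i, μ.rowLen i) ∉ μ := by rw [mem_iff_lt_rowLen]; omega
  rw [mem_iff_profile] at h1
  have h2 : (μ.rowLen i : ℤ) ≤ μ.profile.g (μ.rowLen i - i - 1) := by
    rcases Nat.eq_zero_or_pos (μ.rowLen i) with h | h
    · rw [h]; exact μ.profile.nonneg _
    · have h3 : (i, μ.rowLen i - 1) ∈ μ := by rw [mem_iff_lt_rowLen]; omega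
      rw [mem_iff_profile, show ((μ.rowLen i - 1 : ℕ) : ℤ) - i = μ.rowLen i - i - 1 by omega] at h3
      omega
  have h3 := μ.profile.step (μ.rowLen i - i - 1)
  unfold Profile.Bead
  rw [sub_add_cancel] at h3 ⊢
  omega

theorem exists_row_of_bead (h : μ.profile.Bead p) :
    ∃ i : ℕ, p = μ.rowLen i - i - 1 ∧ μ.profile.g p = μ.rowLen i := by
  unfold Profile.Bead at h
  have h1 := μ.le_profile (p + 1)
  obtain ⟨i, hi⟩ := Int.eq_ofNat_of_zero_le (show 0 ≤ μ.profile.g p - p - 1 by omega)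
  obtain ⟨h2, h3⟩ := μ.bead_row i
  unfold Profile.Bead at h2
  have h4 : p = μ.rowLen i - i - 1 := by
    rcases lt_trichotomy p (μ.rowLen i - i - 1) with h5 | h5 | h5
    · have := μ.profile.anti (show p + 1 ≤ μ.rowLen i - i - 1 by omega)
      omega
    · exact h5
    · have := μ.profile.anti (show μ.rowLen i - i - 1 + 1 ≤ p by omega)
      omega
  exact ⟨i, h4, by omega⟩

theorem gap_col (μ : YoungDiagram) (j : ℕ) :
    μ.profile.Gap (j - μ.colLen j) ∧ μ.profile.g (j - μ.colLen j) = j := by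
  have h1 : (μ.colLen j, j) ∉ μ := by rw [mem_iff_lt_colLen]; omega
  rw [mem_iff_profile] at h1
  have h2 : (j : ℤ) < μ.profile.g (j - μ.colLen j + 1) := by
    rcases Nat.eq_zero_or_pos (μ.colLen j) with h | h
    · rw [h]; have := μ.le_profile (j - (0 : ℕ) + 1); omega
    · have h3 : (μ.colLen j - 1, j) ∈ μ := by rw [mem_iff_lt_colLen]; omega
      rwa [mem_iff_profile, show (j : ℤ) - (μ.colLen j - 1 : ℕ) = j - μ.colLen j + 1 by omega] at h3
  have h3 := μ.profile.step (j - μ.colLen j)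
  unfold Profile.Gap
  omega

theorem exists_col_of_gap (h : μ.profile.Gap p) :
    ∃ j : ℕ, p = j - μ.colLen j ∧ μ.profile.g p = j := by
  unfold Profile.Gap at h
  obtain ⟨j, hj⟩ := Int.eq_ofNat_of_zero_le (μ.profile.nonneg p)
  obtain ⟨h2, h3⟩ := μ.gap_col j
  unfold Profile.Gap at h2
  have h4 : p = j - μ.colLen j := by
    rcases lt_trichotomy p (j - μ.colLen j) with h5 | h5 | h5
    · have := μ.profile.mono (show p + 1 ≤ j - μ.colLen j by omega)
      omega
    · exact h5
    · have := μ.profile.mono (show j - μ.colLen j + 1 ≤ p by omega)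
      omega
  exact ⟨j, h4, hj⟩

/-! ### Rim hooks -/

/-- On each diagonal, the rim contains the last box of the diagram. -/
theorem mem_rim : (i, j) ∈ μ.rim ↔ (i, j) ∈ μ ∧ (j : ℤ) + 1 = μ.profile.g (j - i) := by
  rw [rim, mem_filter, mem_cells, mem_iff_profile, mem_iff_profile]
  push_cast
  rw [show (j : ℤ) + 1 - (i + 1) = j - i by ring]
  constructor <;> rintro ⟨h1, h2⟩ <;> refine ⟨h1, by omega⟩

/-- The rim hook of a box lies on the diagonals above the gap of its column, up to the bead of its
row. -/
theorem mem_rimHook {i' j' : ℕ} : (i', j') ∈ μ.rimHook (i, j) ↔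
    (j' : ℤ) + 1 = μ.profile.g (j' - i') ∧ (j : ℤ) - μ.colLen j < j' - i' ∧
      (j' : ℤ) - i' ≤ μ.rowLen i - i - 1 := by
  rw [rimHook, mem_filter, mem_rim, mem_iff_profile]
  obtain ⟨h1, h2⟩ := μ.bead_row i
  obtain ⟨h3, h4⟩ := μ.gap_col j
  unfold Profile.Bead at h1
  unfold Profile.Gap at h3
  constructor
  · rintro ⟨⟨-, h5⟩, h6, h7⟩
    change i ≤ i' at h6
    change j ≤ j' at h7
    refine ⟨h5, ?_, ?_⟩
    · by_contra h8
      have := μ.profile.mono (not_lt.1 h8); omega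
    · by_contra h8
      have := μ.profile.anti (show (μ.rowLen i : ℤ) - i - 1 + 1 ≤ j' - i' by omega)
      omega
  · rintro ⟨h5, h6, h7⟩
    have h8 := μ.profile.mono (show (j : ℤ) - μ.colLen j + 1 ≤ j' - i' by omega)
    have h9 := μ.profile.anti h7
    refine ⟨⟨by omega, h5⟩, ?_, ?_⟩
    · change i ≤ i'; omega
    · change j ≤ j'; omega

theorem card_rimHook (h : (i, j) ∈ μ) : ((μ.rimHook (i, j)).card : ℤ) =
    (μ.rowLen i - i - 1) - (j - μ.colLen j) := by
  obtain ⟨h1, h2⟩ := μ.bead_row i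
  obtain ⟨h3, h4⟩ := μ.gap_col j
  unfold Profile.Bead at h1
  unfold Profile.Gap at h3
  have hi := mem_iff_lt_colLen.1 h
  have hj := mem_iff_lt_rowLen.1 h
  have hc : (μ.rimHook (i, j)).card =
      (Ioc ((j : ℤ) - μ.colLen j) (μ.rowLen i - i - 1)).card := by
    refine Finset.card_bij' (fun b _ => (b.2 : ℤ) - b.1)
      (fun p _ => ((μ.profile.g p - 1 - p).toNat, (μ.profile.g p - 1).toNat)) ?_ ?_ ?_ ?_
    · rintro ⟨i', j'⟩ hb
      rw [mem_rimHook] at hb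
      exact mem_Ioc.2 hb.2
    · intro p hp
      rw [mem_Ioc] at hp
      have h8 := μ.profile.mono (show (j : ℤ) - μ.colLen j + 1 ≤ p by omega)
      have h9 := μ.profile.anti hp.2
      have h10 : (((μ.profile.g p - 1).toNat : ℕ) : ℤ) - ((μ.profile.g p - 1 - p).toNat : ℕ) = p := by
        omega
      rw [mem_rimHook, h10]
      exact ⟨by omega, hp⟩
    · rintro ⟨i', j'⟩ hb
      rw [mem_rimHook] at hb
      ext <;> simp only <;> omega
    · intro p hp
      rw [mem_Ioc] at hp
      have h8 := μ.profile.mono (show (j : ℤ) - μ.colLen j + 1 ≤ p by omega)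
      have h9 := μ.profile.anti hp.2
      simp only
      omega
  rw [hc, Int.card_Ioc]
  omega

/-- Rim hooks correspond to pairs of a gap below a bead. -/
theorem forall_hook_iff {P : ℤ → ℤ → Prop} :
    (∀ c ∈ μ, P (μ.rimHook c).card (μ.armLength c)) ↔ ∀ p q, p < q → μ.profile.Gap p →
      μ.profile.Bead q → P (q - p) (μ.profile.g q - μ.profile.g p - 1) := by
  constructor
  · intro h p q hpq hp hq
    obtain ⟨j, h1, h2⟩ := exists_col_of_gap hp
    obtain ⟨i, h3, h4⟩ := exists_row_of_bead hq
    unfold Profile.Gap at hp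
    have h5 := μ.profile.mono (show p + 1 ≤ q by omega)
    have hm : (i, j) ∈ μ := by rw [mem_iff_lt_rowLen]; omega
    have h6 := h _ hm
    rw [card_rimHook hm, ← h1, ← h3] at h6
    rw [h2, h4]
    convert h6 using 1
    unfold armLength
    simp only
    omega
  · rintro h ⟨i, j⟩ hm
    obtain ⟨h1, h2⟩ := μ.bead_row i
    obtain ⟨h3, h4⟩ := μ.gap_col j
    have hi := mem_iff_lt_colLen.1 hm
    have hj := mem_iff_lt_rowLen.1 hm
    have h5 := h _ _ (by omega) h3 h1
    rw [h2, h4] at h5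
    rw [card_rimHook hm]
    convert h5 using 1
    unfold armLength
    simp only
    omega

theorem isBalanced_iff {d e : ℕ} : IsBalanced d e μ ↔ Profile.Balanced d e μ.profile := by
  unfold IsBalanced Profile.Balanced
  have := forall_hook_iff (μ := μ) (P := fun x y => (e : ℤ) ∣ x → y ≡ 0 [ZMOD d])
  simp only [Int.natCast_dvd_natCast] at this
  rw [this]
  refine forall_congr' fun p => forall_congr' fun q => forall_congr' fun _ => ?_
  rw [← ZMod.intCast_eq_intCast_iff, ZMod.intCast_eq_intCast_iff_dvd_sub p q e]
  push_cast
  constructor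
  · intro h hc hp hq
    linear_combination h hp hq hc
  · intro h hp hq hc
    linear_combination h hc hp hq

theorem isShiftBalanced_iff {d e : ℕ} :
    IsShiftBalanced d e μ ↔ Profile.ShiftBalanced d e μ.profile := by
  unfold IsShiftBalanced Profile.ShiftBalanced
  have := forall_hook_iff (μ := μ) (P := fun x y => (e : ℤ) ∣ x → y ≡ -1 [ZMOD d])
  simp only [Int.natCast_dvd_natCast] at this
  rw [this]
  refine forall_congr' fun p => forall_congr' fun q => forall_congr' fun _ => ?_
  rw [← ZMod.intCast_eq_intCast_iff, ZMod.intCast_eq_intCast_iff_dvd_sub p q e]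
  push_cast
  constructor
  · intro h hc hp hq
    linear_combination h hp hq hc
  · intro h hp hq hc
    linear_combination h hc hp hq

end YoungDiagram

namespace Profile

/-! ### Cores and runner matrices -/

/-- The number of beads in `[-N, N)` in a residue class modulo `e`; the summand `1 - (g (p + 1) - g
p)` is the indicator of a bead. -/
noncomputable def beadCount (e : ℕ) (a : Profile) (N : ℤ) (y : ZMod e) : ℤ :=
  ∑ p ∈ Ico (-N) N, if (p : ZMod e) = y then 1 - (a.g (p + 1) - a.g p) else 0

theorem beadSum_residue (d : ℕ) {e : ℕ} (a : Profile) (N : ℤ) (y : ZMod e) :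
    beadSum d e a N (fun _ y' => if y' = y then 1 else 0) = beadCount e a N y := by
  refine Finset.sum_congr rfl fun p _ => ?_
  rcases a.bead_or_gap p with h | h
  · rw [if_pos h]; unfold Bead at h; rw [h, sub_self, sub_zero]
  · rw [if_neg (not_bead.2 h)]; unfold Gap at h; rw [h]; simp

theorem eq_of_bead_iff {a b : Profile} (h : ∀ p, a.Bead p ↔ b.Bead p) : a = b := by
  obtain ⟨N, h1, h2⟩ := (a.eventually_bounds.and b.eventually_bounds).exists
  refine ext' fun p => ?_
  rcases le_total p (-N) with hp | hp
  · rw [h1.1 p hp, h2.1 p hp]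
  · induction p, hp using Int.leInduction with
    | base => rw [h1.1 _ le_rfl, h2.1 _ le_rfl]
    | succ p hp ih =>
      have h3 := h p
      have h4 := a.step p
      have h5 := b.step p
      unfold Bead at h3
      omega

/-- If in each residue class modulo `e` all beads lie below all gaps, then the numbers of beads in
the classes determine the profile. -/
theorem eq_of_beadCount_eq {e : ℕ} (he : 0 < e) {a b : Profile} (ha : ∀ p, a.Gap p → a.Gap (p + e))
    (hb : ∀ p, b.Gap p → b.Gap (p + e))
    (h : ∀ᶠ N : ℤ in atTop, ∀ y : ZMod e, beadCount e a N y = beadCount e b N y) : a = b := by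
  have hup : ∀ {a : Profile}, (∀ p, a.Gap p → a.Gap (p + e)) → ∀ p q : ℤ, p < q →
      (p : ZMod e) = q → a.Gap p → a.Gap q := by
    intro a ha p q hpq hc hp
    obtain ⟨n, hn⟩ := (ZMod.intCast_eq_intCast_iff_dvd_sub p q e).1 hc
    have hn0 : 0 < n := pos_of_mul_pos_right (by omega : 0 < (e : ℤ) * n) (by omega)
    obtain ⟨n, rfl⟩ := Int.eq_ofNat_of_zero_le hn0.le
    have key : ∀ n : ℕ, a.Gap (p + e * n) := by
      intro n
      induction n with
      | zero => simpa using hp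
      | succ n ih =>
        have := ha _ ih
        rwa [show p + (e : ℤ) * n + e = p + e * (n + 1 : ℕ) by push_cast; ring] at this
    have := key n
    rwa [← hn, add_sub_cancel] at this
  have key : ∀ a b : Profile, (∀ p, a.Gap p → a.Gap (p + e)) → (∀ p, b.Gap p → b.Gap (p + e)) →
      (∀ᶠ N : ℤ in atTop, ∀ y : ZMod e, beadCount e a N y = beadCount e b N y) →
      ∀ p, a.Bead p → b.Bead p := by
    intro a b ha hb h p hap
    by_contra hbp
    rw [not_bead] at hbp
    obtain ⟨N, h1, h2⟩ := (h.and (eventually_gt_atTop |p|)).exists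
    have h3 := le_abs_self p
    have h4 := neg_abs_le p
    refine absurd (h1 p) (ne_of_gt (Finset.sum_lt_sum (fun q _ => ?_)
      ⟨p, mem_Ico.2 ⟨by omega, by omega⟩, ?_⟩))
    · by_cases hc : (q : ZMod e) = p
      · rw [if_pos hc, if_pos hc]
        rcases lt_trichotomy q p with hq | rfl | hq
        · have : a.Bead q := by
            rw [← not_gap]
            exact fun h => not_bead.2 (hup ha q p hq hc h) hap
          unfold Bead at this
          have := b.step q
          omega
        · have := a.step q
          have := b.step q
          unfold Bead at hap
          unfold Gap at hbp
          omega
        · have := hup hb p q hq hc.symm hbp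
          unfold Gap at this
          have := a.step q
          omega
      · rw [if_neg hc, if_neg hc]
    · rw [if_pos rfl, if_pos rfl]
      unfold Bead at hap
      unfold Gap at hbp
      omega
  exact eq_of_bead_iff fun p => ⟨key a b ha hb h p, key b a hb ha
    (h.mono fun N hN y => (hN y).symm) p⟩

end Profile

namespace YoungDiagram

variable {μ ν : YoungDiagram} {i j e : ℕ} {p q : ℤ}

/-- Removing a rim hook exchanges the bead of its row with the gap of its column. -/
theorem profile_removeRimHook (i j : ℕ) (p : ℤ) :
    (μ.removeRimHook (i, j)).profile.g p = μ.profile.g p -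
      if (j : ℤ) - μ.colLen j < p ∧ p ≤ μ.rowLen i - i - 1 then 1 else 0 := by
  obtain ⟨h1, h2⟩ := μ.bead_row i
  obtain ⟨h3, h4⟩ := μ.gap_col j
  unfold Profile.Gap at h3
  refine profile_g_eq_of_mem_iff (h := fun p => μ.profile.g p -
      if (j : ℤ) - μ.colLen j < p ∧ p ≤ μ.rowLen i - i - 1 then 1 else 0)
    (fun p => ?_) (fun p => ?_) (fun i' j' => ?_) p
  · have := μ.profile.nonneg p
    split_ifs with h5
    · have := μ.profile.mono (show (j : ℤ) - μ.colLen j + 1 ≤ p by omega)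
      omega
    · omega
  · have := μ.le_profile p
    split_ifs with h5
    · have := μ.profile.anti h5.2
      omega
    · omega
  · have h5 : (i', j') ∈ μ.removeRimHook (i, j) ↔ (i', j') ∈ μ ∧ (i', j') ∉ μ.rimHook (i, j) :=
      Finset.mem_sdiff
    rw [h5, mem_rimHook, mem_iff_profile]
    split_ifs with h6 <;> omega

theorem RemovesHook.beadCount_eq (h : RemovesHook e μ ν) : ∀ᶠ N : ℤ in atTop, ∀ y : ZMod e,
    Profile.beadCount e μ.profile N y = Profile.beadCount e ν.profile N y := by
  obtain ⟨⟨i, j⟩, hm, hc, rfl⟩ := h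
  have h1 := card_rimHook hm
  rw [hc] at h1
  have h2 := profile_removeRimHook (μ := μ) i j
  set u : ℤ := j - μ.colLen j with hu
  have hb : (μ.rowLen i : ℤ) - i - 1 = u + e := by omega
  rw [hb] at h2
  filter_upwards [eventually_gt_atTop (|u| + e)] with N hN y
  have h3 := le_abs_self u
  have h4 := neg_abs_le u
  rw [← sub_eq_zero, Profile.beadCount, Profile.beadCount, ← Finset.sum_sub_distrib]
  have key : ∑ p ∈ Ico (-N) N, ((if p = u + e then (if (u : ZMod e) = y then (1 : ℤ) else 0) else 0) -
      (if p = u then (if (u : ZMod e) = y then (1 : ℤ) else 0) else 0)) = 0 := by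
    rw [Finset.sum_sub_distrib, Finset.sum_ite_eq', Finset.sum_ite_eq',
      if_pos (mem_Ico.2 ⟨by omega, by omega⟩ : u + (e : ℤ) ∈ Ico (-N) N),
      if_pos (mem_Ico.2 ⟨by omega, by omega⟩ : u ∈ Ico (-N) N), sub_self]
  rw [← key]
  refine Finset.sum_congr rfl fun p _ => ?_
  rw [h2, h2]
  by_cases h5 : p = u + e
  · subst h5
    have : (((u + e : ℤ)) : ZMod e) = u := by simp
    rw [this]
    split_ifs <;> omega
  · by_cases h6 : p = u
    · subst h6
      split_ifs <;> omega
    · split_ifs <;> omega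

theorem IsCoreOf.beadCount_eq (h : IsCoreOf e ν μ) : ∀ᶠ N : ℤ in atTop, ∀ y : ZMod e,
    Profile.beadCount e μ.profile N y = Profile.beadCount e ν.profile N y := by
  obtain ⟨h, -⟩ := h
  induction h with
  | refl => exact .of_forall fun _ _ => rfl
  | tail _ h ih =>
    filter_upwards [ih, h.beadCount_eq] with N h1 h2 y
    rw [h1, h2]

/-- Removing rim hooks of size `e` terminates, as it lowers the number of boxes. -/
theorem exists_isCoreOf (he : 0 < e) (μ : YoungDiagram) : ∃ γ, IsCoreOf e γ μ := by
  obtain ⟨n, hn⟩ : ∃ n, μ.cells.card = n := ⟨_, rfl⟩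
  induction n using Nat.strong_induction_on generalizing μ with
  | _ n ih =>
    by_cases h : IsCore e μ
    · exact ⟨μ, .refl, h⟩
    · unfold IsCore at h
      push Not at h
      obtain ⟨c, hc, hce⟩ := h
      obtain ⟨γ, h1, h2⟩ := ih (μ.removeRimHook c).cells.card (by
        rw [← hn]
        refine Finset.card_lt_card (Finset.sdiff_ssubset ?_ ?_)
        · exact (Finset.filter_subset _ _).trans (Finset.filter_subset _ _)
        · exact Finset.card_pos.1 (by omega)) (μ.removeRimHook c) rfl
      exact ⟨γ, .head ⟨c, hc, hce, rfl⟩ h1, h2⟩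

theorem IsCore.gap_add (h : IsCore e μ) (he : 0 < e) (hp : μ.profile.Gap p) :
    μ.profile.Gap (p + e) := by
  unfold IsCore at h
  have := forall_hook_iff (μ := μ) (P := fun x _ => x ≠ e)
  simp only [ne_eq, Nat.cast_inj] at this
  rw [← Profile.not_bead]
  exact fun hb => this.1 h p (p + e) (by omega) hp hb (by ring)

/-- The `e`-core records the numbers of beads in the residue classes modulo `e`. -/
theorem sameCore_iff (he : 0 < e) : SameCore e μ ν ↔ ∀ᶠ N : ℤ in atTop, ∀ y : ZMod e,
    Profile.beadCount e μ.profile N y = Profile.beadCount e ν.profile N y := by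
  constructor
  · rintro ⟨γ, h1, h2⟩
    filter_upwards [h1.beadCount_eq, h2.beadCount_eq] with N h1 h2 y
    rw [h1, h2]
  · intro h
    obtain ⟨γ, h1⟩ := exists_isCoreOf he μ
    obtain ⟨δ, h2⟩ := exists_isCoreOf he ν
    have h3 : γ = δ := by
      refine profile_injective (Profile.eq_of_beadCount_eq he (fun p => h1.2.gap_add he)
        (fun p => h2.2.gap_add he) ?_)
      filter_upwards [h, h1.beadCount_eq, h2.beadCount_eq] with N h h1 h2 y
      rw [← h1, h, h2]
    exact ⟨γ, h1, h3 ▸ h2⟩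

/-- The entries of the runner matrix count labelled beads. Only nonzero labels occur, so the
infinitely many rows of length `0` do not matter. -/
theorem runnerMatrix_eq (d e : ℕ) (μ : YoungDiagram) : ∀ᶠ N : ℤ in atTop, ∀ x y,
    (runnerMatrix d e μ x y : ℤ) = Profile.beadSum d e μ.profile N
      (fun x' y' => if x' = ((x : ℕ) + 1 : ℕ) ∧ y' = (y : ℕ) then 1 else 0) := by
  filter_upwards [eventually_gt_atTop ((μ.rowLen 0 : ℤ) + μ.colLen 0)] with N hN x y
  have hd : ((((x : ℕ) + 1 : ℕ) : ZMod d)) ≠ 0 := by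
    intro h
    have h1 := Nat.le_of_dvd (by omega) ((ZMod.natCast_eq_zero_iff _ _).1 h)
    have := x.2
    omega
  have hcast : ∀ k : ℕ, μ.rowLen k ≡ (k + 1) + (y : ℕ) [MOD e] ↔
      ((μ.rowLen k - k - 1 : ℤ) : ZMod e) = (y : ℕ) := by
    intro k
    rw [← ZMod.natCast_eq_natCast_iff]
    push_cast
    constructor <;> intro h <;> linear_combination h
  have hrow : ∀ k, k < μ.colLen 0 → (μ.rowLen k : ℤ) - k - 1 < N ∧ -N ≤ (μ.rowLen k : ℤ) - k - 1 := by
    intro k hk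
    have := μ.rowLen_anti 0 k (Nat.zero_le k)
    omega
  unfold Profile.beadSum
  simp only [← ite_and]
  rw [runnerMatrix, Finset.sum_boole, Nat.cast_inj]
  refine Finset.card_bij (fun k _ => (μ.rowLen k : ℤ) - k - 1) ?_ ?_ ?_
  · intro k hk
    simp only [mem_filter, mem_range, mem_Ico] at hk ⊢
    obtain ⟨h1, h2, h3⟩ := hk
    have h4 := hrow k h1
    refine ⟨⟨h4.2, h4.1⟩, (μ.bead_row k).1, ?_, (hcast k).1 h3⟩
    rw [(μ.bead_row k).2]
    exact_mod_cast (ZMod.natCast_eq_natCast_iff _ _ _).2 h2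
  · intro k _ k' _ h
    have h1 := μ.rowLen_anti k k'
    have h2 := μ.rowLen_anti k' k
    rcases le_total k k' with h3 | h3
    · have := h1 h3; omega
    · have := h2 h3; omega
  · intro p hp
    simp only [mem_filter, mem_range, mem_Ico] at hp ⊢
    obtain ⟨-, h1, h2, h3⟩ := hp
    obtain ⟨k, h4, h5⟩ := exists_row_of_bead h1
    rw [h5] at h2
    rw [h4] at h3
    refine ⟨k, ⟨?_, (ZMod.natCast_eq_natCast_iff _ _ _).1 (by exact_mod_cast h2), (hcast k).2 h3⟩,
      h4.symm⟩
    by_contra h6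
    have h7 : ¬ 0 < μ.rowLen k := by rwa [← mem_iff_lt_rowLen, mem_iff_lt_colLen]
    rw [show μ.rowLen k = 0 by omega] at h2
    exact hd (by rw [← h2]; simp)

/-- A diagram without `e` consecutive equal rows is regular. -/
theorem isRegular_of_rowLen (he : 0 < e)
    (h : ∀ i, 0 < μ.rowLen i → μ.rowLen (i + (e - 1)) ≠ μ.rowLen i) : IsRegular e μ := by
  intro k
  have hcount : ∀ n, ((List.range n).map μ.rowLen).count k =
      ((range n).filter fun i => μ.rowLen i = k).card := by
    intro n
    induction n with
    | zero => simp
    | succ n ih =>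
      rw [List.range_succ, List.map_append, List.count_append, ih, Finset.range_add_one,
        Finset.filter_insert]
      by_cases hk : μ.rowLen n = k
      · rw [if_pos hk, Finset.card_insert_of_notMem (by simp)]
        simp [hk]
      · rw [if_neg hk]
        simp [hk]
  rw [rowLens, hcount]
  set s := (range (μ.colLen 0)).filter fun i => μ.rowLen i = k
  rcases s.eq_empty_or_nonempty with hs | hs
  · rw [hs]; simpa using he
  obtain ⟨i, hi, hm⟩ := s.exists_min_image id hs
  -- the rows of length `k` are consecutive, and fewer than `e`
  have h1 : s ⊆ Ico i (i + (e - 1)) := by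
    intro j hj
    refine mem_Ico.2 ⟨hm j hj, ?_⟩
    by_contra h2
    simp only [s, mem_filter, mem_range] at hi hj
    have h3 := μ.rowLen_anti i (i + (e - 1)) (by omega)
    have h4 := μ.rowLen_anti (i + (e - 1)) j (by omega)
    refine h i ?_ (by omega)
    rw [← mem_iff_lt_rowLen, mem_iff_lt_colLen]
    exact hi.1
  have h2 := Finset.card_le_card h1
  rw [Nat.card_Ico] at h2
  omega

/-- A run of `e` beads with the same positive label is the same as `e` equal rows. -/
theorem isRegular_of_profile (he : 0 < e)
    (h : ∀ p, 0 < μ.profile.g p → μ.profile.g (p + e) ≠ μ.profile.g p) : IsRegular e μ := by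
  refine isRegular_of_rowLen he fun i hi hr => ?_
  obtain ⟨h1, h2⟩ := μ.bead_row i
  obtain ⟨h3, h4⟩ := μ.bead_row (i + (e - 1))
  unfold Profile.Bead at h1
  refine h (μ.rowLen (i + (e - 1)) - (i + (e - 1) : ℕ) - 1) (by omega) ?_
  rw [show (μ.rowLen (i + (e - 1)) : ℤ) - (i + (e - 1) : ℕ) - 1 + e = μ.rowLen i - i - 1 + 1 by
    rw [hr]; omega]
  omega

end YoungDiagram

namespace YoungDiagram

variable {μ ν : YoungDiagram} {i j e t : ℕ} {p q : ℤ}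

/-! ### The Mullineux symbol -/

theorem card_cells (μ : YoungDiagram) : (μ.cells.card : ℤ) = μ.profile.size := by
  obtain ⟨N, h1, h2⟩ := (μ.profile.eventually_size.and
    (eventually_gt_atTop ((μ.rowLen 0 : ℤ) + μ.colLen 0))).exists
  rw [h1, Finset.card_eq_sum_card_fiberwise (f := fun b => (b.2 : ℤ) - b.1) (t := Ico (-N) N)]
  · push_cast
    refine Finset.sum_congr rfl fun p _ => ?_
    have h3 : ({b ∈ μ.cells | (b.2 : ℤ) - b.1 = p}).card =
        (Ico (max 0 p) (μ.profile.g p)).card := by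
      refine Finset.card_bij' (fun b _ => (b.2 : ℤ)) (fun j _ => ((j - p).toNat, j.toNat)) ?_ ?_ ?_ ?_
      · rintro ⟨i, j⟩ hb
        rw [mem_filter, mem_cells, mem_iff_profile] at hb
        obtain ⟨h4, h5⟩ := hb
        simp only at h5
        rw [h5] at h4
        simp only [mem_Ico]
        omega
      · intro j hj
        rw [mem_Ico] at hj
        have h4 : ((j.toNat : ℕ) : ℤ) - ((j - p).toNat : ℕ) = p := by omega
        rw [mem_filter, mem_cells, mem_iff_profile, h4]
        simp only [and_true]
        omega
      · rintro ⟨i, j⟩ hb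
        rw [mem_filter] at hb
        simp only at hb
        ext <;> simp only <;> omega
      · intro j hj
        rw [mem_Ico] at hj
        simp only
        omega
    rw [h3, Int.card_Ico, profile_s, sub_zero]
    have := μ.profile.nonneg p
    have := μ.le_profile p
    omega
  · rintro ⟨i, j⟩ hb
    have hb : (i, j) ∈ μ := hb
    have h3 := mem_iff_lt_colLen.1 (μ.up_left_mem le_rfl (Nat.zero_le j) hb)
    have h4 := mem_iff_lt_rowLen.1 (μ.up_left_mem (Nat.zero_le i) le_rfl hb)
    simp only [coe_Ico, Set.mem_Ico]
    omega

theorem colLen_zero (μ : YoungDiagram) :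
    (μ.colLen 0 : ℤ) = μ.profile.size - μ.profile.col.size := by
  obtain ⟨h1, h2⟩ := μ.gap_col 0
  unfold Profile.Gap at h1
  rw [Profile.size_sub_size_col (u := ((0 : ℕ) : ℤ) - μ.colLen 0), profile_s]
  · push_cast; ring
  · intro p hp
    have := μ.profile.mono hp
    have := μ.profile.nonneg p
    omega
  · intro p hp
    have := μ.profile.mono (show ((0 : ℕ) : ℤ) - μ.colLen 0 + 1 ≤ p by omega)
    omega

theorem mem_rimSegment : (i, j) ∈ rimSegment e μ t ↔
    (i, j) ∈ μ.rim ∧ t ≤ i ∧ (μ.rowLen t : ℤ) - t - 1 - e < j - i := by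
  rw [rimSegment, mem_filter]
  refine and_congr_right fun _ => ?_
  simp only
  omega

theorem le_of_mem_rim (h : (i, j) ∈ μ.rim) (ht : t ≤ i) : (j : ℤ) - i ≤ μ.rowLen t - t - 1 := by
  have h1 := mem_iff_lt_rowLen.1 (mem_rim.1 h).1
  have h2 := μ.rowLen_anti t i ht
  omega

/-- The number of the row in which the next segment starts is the number of beads from `P` on, where
`P` is the lowest diagonal of the current segment. The maximum accounts for a last segment of length
less than `e`, which stops at the diagonal of the last row. -/
theorem nextStart_eq (he : 0 < e) (ht : t < μ.colLen 0) {P : ℤ}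
    (hP : P = max ((μ.rowLen t : ℤ) - t - 1 - e + 1) (1 - μ.colLen 0)) :
    (nextStart e μ t : ℤ) = μ.profile.g P - P := by
  obtain ⟨h1, h2⟩ := μ.bead_row t
  obtain ⟨h3, h4⟩ := μ.gap_col 0
  unfold Profile.Gap at h3
  have hr : 0 < μ.rowLen t := by rwa [← mem_iff_lt_rowLen, mem_iff_lt_colLen]
  have h5 := μ.profile.mono (show ((0 : ℕ) : ℤ) - μ.colLen 0 + 1 ≤ P by omega)
  have h6 := μ.profile.anti (show P ≤ (μ.rowLen t : ℤ) - t - 1 by omega)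
  have hsup : (rimSegment e μ t).sup Prod.fst = (μ.profile.g P - P - 1).toNat := by
    refine le_antisymm (Finset.sup_le ?_) ?_
    · rintro ⟨i, j⟩ hb
      rw [mem_rimSegment, mem_rim, mem_iff_lt_colLen] at hb
      obtain ⟨⟨h7, h8⟩, h9, h10⟩ := hb
      have h11 := μ.colLen_anti 0 j (Nat.zero_le j)
      have h12 := μ.profile.anti (show P ≤ (j : ℤ) - i by omega)
      change i ≤ _
      omega
    · refine Finset.le_sup (f := Prod.fst)
        (b := ((μ.profile.g P - P - 1).toNat, (μ.profile.g P - 1).toNat)) ?_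
      have h7 : (((μ.profile.g P - 1).toNat : ℕ) : ℤ) - ((μ.profile.g P - P - 1).toNat : ℕ) = P := by
        omega
      rw [mem_rimSegment, mem_rim, mem_iff_profile, h7]
      omega
  rw [nextStart, hsup]
  omega

/-- If the segment that starts in row `t` starts a run of the sweep and does not reach the end of
the rim, then the next segment also starts a run, and the diagonals between the two are skipped. -/
theorem sweep_nextStart (he : 0 < e) (ht : t < μ.colLen 0)
    (hs : Profile.sweep e μ.profile (μ.rowLen t - t - 1) = e)
    (hc : -(μ.colLen 0 : ℤ) ≤ μ.rowLen t - t - 1 - e) :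
    (∀ p, (μ.rowLen (nextStart e μ t) : ℤ) - nextStart e μ t - 1 < p → p ≤ μ.rowLen t - t - 1 - e →
      Profile.sweep e μ.profile p = 0) ∧
    Profile.sweep e μ.profile (μ.rowLen (nextStart e μ t) - nextStart e μ t - 1) = e := by
  have h1 := nextStart_eq he ht (P := (μ.rowLen t : ℤ) - t - 1 - e + 1) (by omega)
  set t' := nextStart e μ t
  set b : ℤ := μ.rowLen t' - t' - 1 with hbdef
  set c : ℤ := (μ.rowLen t : ℤ) - t - 1 - e with hcdef
  obtain ⟨h2, h3⟩ := μ.bead_row t'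
  rw [← hbdef] at h2 h3
  have hbead := h2
  unfold Profile.Bead at h2
  have hbc : b ≤ c := by
    by_contra h
    have := μ.profile.anti (show c + 1 ≤ b by omega)
    omega
  have h4 : Profile.sweep e μ.profile (c + 1) = 1 := by
    have := Profile.sweep_sub (a := μ.profile) (e := e) (b := μ.rowLen t - t - 1) (n := e - 1)
      (by omega)
    rw [hs, show (μ.rowLen t : ℤ) - t - 1 - (e - 1 : ℕ) = c + 1 by omega] at this
    omega
  have hgap : ∀ p, b < p → p ≤ c → μ.profile.Gap p := by
    intro p hp hp'
    have h5 := μ.profile.anti (show b + 1 ≤ p by omega)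
    have h6 := μ.profile.anti (show p ≤ p + 1 by omega)
    have h7 := μ.profile.anti (show p + 1 ≤ c + 1 by omega)
    unfold Profile.Gap
    omega
  have hzero : ∀ n : ℕ, b < c - n → Profile.sweep e μ.profile (c - n) = 0 := by
    intro n
    induction n with
    | zero =>
      intro hn
      rw [Profile.sweep_eq, Nat.cast_zero, sub_zero, h4, if_neg (by omega),
        if_neg (Profile.not_bead.2 (hgap c (by omega) le_rfl))]
    | succ n ih =>
      intro hn
      push_cast at hn
      rw [Profile.sweep_eq, show c - (n + 1 : ℕ) + 1 = c - n by push_cast; ring, ih (by omega),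
        if_neg (by omega), if_neg (Profile.not_bead.2 (hgap _ (by push_cast; omega) (by omega)))]
  have hz : ∀ p, b < p → p ≤ c → Profile.sweep e μ.profile p = 0 := by
    intro p hp hp'
    have := hzero (c - p).toNat (by omega)
    rwa [show c - (c - p).toNat = p by omega] at this
  refine ⟨hz, ?_⟩
  rw [Profile.sweep_eq, if_neg, if_pos hbead]
  rcases hbc.eq_or_lt with h | h
  · rw [h, h4]; omega
  · rw [hz (b + 1) (by omega) (by omega)]; omega

theorem sweep_segmentStart (he : 0 < e) (k : ℕ) (hk : segmentStart e μ k < μ.colLen 0) :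
    Profile.sweep e μ.profile (μ.rowLen (segmentStart e μ k) - segmentStart e μ k - 1) = e := by
  induction k with
  | zero =>
    change Profile.sweep e μ.profile (μ.rowLen 0 - (0 : ℕ) - 1) = e
    obtain ⟨h1, h2⟩ := μ.bead_row 0
    have htop : ∀ p, (μ.rowLen 0 : ℤ) - (0 : ℕ) - 1 < p → μ.profile.g p = p - μ.profile.s := by
      intro p hp
      unfold Profile.Bead at h1
      have h3 := μ.profile.anti (show (μ.rowLen 0 : ℤ) - (0 : ℕ) - 1 + 1 ≤ p by omega)
      have h4 := μ.le_profile p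
      rw [profile_s]
      push_cast at *
      omega
    rw [Profile.sweep_eq, Profile.sweep_of_top htop (by omega), if_neg (by omega), if_pos h1]
  | succ k ih =>
    have h1 := le_max_left (segmentStart e μ k) ((rimSegment e μ (segmentStart e μ k)).sup Prod.fst)
    have hk' : segmentStart e μ k < μ.colLen 0 := by
      rw [segmentStart_succ, nextStart] at hk
      omega
    rw [segmentStart_succ] at hk ⊢
    refine (sweep_nextStart he hk' (ih hk') ?_).2
    by_contra hc
    have h2 := nextStart_eq he hk' (P := 1 - μ.colLen 0) (by omega)
    obtain ⟨h3, h4⟩ := μ.gap_col 0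
    have h5 := μ.profile.mono (show ((0 : ℕ) : ℤ) - μ.colLen 0 + 1 ≤ 1 - μ.colLen 0 by omega)
    unfold Profile.Gap at h3
    omega

/-- The `e`-rim consists of the rim boxes on the swept diagonals. -/
theorem mem_eRim (he : 0 < e) : (i, j) ∈ eRim e μ ↔
    (i, j) ∈ μ.rim ∧ Profile.sweep e μ.profile (j - i) ≠ 0 := by
  rw [eRim, mem_biUnion]
  constructor
  · rintro ⟨k, -, h⟩
    obtain ⟨h1, h2, h3⟩ := mem_rimSegment.1 h
    refine ⟨h1, ?_⟩
    have h4 := le_of_mem_rim h1 h2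
    have h5 := mem_iff_lt_colLen.1 (mem_rim.1 h1).1
    have h6 := μ.colLen_anti 0 j (Nat.zero_le j)
    have h7 := sweep_segmentStart (μ := μ) he k (by omega)
    set b : ℤ := μ.rowLen (segmentStart e μ k) - segmentStart e μ k - 1
    have h8 := Profile.sweep_sub (a := μ.profile) (e := e) (b := b) (n := (b - (j - i)).toNat)
      (by omega)
    rw [show b - (b - ((j : ℤ) - i)).toNat = j - i by omega] at h8
    omega
  · rintro ⟨h1, h2⟩
    have h3 := mem_iff_lt_colLen.1 (mem_rim.1 h1).1
    have h4 := μ.colLen_anti 0 j (Nat.zero_le j)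
    obtain ⟨k, hk, hk'⟩ : ∃ k, segmentStart e μ k ≤ i ∧ i < segmentStart e μ (k + 1) := by
      have h5 := Nat.findGreatest_spec (P := fun k => segmentStart e μ k ≤ i) (Nat.zero_le i)
        (Nat.zero_le i)
      refine ⟨Nat.findGreatest (fun k => segmentStart e μ k ≤ i) i, h5, ?_⟩
      by_contra h6
      have h7 := le_segmentStart e μ (Nat.findGreatest (fun k => segmentStart e μ k ≤ i) i + 1)
      exact Nat.findGreatest_is_greatest (P := fun k => segmentStart e μ k ≤ i) (n := i)
        (Nat.lt_succ_self _) (h7.trans (not_lt.1 h6)) (not_lt.1 h6)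
    have h5 := le_segmentStart e μ k
    refine ⟨k, mem_range.2 (by omega), mem_rimSegment.2 ⟨h1, hk, ?_⟩⟩
    by_contra h6
    have h7 := sweep_segmentStart (μ := μ) he k (by omega)
    rw [segmentStart_succ] at hk'
    refine h2 ((sweep_nextStart he (by omega) h7 (by omega)).1 _ ?_ (by omega))
    have h8 := (mem_rim.1 h1).2
    obtain ⟨h9, h10⟩ := μ.bead_row (nextStart e μ (segmentStart e μ k))
    by_contra h11
    have := μ.profile.anti (not_lt.1 h11)
    omega

theorem profile_removeERim [NeZero e] (μ : YoungDiagram) :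
    (removeERim e μ).profile = (Profile.trim e μ.profile).col := by
  refine profile_eq_of_mem_iff (by rw [Profile.col_s, Profile.trim_s, profile_s]; rfl)
    fun i j => ?_
  have h1 : (i, j) ∈ removeERim e μ ↔ (i, j) ∈ μ ∧ (i, j) ∉ eRim e μ := Finset.mem_sdiff
  rw [h1, mem_eRim (NeZero.pos e), mem_rim, mem_iff_profile, Profile.col_g, Profile.trim_g]
  rcases Profile.skip_cases e μ.profile (j - i) with ⟨h2, h3⟩ | ⟨h2, h3⟩ <;> rw [h3] <;> omega

theorem profile_removeERim_iterate [NeZero e] (μ : YoungDiagram) (i : ℕ) :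
    ((removeERim e)^[i] μ).profile = Profile.col^[i] ((Profile.trim e)^[i] μ.profile) := by
  induction i with
  | zero => rfl
  | succ i ih =>
    rw [Function.iterate_succ_apply', profile_removeERim, ih, Profile.trim_col_iterate,
      ← Function.iterate_succ_apply' (Profile.trim e), ← Function.iterate_succ_apply' Profile.col]

/-- The first row of the Mullineux symbol in terms of the array of sizes. -/
theorem mullineuxA_eq [NeZero e] (μ : YoungDiagram) (i : ℕ) : (mullineuxA e μ i : ℤ) =
    Profile.arr e μ.profile i i - Profile.arr e μ.profile (i + 1) (i + 1) := by
  rw [Profile.arr, Profile.arr, ← profile_removeERim_iterate, ← profile_removeERim_iterate,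
    ← card_cells, ← card_cells, Function.iterate_succ_apply', mullineuxA]
  have h1 : eRim e ((removeERim e)^[i] μ) ⊆ ((removeERim e)^[i] μ).cells := by
    rintro ⟨i, j⟩ h
    exact (mem_rim.1 ((mem_eRim (NeZero.pos e)).1 h).1).1
  have h2 := Finset.card_sdiff_add_card_eq_card h1
  change _ = _ - ((((removeERim e)^[i] μ).cells \ eRim e ((removeERim e)^[i] μ)).card : ℤ)
  omega

/-- The second row of the Mullineux symbol in terms of the array of sizes. -/
theorem mullineuxR_eq [NeZero e] (μ : YoungDiagram) (i : ℕ) : (mullineuxR e μ i : ℤ) =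
    Profile.arr e μ.profile i i - Profile.arr e μ.profile (i + 1) i := by
  rw [Profile.arr, Profile.arr, Function.iterate_succ_apply', ← profile_removeERim_iterate,
    ← colLen_zero, mullineuxR]

theorem eventually_arr_diag [NeZero e] (he : 1 < e) (a : Profile) :
    ∀ᶠ i in atTop, Profile.arr e a i i = 0 := by
  filter_upwards [a.eventually_size_col_iterate] with i hi
  have h1 : ∀ k, Profile.arr e a i k ≤ Profile.arr e a i 0 := by
    intro k
    induction k with
    | zero => exact le_rfl
    | succ k ih => exact (Profile.arr_trim_le he a i k).trans ih
  exact le_antisymm ((h1 i).trans hi.le) (Profile.arr_nonneg _ _ _)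

/-- A diagram is determined by its Mullineux symbol: the symbol gives the diagonal and subdiagonal
of the array of sizes, hence its first column. -/
theorem eq_of_mullineux_eq (he : 1 < e) (hA : ∀ i, mullineuxA e μ i = mullineuxA e ν i)
    (hR : ∀ i, mullineuxR e μ i = mullineuxR e ν i) : μ = ν := by
  have : NeZero e := ⟨by omega⟩
  have h0 : ∀ i, Profile.arr e μ.profile i i = Profile.arr e ν.profile i i := by
    obtain ⟨n, hn⟩ := eventually_atTop.1
      ((eventually_arr_diag he μ.profile).and (eventually_arr_diag he ν.profile))
    intro i
    rcases le_total n i with h | h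
    · rw [(hn i h).1, (hn i h).2]
    · induction h using Nat.decreasingInduction with
      | self => rw [(hn n le_rfl).1, (hn n le_rfl).2]
      | of_succ i _ ih =>
        have h3 := mullineuxA_eq (e := e) μ i
        have h4 := mullineuxA_eq (e := e) ν i
        rw [hA i] at h3
        omega
  have h1 : ∀ i, Profile.arr e μ.profile (i + 1) i = Profile.arr e ν.profile (i + 1) i := by
    intro i
    have h3 := mullineuxR_eq (e := e) μ i
    have h4 := mullineuxR_eq (e := e) ν i
    have h5 := h0 i
    rw [hR i] at h3
    omega
  refine profile_injective (Profile.eq_of_size_col_iterate rfl fun i => ?_)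
  have h2 := Profile.arr_eq_of_diag he h0 h1 i 0
  simpa [Profile.arr] using h2

/-- If the array of `ν` is the transpose of that of `μ`, then `ν` is the Mullineux image of `μ`. The
`A`-entries lie on the diagonal and agree, and the `R`-entries are related by the recurrence of the
array at the diagonal. -/
theorem isMullineuxImage_of_arr [NeZero e] (he : 1 < e) (hν : IsRegular e ν)
    (h : ∀ i, Profile.arr e ν.profile i 0 = Profile.arr e μ.profile 0 i) :
    IsMullineuxImage e μ ν := by
  have h1 := Profile.arr_transpose he h
  refine ⟨hν, fun i => ?_⟩
  have h2 := mullineuxA_eq (e := e) μ i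
  have h3 := mullineuxA_eq (e := e) ν i
  have h4 := mullineuxR_eq (e := e) μ i
  have h5 := mullineuxR_eq (e := e) ν i
  have h6 := Profile.arr_recurrence he μ.profile i i
  rw [h1, h1] at h3 h5
  have h7 : (e : ℤ) ∣ Profile.arr e μ.profile i i - Profile.arr e μ.profile (i + 1) (i + 1) ↔
      e ∣ mullineuxA e μ i := by rw [← h2, Int.natCast_dvd_natCast]
  simp only [h7] at h6
  refine ⟨by omega, ?_⟩
  split_ifs at h6 ⊢ <;> omega

theorem IsMullineuxImage.unique {lam : YoungDiagram} (he : 1 < e) (h1 : IsMullineuxImage e lam μ)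
    (h2 : IsMullineuxImage e lam ν) : μ = ν := by
  refine eq_of_mullineux_eq he (fun i => ?_) fun i => ?_
  · rw [(h1.2 i).1, (h2.2 i).1]
  · have := (h1.2 i).2
    have := (h2.2 i).2
    omega

end YoungDiagram

namespace Profile

variable {d e : ℕ} {a b : Profile}

/-! ### Regularity -/

/-- Regularity of balanced profiles. A run of `e` beads with label `m` meets every residue class:
for `m = 1` that of a zero of the runner matrix, and for `m ≥ 2` that of the gap with label `m - 2`,
which contradicts balance. -/
theorem Balanced.g_add_ne (hd : 1 < d) (he : 0 < e) (hb : Balanced d e a) (hz : HasZero d e a)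
    {p : ℤ} (hp : 0 < a.g p) : a.g (p + e) ≠ a.g p := by
  intro h
  have hbead : ∀ x, p ≤ x → x < p + e → a.Bead x ∧ a.g x = a.g p := by
    intro x h1 h2
    have h3 := a.mono h1
    have h4 := a.mono (show x ≤ x + 1 by omega)
    have h5 := a.mono (show x + 1 ≤ p + e by omega)
    unfold Bead
    omega
  rcases (show a.g p = 1 ∨ 2 ≤ a.g p by omega) with h1 | h1
  · obtain ⟨y, hy⟩ := hz
    obtain ⟨x, hx, hx', hxy⟩ := Int.exists_mem_Ico_cast_eq he p y
    obtain ⟨h2, h3⟩ := hbead x hx hx'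
    refine hy x hxy h2 ?_
    rw [h3, h1]; norm_num
  · -- `z` is the gap with label `a.g p - 2`
    obtain ⟨u, hu, -⟩ := a.exists_firstGap
    obtain ⟨z, hz1, hm⟩ := Int.exists_greatest_of_bdd (P := fun x => a.g x ≤ a.g p - 2)
      ⟨p, fun z hz => by by_contra h2; have := a.mono (not_le.1 h2).le; omega⟩
      ⟨u, by rw [hu u le_rfl]; omega⟩
    have hz2 : a.g p - 2 < a.g (z + 1) := by
      by_contra h2
      have := hm (z + 1) (by omega); omega
    have hstep := a.step z
    have hzp : z < p := by
      by_contra h2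
      have := a.mono (not_lt.1 h2); omega
    obtain ⟨x, hx, hx', hxz⟩ := Int.exists_mem_Ico_cast_eq he p z
    obtain ⟨h2, h3⟩ := hbead x hx hx'
    have h4 := hb z x (by omega) hxz.symm (by unfold Gap; omega) h2
    rw [h3, show a.g z = a.g p - 2 by omega] at h4
    push_cast at h4
    exact one_ne_zero_of hd (by linear_combination h4)

/-- Regularity of conjugates of shift balanced profiles. A bead directly above `e` gaps forces `d ∣
e`. -/
theorem ShiftBalanced.conj_g_add_ne [NeZero e] (hd : 1 < d) (hcop : Nat.Coprime d e)
    (hb : ShiftBalanced d e a) {p : ℤ} (hp : 0 < a.conj.g p) : a.conj.g (p + e) ≠ a.conj.g p := by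
  intro h
  rw [conj_g] at hp
  rw [conj_g, conj_g] at h
  have he := NeZero.pos e
  -- the lowest bead `r` from `-p` on
  obtain ⟨t, ht, ht'⟩ := a.exists_top
  have htp : -p ≤ t := by
    by_contra h1
    rw [ht' _ (by omega)] at hp; omega
  obtain ⟨r, ⟨hr, hr1⟩, hm⟩ := Int.exists_least_of_bdd (P := fun x => -p ≤ x ∧ a.Bead x)
    ⟨-p, fun z hz => hz.1⟩ ⟨t, htp, ht⟩
  have hgap : ∀ x, -p - e ≤ x → x < r → a.Gap x := by
    intro x h1 h2
    by_contra h3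
    rw [not_gap] at h3
    rcases lt_or_ge x (-p) with h4 | h4
    · have h5 := a.anti h1
      have h6 := a.anti (show x + 1 ≤ -p by omega)
      unfold Bead at h3
      rw [show -(p + (e : ℤ)) = -p - e by ring] at h
      omega
    · have := hm x ⟨h4, h3⟩; omega
  have hlabel : ∀ n : ℕ, n ≤ e → a.g (r - e + n) = a.g (r - e) + n := by
    intro n
    induction n with
    | zero => simp
    | succ n ih =>
      intro hn
      have h1 := hgap (r - e + n) (by omega) (by omega)
      unfold Gap at h1
      rw [ih (by omega)] at h1
      push_cast
      rw [← add_assoc, h1]; ring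
  have h1 := hlabel e le_rfl
  rw [sub_add_cancel] at h1
  have h2 := hb (r - e) r (by omega) (by simp) (hgap _ (by omega) (by omega)) hr1
  rw [h1] at h2
  push_cast at h2
  exact cast_e_ne_zero hd hcop (by linear_combination h2)

/-! ### Runner matrix and core determine the labelled beads -/

theorem beadSum_eq_sum [NeZero d] [NeZero e] (a : Profile) (N : ℤ) (f : ZMod d → ZMod e → ℤ) :
    beadSum d e a N f = ∑ x : ZMod d, ∑ y : ZMod e,
      f x y * beadSum d e a N (fun x' y' => if x' = x ∧ y' = y then 1 else 0) := by
  simp only [beadSum, Finset.mul_sum]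
  rw [Finset.sum_congr rfl fun x _ => Finset.sum_comm, Finset.sum_comm]
  refine Finset.sum_congr rfl fun p _ => ?_
  split_ifs
  · simp [ite_and]
  · simp

theorem sum_beadSum_eq_beadCount [NeZero d] (a : Profile) (N : ℤ) (y : ZMod e) :
    ∑ x : ZMod d, beadSum d e a N (fun x' y' => if x' = x ∧ y' = y then 1 else 0) =
      beadCount e a N y := by
  rw [← beadSum_residue d]
  simp only [beadSum]
  rw [Finset.sum_comm]
  refine Finset.sum_congr rfl fun p _ => ?_
  split_ifs with h1 h2
  · simp [h2]
  · simp [h2]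
  · simp

/-- The numbers of beads with given nonzero label, together with the numbers of all beads, in the
residue classes determine the labelled beads. -/
theorem partner_of_counts [NeZero d] [NeZero e] (hs : a.s = b.s)
    (h1 : ∀ᶠ N : ℤ in atTop, ∀ x y, x ≠ 0 →
      beadSum d e a N (fun x' y' => if x' = x ∧ y' = y then 1 else 0) =
      beadSum d e b N (fun x' y' => if x' = x ∧ y' = y then 1 else 0))
    (h2 : ∀ᶠ N : ℤ in atTop, ∀ y : ZMod e, beadCount e a N y = beadCount e b N y) :
    Partner d e a b := by
  refine ⟨hs, ?_⟩
  filter_upwards [h1, h2] with N h1 h2 f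
  rw [beadSum_eq_sum, beadSum_eq_sum]
  refine Finset.sum_congr rfl fun x _ => Finset.sum_congr rfl fun y _ => ?_
  congr 1
  by_cases hx : x = 0
  · subst hx
    have h3 := h2 y
    rw [← sum_beadSum_eq_beadCount (d := d), ← sum_beadSum_eq_beadCount (d := d),
      ← Finset.add_sum_erase _ _ (mem_univ 0), ← Finset.add_sum_erase _ _ (mem_univ 0),
      Finset.sum_congr rfl fun x hx => h1 x y (Finset.ne_of_mem_erase hx)] at h3
    exact add_right_cancel h3
  · exact h1 x y hx

end Profile

namespace YoungDiagram

variable {d e : ℕ} {μ ν : YoungDiagram}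

/-- The runner matrix and the core together record the labelled beads. -/
theorem partner_iff (hd : 1 < d) (he : 0 < e) : Profile.Partner d e μ.profile ν.profile ↔
    runnerMatrix d e μ = runnerMatrix d e ν ∧ SameCore e μ ν := by
  have : NeZero d := ⟨by omega⟩
  have : NeZero e := ⟨by omega⟩
  rw [sameCore_iff he]
  constructor
  · rintro ⟨-, h⟩
    constructor
    · obtain ⟨N, h1, h2, h3⟩ :=
        (h.and ((runnerMatrix_eq d e μ).and (runnerMatrix_eq d e ν))).exists
      ext x y
      have := h2 x y
      rw [h1, ← h3] at this
      exact_mod_cast this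
    · filter_upwards [h] with N hN y
      rw [← Profile.beadSum_residue d, hN, Profile.beadSum_residue]
  · rintro ⟨h1, h2⟩
    refine Profile.partner_of_counts rfl ?_ h2
    filter_upwards [runnerMatrix_eq d e μ, runnerMatrix_eq d e ν] with N h3 h4 x y hx
    have hx0 : 0 < x.val := by
      rw [Nat.pos_iff_ne_zero, Ne, ZMod.val_eq_zero]; exact hx
    have hxd := ZMod.val_lt x
    have h5 := h3 ⟨x.val - 1, by omega⟩ ⟨y.val, ZMod.val_lt y⟩
    have h6 := h4 ⟨x.val - 1, by omega⟩ ⟨y.val, ZMod.val_lt y⟩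
    simp only [Nat.sub_add_cancel hx0, ZMod.natCast_zmod_val] at h5 h6
    rw [← h5, ← h6, h1]

theorem hasZero_of_runnerMatrix (hd : 1 < d)
    (h : ∃ y : Fin e, runnerMatrix d e μ ⟨0, Nat.sub_pos_of_lt hd⟩ y = 0) :
    Profile.HasZero d e μ.profile := by
  classical
  obtain ⟨y, hy⟩ := h
  refine ⟨(y : ℕ), fun p hp hbp hl => ?_⟩
  refine Profile.forall_bead_of_beadSum_eq_zero (d := d) (e := e)
    (P := fun x' y' => x' = 1 ∧ y' = (y : ℕ)) ?_ hbp ⟨hl, by exact_mod_cast hp⟩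
  filter_upwards [runnerMatrix_eq d e μ] with N hN
  have h1 := hN ⟨0, Nat.sub_pos_of_lt hd⟩ y
  rw [hy] at h1
  simp only [zero_add, Nat.cast_one] at h1
  rw [← h1]
  simp

end YoungDiagram

theorem mainTheorem1 (d e : ℕ) (hd : 1 < d) (hde : d < e) (hcop : Nat.Coprime d e)
    (lam : YoungDiagram) (hbal : YoungDiagram.IsBalanced d e lam)
    (hzero : ∃ y : Fin e, YoungDiagram.runnerMatrix d e lam ⟨0, Nat.sub_pos_of_lt hd⟩ y = 0) :
    YoungDiagram.IsRegular e lam ∧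
    (∃! ν : YoungDiagram, YoungDiagram.IsMullineuxImage e lam ν) ∧
    YoungDiagram.IsMullineuxImage e lam (YoungDiagram.mullineux e lam) ∧
    YoungDiagram.IsShiftBalanced d e (YoungDiagram.mullineux e lam).transpose ∧
    YoungDiagram.runnerMatrix d e (YoungDiagram.mullineux e lam).transpose =
      YoungDiagram.runnerMatrix d e lam ∧
    YoungDiagram.SameCore e (YoungDiagram.mullineux e lam).transpose lam ∧
    ∀ κ : YoungDiagram,
      YoungDiagram.IsShiftBalanced d e κ →
      YoungDiagram.runnerMatrix d e κ = YoungDiagram.runnerMatrix d e lam →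
      YoungDiagram.SameCore e κ lam →
      κ = (YoungDiagram.mullineux e lam).transpose := by
  have he : 1 < e := hd.trans hde
  have he0 : 0 < e := by omega
  have : NeZero e := ⟨by omega⟩
  have hb := YoungDiagram.isBalanced_iff.1 hbal
  have hz := YoungDiagram.hasZero_of_runnerMatrix hd hzero
  obtain ⟨k, hk, hp, hi⟩ := Profile.exists_shiftBalanced hd he hcop lam.profile hb hz
  obtain ⟨κ, rfl⟩ := YoungDiagram.exists_profile_eq hp.1.symm
  have hp' : Profile.Partner d e κ.profile lam.profile :=
    ⟨hp.1.symm, hp.2.mono fun N hN f => (hN f).symm⟩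
  have himage : YoungDiagram.IsMullineuxImage e lam κ.transpose := by
    refine YoungDiagram.isMullineuxImage_of_arr he ?_ fun i => ?_
    · refine YoungDiagram.isRegular_of_profile he0 fun p hp => ?_
      rw [YoungDiagram.profile_transpose] at hp ⊢
      exact hk.conj_g_add_ne hd hcop hp
    · rw [YoungDiagram.profile_transpose]
      exact hi i
  have hmull : YoungDiagram.mullineux e lam = κ.transpose :=
    (Classical.epsilon_spec ⟨_, himage⟩ : YoungDiagram.IsMullineuxImage e lam _).unique he himage
  rw [hmull, YoungDiagram.transpose_transpose]
  obtain ⟨h1, h2⟩ := (YoungDiagram.partner_iff hd he0).1 hp'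
  refine ⟨YoungDiagram.isRegular_of_profile he0 fun p hp => hb.g_add_ne hd he0 hz hp,
    ⟨_, himage, fun ν hν => hν.unique he himage⟩, himage,
    YoungDiagram.isShiftBalanced_iff.2 hk, h1, h2, fun κ' h3 h4 h5 => ?_⟩
  have h6 := (YoungDiagram.partner_iff hd he0).2 ⟨h4, h5⟩
  refine YoungDiagram.profile_injective
    ((YoungDiagram.isShiftBalanced_iff.1 h3).eq_of_partner hd hcop hk ⟨h6.1.trans hp.1, ?_⟩)
  filter_upwards [h6.2, hp.2] with N h7 h8 f
  rw [h7, h8]
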